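/- **Setting.** Fix disjoint finite sets $\mathcal X$ (inputs) and $\mathcal Y$ (outputs) of propositional variables and a subset $\mathcal X_{unr}\subseteq\mathcal X$ of unreliable inputs. LTL$_f$ formulas are given by $\varphi ::= A \mid \neg\varphi \mid \varphi\wedge\psi \mid \circ\varphi \mid \varphi\,\mathcal U\,\psi$ with $A\in\mathcal X\cup\mathcal Y$, interpreted on finite nonempty traces over $2^{\mathcal X\cup\mathcal Y}$ in the usual way ($\circ\varphi$ requires that a next position exists); $t\models\varphi$ means satisfaction at the first position. A strategy is a map $\sigma:(2^{\mathcal X})^*\to 2^{\mathcal Y}$; with an infinite input sequence $\lambda=(X_0,X_1,\dots)$ and $k\in\mathbb N$ it produces the trace $t_{\sigma,\lambda,k}=((X_0,Y_0),\dots,(X_k,Y_k))$, where $Y_i=\sigma(X_0,\dots,X_{i-1})$. Write $t'\sim_{-\mathcal X_{unr}}t$ if $t',t$ have the same length and agree on all variables outside $\mathcal X_{unr}$ at every position. A strategy $\sigma$ *solves synthesis under unreliable input* for $(\varphi_m,\varphi_b,\mathcal X_{unr})$ if for every $\lambda$ there is a $k$ such that $t_{\sigma,\lambda,k}\models\varphi_m$,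 and $t'\models\varphi_b$ for every $t'\sim_{-\mathcal X_{unr}}t_{\sigma,\lambda,k}$. A strategy $\sigma$ *wins the game* on a DFA $\mathcal G$ over $2^{\mathcal X\cup\mathcal Y}$ if for every $\lambda$ there is a $k$ such that $\mathcal G$ accepts $t_{\sigma,\lambda,k}$. For a DFA $\mathcal A$ with states $S$, initial state $s_0$, transition function $\delta$ and final states $F$, the *belief-state automaton* $\mathcal G^{rel}_{\mathcal A}$ has states $2^S$, initial state $\{s_0\}$, final states $2^F$, and transitions $$\partial(B,X\cup Y)=\{\delta(s,X'\cup Y)\mid s\in B,\ X'\subseteq\mathcal X,\ X'\setminus\mathcal X_{unr}=X\setminus\mathcal X_{unr}\}.$$ The *synchronous product* $\mathcal A_1\otimes\mathcal A_2$ has states $S_1\times S_2$, componentwise transitions, and final states $F_1\times F_2$. Objects are encoded as bit strings in a standard way (automata and finite-state strategies with their transition tables written out over all letters), and running time is the number of steps of a deterministic multi-stack Turing machine. For $k\ge 1$, a function is computable in $k$EXPTIME if some machine computes it in time $2^{2^{\cdot^{\cdot^{2^{p(n)}}}}}$ ($k$ twos) for a polynomial $p$, where $n$ is the input length. **Theorem.**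 The belief-state technique solves synthesis under unreliable input in 3EXPTIME. More precisely, there are the following procedures: 1. a procedure $\varphi\mapsto\mathcal A_\varphi$, computable in 2EXPTIME, where $\mathcal A_\varphi$ is a DFA whose language is exactly the set of (nonempty) traces that satisfy $\varphi$; 2. a procedure computable in EXPTIME (in the size of the explicitly given automaton) that sends $\mathcal X_{unr}$ and a DFA $\mathcal A$ to the belief-state automaton $\mathcal G^{rel}_{\mathcal A}$ (up to renaming of states); 3. a polynomial-time procedure that sends two DFAs to their synchronous product (up to renaming of states); 4. a polynomial-time procedure that, given a DFA game $\mathcal G$, returns a finite-state strategy that wins $\mathcal G$, or reports that no winning strategy exists; such that their composition, which for input $(\mathcal X,\mathcal Y,\mathcal X_{unr},\varphi_m,\varphi_b)$ applies procedure 4 to the game $\mathcal A_{\varphi_m}\otimes\mathcal G^{rel}_{\mathcal A_{\varphi_b}}$ built by procedures 1–3, is computable in 3EXPTIME, and always returns either a finite-state strategy that solves synthesis under unreliable input for $(\varphi_m,\varphi_b,\mathcal X_{unr})$, or, if and only if no strategy solves it, the report that there is none. -/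

import Mathlib

namespace UnreliableSynthesis

/-! ### Valuations, traces and linear temporal logic on finite traces -/

/-- A set of true variables, i.e. an element of `2^P`, given by its characteristic function. -/
abbrev Val (P : Type) : Type := P → Bool

/-- Formulas of linear temporal logic on finite traces over the variables `P`. -/
inductive LTLf (P : Type) : Type where
  | atom (A : P) : LTLf P
  | neg (φ : LTLf P) : LTLf P
  | and (φ ψ : LTLf P) : LTLf P
  | next (φ : LTLf P) : LTLf P
  | until (φ ψ : LTLf P) : LTLf P

/-- `Sat t φ i`: the trace `t` satisfies `φ` at position `i`; the positions are
`0, …, t.length - 1`. -/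
def Sat {P : Type} (t : List (Val P)) : LTLf P → ℕ → Prop
  | .atom A, i => ∃ a : Val P, t[i]? = some a ∧ a A = true
  | .neg φ, i => ¬ Sat t φ i
  | .and φ ψ, i => Sat t φ i ∧ Sat t ψ i
  | .next φ, i => i + 1 < t.length ∧ Sat t φ (i + 1)
  | .until φ ψ, i => ∃ j, i ≤ j ∧ j < t.length ∧ Sat t ψ j ∧ ∀ k, i ≤ k → k < j → Sat t φ k

/-- A trace satisfies a formula if it does so at its first position. It is only applied to
nonempty traces. -/
def Models {P : Type} (t : List (Val P)) (φ : LTLf P) : Prop := Sat t φ 0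

/-- The projection that removes the variables in `V` from a trace. -/
def proj {P : Type} (V : Set P) (t : List (Val P)) : List (Val {p : P // p ∉ V}) :=
  t.map fun a p => a p.1

/-- The expansion of a trace without the variables in `V`: all traces that arise by setting the
variables in `V` in every possible way at all instants. -/
def expand {P : Type} (V : Set P) (u : List (Val {p : P // p ∉ V})) : Set (List (Val P)) :=
  {t | proj V t = u}

/-- The two traces are equal up to the variables in `V`. -/
def SimOff {P : Type} (V : Set P) (t t' : List (Val P)) : Prop := t ∈ expand V (proj V t')

/-! ### Strategies, synthesis under unreliable input, games on automata -/

/-- A strategy of the agent with input variables `X` and output variables `Y`. -/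
abbrev Strategy (X Y : Type) : Type := List (Val X) → Val Y

/-- The finite trace `((X₀, Y₀), …, (X_k, Y_k))` with `Y_i = σ (X₀, …, X_{i-1})`. -/
def play {X Y : Type} (σ : Strategy X Y) (w : ℕ → Val X) (k : ℕ) : List (Val (X ⊕ Y)) :=
  (List.range (k + 1)).map fun i => Sum.elim (w i) (σ ((List.range i).map w))

/-- The strategy `σ` solves synthesis under unreliable input, with main specification `φm`,
backup specification `φb` and unreliable input variables `U`. -/
def SolvesUnreliable {X Y : Type} (U : Set X) (φm φb : LTLf (X ⊕ Y)) (σ : Strategy X Y) : Prop :=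
  ∀ w : ℕ → Val X, ∃ k : ℕ,
    Models (play σ w k) φm ∧
      ∀ t' : List (Val (X ⊕ Y)), SimOff (Sum.inl '' U) t' (play σ w k) → Models t' φb

/-- The strategy `σ` wins the game on the automaton `M`: against every sequence of inputs, a
final state is reached after finitely many (and at least one) rounds. -/
def WinsGame {X Y S : Type} (M : DFA (Val (X ⊕ Y)) S) (σ : Strategy X Y) : Prop :=
  ∀ w : ℕ → Val X, ∃ k : ℕ, play σ w k ∈ M.accepts

/-- The language of `M` consists of the traces (nonempty words) that satisfy `φ`. -/
def RecognizesFormula {P S : Type} (M : DFA (Val P) S) (φ : LTLf P) : Prop :=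
  ∀ t : List (Val P), t ∈ M.accepts ↔ t ≠ [] ∧ Models t φ

/-- The belief-state automaton: the states are all sets of states of `M`, and a transition
collects the successors of all members under all values of the unreliable inputs `U`. -/
def beliefDFA {X Y S : Type} (U : Set X) (M : DFA (Val (X ⊕ Y)) S) :
    DFA (Val (X ⊕ Y)) (Set S) where
  step B a := {s' | ∃ s ∈ B, ∃ x' : Val X, (∀ i, i ∉ U → a (Sum.inl i) = x' i) ∧
    M.step s (Sum.elim x' fun j => a (Sum.inr j)) = s'}
  start := {M.start}
  accept := {B | B ⊆ M.accept}

/-! ### Finite objects that a machine can read and write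

The input variables are `Fin nX` and the output variables `Fin nY`. -/

/-- A deterministic automaton over the alphabet `2^(X ∪ Y)`, with states `0, …, n - 1`. -/
structure ExplicitDFA (nX nY : ℕ) : Type where
  n : ℕ
  start : Fin n
  step : Fin n → Val (Fin nX) → Val (Fin nY) → Fin n
  accept : Fin n → Bool

/-- The automaton as a `DFA`. -/
def ExplicitDFA.toDFA {nX nY : ℕ} (A : ExplicitDFA nX nY) :
    DFA (Val (Fin nX ⊕ Fin nY)) (Fin A.n) where
  step s a := A.step s (fun i => a (Sum.inl i)) (fun j => a (Sum.inr j))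
  start := A.start
  accept := {s | A.accept s = true}

/-- `A` is the automaton `M`, up to the names of the states. -/
def ExplicitDFA.Presents {nX nY : ℕ} {S : Type} (A : ExplicitDFA nX nY)
    (M : DFA (Val (Fin nX ⊕ Fin nY)) S) : Prop :=
  ∃ e : Fin A.n ≃ S, e A.toDFA.start = M.start ∧
    (∀ s a, e (A.toDFA.step s a) = M.step (e s) a) ∧
    ∀ s, s ∈ A.toDFA.accept ↔ e s ∈ M.accept

/-- A finite-state strategy: in state `s` the agent outputs `out s`, then reads an input. -/
structure Transducer (nX nY : ℕ) : Type where
  n : ℕ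
  start : Fin n
  step : Fin n → Val (Fin nX) → Fin n
  out : Fin n → Val (Fin nY)

/-- The strategy that a transducer carries out. -/
def Transducer.strategy {nX nY : ℕ} (T : Transducer nX nY) : Strategy (Fin nX) (Fin nY) :=
  fun h => T.out (h.foldl T.step T.start)

/-- An instance of synthesis under unreliable input; `unr` marks the unreliable inputs, all other
inputs are reliable. -/
structure Problem : Type where
  nX : ℕ
  nY : ℕ
  unr : Val (Fin nX)
  main : LTLf (Fin nX ⊕ Fin nY)
  backup : LTLf (Fin nX ⊕ Fin nY)

/-- The set of variables marked by a characteristic function. -/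
def markedSet {X : Type} (u : Val X) : Set X := {i | u i = true}

/-- `σ` solves the instance `I` of synthesis under unreliable input. -/
def Problem.IsSolution (I : Problem) (σ : Strategy (Fin I.nX) (Fin I.nY)) : Prop :=
  SolvesUnreliable (markedSet I.unr) I.main I.backup σ

/-- An answer to a search for a strategy is correct if it is a strategy with the wanted property,
or else reports that there is none. -/
def CorrectAnswer {nX nY : ℕ} (Good : Strategy (Fin nX) (Fin nY) → Prop) :
    Option (Transducer nX nY) → Prop
  | some T => Good T.strategy
  | none => ¬ ∃ σ, Good σ

/-! ### Inputs of the single steps -/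

/-- Input of the translation of a formula into an automaton. -/
structure FormulaInput : Type where
  nX : ℕ
  nY : ℕ
  formula : LTLf (Fin nX ⊕ Fin nY)

/-- Input of the belief-state construction. -/
structure BeliefInput : Type where
  nX : ℕ
  nY : ℕ
  unr : Val (Fin nX)
  dfa : ExplicitDFA nX nY

/-- Input of the synchronous product. -/
structure ProductInput : Type where
  nX : ℕ
  nY : ℕ
  left : ExplicitDFA nX nY
  right : ExplicitDFA nX nY

/-- Input of the game solver. -/
structure GameInput : Type where
  nX : ℕ
  nY : ℕ
  game : ExplicitDFA nX nY

/-! ### Encodings as bit strings -/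

/-- Binary trees, an intermediate data format. -/
inductive Data : Type where
  | nil : Data
  | cons (a b : Data) : Data

/-- The bit string of a tree (a prefix-free code). -/
def Data.bits : Data → List Bool
  | .nil => [false]
  | .cons a b => true :: (a.bits ++ b.bits)

/-- Lists as trees. -/
def Data.ofList : List Data → Data
  | [] => .nil
  | a :: l => .cons a (Data.ofList l)

/-- Natural numbers as trees, in unary. -/
def Data.ofNat : ℕ → Data
  | 0 => .nil
  | n + 1 => .cons .nil (Data.ofNat n)

/-- Booleans as trees. -/
def Data.ofBool : Bool → Data
  | false => .nil
  | true => .cons .nil .nil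

/-- Finite sequences as trees. -/
def Data.ofFn {n : ℕ} (f : Fin n → Data) : Data := Data.ofList (List.ofFn f)

/-- A table indexed by `2^k`, as a full binary tree of depth `k`; at the root one branches on
variable `0`. -/
def Data.ofTable : (k : ℕ) → (Val (Fin k) → Data) → Data
  | 0, f => f Fin.elim0
  | k + 1, f => .cons (Data.ofTable k fun v => f (Fin.cons false v))
      (Data.ofTable k fun v => f (Fin.cons true v))

/-- Valuations as trees. -/
def Data.ofVal {k : ℕ} (v : Val (Fin k)) : Data := Data.ofFn fun i => Data.ofBool (v i)

/-- Formulas as trees. -/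
def LTLf.data {nX nY : ℕ} : LTLf (Fin nX ⊕ Fin nY) → Data
  | .atom (Sum.inl i) => .cons (Data.ofNat 0) (Data.ofNat i.1)
  | .atom (Sum.inr j) => .cons (Data.ofNat 1) (Data.ofNat j.1)
  | .neg φ => .cons (Data.ofNat 2) φ.data
  | .and φ ψ => .cons (Data.ofNat 3) (.cons φ.data ψ.data)
  | .next φ => .cons (Data.ofNat 4) φ.data
  | .until φ ψ => .cons (Data.ofNat 5) (.cons φ.data ψ.data)

/-- Automata as trees, with the whole transition table written out. -/
def ExplicitDFA.data {nX nY : ℕ} (A : ExplicitDFA nX nY) : Data :=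
  Data.ofList [Data.ofNat nX, Data.ofNat nY, Data.ofNat A.n, Data.ofNat A.start.1,
    Data.ofFn fun s => Data.ofTable nX fun x => Data.ofTable nY fun y =>
      Data.ofNat (A.step s x y).1,
    Data.ofFn fun s => Data.ofBool (A.accept s)]

/-- Transducers as trees. -/
def Transducer.data {nX nY : ℕ} (T : Transducer nX nY) : Data :=
  Data.ofList [Data.ofNat nX, Data.ofNat nY, Data.ofNat T.n, Data.ofNat T.start.1,
    Data.ofFn fun s => Data.ofTable nX fun x => Data.ofNat (T.step s x).1,
    Data.ofFn fun s => Data.ofVal (T.out s)]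

/-- Answers as trees. -/
def answerData {nX nY : ℕ} : Option (Transducer nX nY) → Data
  | none => .nil
  | some T => .cons .nil T.data

/-- Instances as trees. -/
def Problem.data (I : Problem) : Data :=
  Data.ofList [Data.ofNat I.nX, Data.ofNat I.nY, Data.ofVal I.unr, I.main.data, I.backup.data]

/-- Inputs of the translation of formulas as trees. -/
def FormulaInput.data (i : FormulaInput) : Data :=
  Data.ofList [Data.ofNat i.nX, Data.ofNat i.nY, i.formula.data]

/-- Inputs of the belief-state construction as trees. -/
def BeliefInput.data (i : BeliefInput) : Data :=
  Data.ofList [Data.ofVal i.unr, i.dfa.data]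

/-- Inputs of the synchronous product as trees. -/
def ProductInput.data (i : ProductInput) : Data :=
  Data.ofList [i.left.data, i.right.data]

/-- Inputs of the game solver as trees. -/
def GameInput.data (i : GameInput) : Data := i.game.data

/-! ### Deterministic time classes -/

/-- The tower `2^(2^(…^x))` with `k` twos. -/
def expTower : ℕ → ℕ → ℕ
  | 0, x => x
  | k + 1, x => 2 ^ expTower k x

/-- The function that sends an input `a`, written as the bit string of `inp a`, to the bit string
of `out a` is computed by a multi-stack Turing machine within `2^(2^(…^p(n)))` steps (`k` twos),
for some polynomial `p`, where `n` is the number of bits of the input. The cases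
`k = 0, 1, 2, 3` are polynomial time, EXPTIME, 2EXPTIME and 3EXPTIME. -/
def ComputableInExpTime (k : ℕ) {α : Type} (inp : α → Data) (out : α → Data) : Prop :=
  ∃ c : Turing.TM2ComputableInTime (fun a => (inp a).bits) Data.bits out,
    ∃ p : Polynomial ℕ, ∀ n : ℕ, c.time n ≤ expTower k (p.eval n)

/-! ### The belief-state technique -/

/-- The belief-state technique, put together from a translation `toDFA` of formulas into automata,
a procedure `belief` for the belief-state automaton, a procedure `product` for the synchronous
product and a procedure `solve` for games on automata. -/
def beliefTechnique
    (toDFA : ∀ nX nY : ℕ, LTLf (Fin nX ⊕ Fin nY) → ExplicitDFA nX nY)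
    (belief : ∀ nX nY : ℕ, Val (Fin nX) → ExplicitDFA nX nY → ExplicitDFA nX nY)
    (product : ∀ nX nY : ℕ, ExplicitDFA nX nY → ExplicitDFA nX nY → ExplicitDFA nX nY)
    (solve : ∀ nX nY : ℕ, ExplicitDFA nX nY → Option (Transducer nX nY))
    (I : Problem) : Option (Transducer I.nX I.nY) :=
  solve I.nX I.nY
    (product I.nX I.nY (toDFA I.nX I.nY I.main)
      (belief I.nX I.nY I.unr (toDFA I.nX I.nY I.backup)))

end UnreliableSynthesis

open UnreliableSynthesis

/-! Correctness rests on an invariant of the belief-state automaton: its state after a trace `t` is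
the set of states that the backup automaton can reach on traces equal to `t` up to the unreliable
inputs (`mem_eval_beliefDFA`). It is final exactly if all these traces are accepted. So for each
strategy, input sequence and stopping time separately, the play meets both specifications iff the
product accepts it, and solving synthesis and winning the game are the same property of a strategy
(`solvesUnreliable_iff_winsGame`). The game is a reachability game. It is solved by an attractor
computation that records a move when a state enters the winning region; outside the region the
environment can stay outside forever (`ExplicitDFA.winner_wins`, `ExplicitDFA.not_wins`).

The automaton of a formula avoids nondeterminism. By the expansion laws, the relevant truth values
at a position are a function of the letter there and of the values at the next position. A forward
automaton therefore only has to remember the map from values at the position about to be read to the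
value of the formula at the first position. There are `2 ^ 2 ^ width` such maps, with a width linear
in the number of subformulas.

For the running times, `Code` is a small language on binary trees whose only recursion is the right
fold. `Code.within_prog` executes it on five stacks within `Code.cost`, and `Exec.reachesIn` turns
the stack programs into Turing machines. After that, machines no longer occur: `FeasibleIn k` is
closed under pairing, composition and folds, provided that all intermediate results of a fold have
an a priori size bound (`FeasibleIn.foldrIn`). Numbers are in unary, so writing down `2 ^ n` is the
only source of exponential time (`feasibleIn_one_two_pow`). Every construction is polynomial once
its number of states is given as part of the input. Tower heights add under composition
(`FeasibleIn.compose`): formulas need 1 + 1, belief states 1 more, product and solver 0, hence 3 in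
total. -/

namespace UnreliableSynthesis

/-! ### Structured programs over five stacks of bits -/

/-- The names of the stacks: `main` and `aux` hold sequences of trees, `marks` controls the
recursion on lists, `scratch` and `count` are used to move single trees. -/
inductive Reg : Type where
  | main | aux | marks | scratch | count
  deriving DecidableEq

/-- There are finitely many stacks. -/
instance : Fintype Reg :=
  ⟨{.main, .aux, .marks, .scratch, .count}, fun k => by cases k <;> decide⟩

/-- The contents of the stacks. -/
structure Stacks : Type where
  main : List Bool
  aux : List Bool
  marks : List Bool
  scratch : List Bool
  count : List Bool

/-- The contents of one stack. -/
def Stacks.get (S : Stacks) : Reg → List Bool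
  | .main => S.main
  | .aux => S.aux
  | .marks => S.marks
  | .scratch => S.scratch
  | .count => S.count

/-- Replace the contents of one stack. -/
def Stacks.set (S : Stacks) : Reg → List Bool → Stacks
  | .main, l => { S with main := l }
  | .aux, l => { S with aux := l }
  | .marks, l => { S with marks := l }
  | .scratch, l => { S with scratch := l }
  | .count, l => { S with count := l }

theorem Stacks.update_get (S : Stacks) (k : Reg) (l : List Bool) :
    Function.update S.get k l = (S.set k l).get := by
  funext j
  cases k <;> cases j <;> rfl

/-- Structured programs. `popIf k p q` pops a bit and runs `p` if it is `true`, otherwise `q`.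
`loop k p` pops a bit and runs `p` as long as the bit is `true`. `drain k p q` empties a stack and
runs `p` or `q` depending on the popped bit. -/
inductive Prog : Type where
  | push (k : Reg) (b : Bool)
  | seq (p q : Prog)
  | popIf (k : Reg) (p q : Prog)
  | loop (k : Reg) (p : Prog)
  | drain (k : Reg) (p q : Prog)

/-- Executions of programs, with the number of steps. -/
inductive Exec : Prog → Stacks → Stacks → ℕ → Prop where
  | push (k b S) : Exec (.push k b) S (S.set k (b :: S.get k)) 1
  | seq {p q S₁ S₂ S₃ m n} (hp : Exec p S₁ S₂ m) (hq : Exec q S₂ S₃ n) :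
      Exec (.seq p q) S₁ S₃ (m + n)
  | popTrue {k p q S S' n} {l : List Bool} (h : S.get k = true :: l)
      (hp : Exec p (S.set k l) S' n) : Exec (.popIf k p q) S S' (n + 1)
  | popFalse {k p q S S' n} {l : List Bool} (h : S.get k = false :: l)
      (hq : Exec q (S.set k l) S' n) : Exec (.popIf k p q) S S' (n + 1)
  | loopNil {k p S} (h : S.get k = []) : Exec (.loop k p) S (S.set k []) 1
  | loopFalse {k p S} {l : List Bool} (h : S.get k = false :: l) :
      Exec (.loop k p) S (S.set k l) 1
  | loopTrue {k p S S' S'' m n} {l : List Bool} (h : S.get k = true :: l)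
      (hp : Exec p (S.set k l) S' m) (hl : Exec (.loop k p) S' S'' n) :
      Exec (.loop k p) S S'' (n + m + 1)
  | drainNil {k p q S} (h : S.get k = []) : Exec (.drain k p q) S (S.set k []) 1
  | drainTrue {k p q S S' S'' m n} {l : List Bool} (h : S.get k = true :: l)
      (hp : Exec p (S.set k l) S' m) (hl : Exec (.drain k p q) S' S'' n) :
      Exec (.drain k p q) S S'' (n + m + 1)
  | drainFalse {k p q S S' S'' m n} {l : List Bool} (h : S.get k = false :: l)
      (hq : Exec q (S.set k l) S' m) (hl : Exec (.drain k p q) S' S'' n) :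
      Exec (.drain k p q) S S'' (n + m + 1)

/-! ### Compilation into stack machines -/

/-- The labels of the machine for a program. -/
def Prog.Label : Prog → Type
  | .push _ _ => Unit
  | .seq p q => p.Label ⊕ q.Label
  | .popIf _ p q => Option (p.Label ⊕ q.Label)
  | .loop _ p => Option p.Label
  | .drain _ p q => Option (p.Label ⊕ q.Label)

/-- The set of labels is finite. -/
@[reducible] noncomputable def Prog.fintypeLabel : (p : Prog) → Fintype p.Label
  | .push _ _ => inferInstanceAs (Fintype Unit)
  | .seq p q =>
    letI := p.fintypeLabel; letI := q.fintypeLabel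
    inferInstanceAs (Fintype (p.Label ⊕ q.Label))
  | .popIf _ p q =>
    letI := p.fintypeLabel; letI := q.fintypeLabel
    inferInstanceAs (Fintype (Option (p.Label ⊕ q.Label)))
  | .loop _ p =>
    letI := p.fintypeLabel
    inferInstanceAs (Fintype (Option p.Label))
  | .drain _ p q =>
    letI := p.fintypeLabel; letI := q.fintypeLabel
    inferInstanceAs (Fintype (Option (p.Label ⊕ q.Label)))

/-- The label at which a program starts. -/
def Prog.entry : (p : Prog) → p.Label
  | .push _ _ => ()
  | .seq p _ => Sum.inl p.entry
  | .popIf _ _ _ => none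
  | .loop _ _ => none
  | .drain _ _ _ => none

/-- Statements of machines on the five stacks. The internal state is the last popped bit. -/
abbrev MStmt (L : Type) : Type := Turing.TM2.Stmt (fun _ : Reg => Bool) L (Option Bool)

/-- Pop a bit and jump depending on it. -/
def popGoto {L : Type} (k : Reg) (onTrue onFalse onNil : L) : MStmt L :=
  .pop k (fun _ o => o) (.goto fun v => v.elim onNil fun b => cond b onTrue onFalse)

/-- The statements of the machine for a program that is embedded in a larger machine, where control
passes to `ex` at the end. -/
def Prog.stmt {L : Type} : (p : Prog) → (p.Label → L) → L → p.Label → MStmt L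
  | .push k b, _, ex, _ => .push k (fun _ => b) (.goto fun _ => ex)
  | .seq p q, e, _, Sum.inl l => p.stmt (fun l => e (Sum.inl l)) (e (Sum.inr q.entry)) l
  | .seq _ q, e, ex, Sum.inr l => q.stmt (fun l => e (Sum.inr l)) ex l
  | .popIf k p q, e, ex, none =>
    popGoto k (e (some (Sum.inl p.entry))) (e (some (Sum.inr q.entry))) ex
  | .popIf _ p _, e, ex, some (Sum.inl l) => p.stmt (fun l => e (some (Sum.inl l))) ex l
  | .popIf _ _ q, e, ex, some (Sum.inr l) => q.stmt (fun l => e (some (Sum.inr l))) ex l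
  | .loop k p, e, ex, none => popGoto k (e (some p.entry)) ex ex
  | .loop _ p, e, _, some l => p.stmt (fun l => e (some l)) (e none) l
  | .drain k p q, e, ex, none =>
    popGoto k (e (some (Sum.inl p.entry))) (e (some (Sum.inr q.entry))) ex
  | .drain _ p _, e, _, some (Sum.inl l) =>
    p.stmt (fun l => e (some (Sum.inl l))) (e none) l
  | .drain _ _ q, e, _, some (Sum.inr l) =>
    q.stmt (fun l => e (some (Sum.inr l))) (e none) l

/-- `ReachesIn M n l S l' S'`: the machine `M` gets from label `l` with stacks `S` to label `l'`
with stacks `S'` in `n` steps. -/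
def ReachesIn {L : Type} (M : L → MStmt L) (n : ℕ) (l : L) (S : Stacks) (l' : L) (S' : Stacks) :
    Prop :=
  ∀ v, ∃ v', (flip bind (Turing.TM2.step M))^[n] (some ⟨some l, v, S.get⟩) =
    some ⟨some l', v', S'.get⟩

theorem ReachesIn.trans {L : Type} {M : L → MStmt L} {m n : ℕ} {l₁ l₂ l₃ : L} {S₁ S₂ S₃ : Stacks}
    (h₁ : ReachesIn M m l₁ S₁ l₂ S₂) (h₂ : ReachesIn M n l₂ S₂ l₃ S₃) :
    ReachesIn M (n + m) l₁ S₁ l₃ S₃ := by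
  intro v
  obtain ⟨v', h⟩ := h₁ v
  obtain ⟨v'', h'⟩ := h₂ v'
  exact ⟨v'', by rw [Function.iterate_add_apply, h, h']⟩

theorem reachesIn_push {L : Type} {M : L → MStmt L} {l l' : L} {k : Reg} {b : Bool} (S : Stacks)
    (h : M l = .push k (fun _ => b) (.goto fun _ => l')) :
    ReachesIn M 1 l S l' (S.set k (b :: S.get k)) := by
  intro v
  refine ⟨v, ?_⟩
  simp [flip, h, Stacks.update_get]

theorem reachesIn_pop {L : Type} {M : L → MStmt L} {l lt lf ln : L} {k : Reg} (S : Stacks)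
    (h : M l = popGoto k lt lf ln) :
    ReachesIn M 1 l S ((S.get k).head?.elim ln fun b => cond b lt lf)
      (S.set k (S.get k).tail) := by
  intro v
  refine ⟨(S.get k).head?, ?_⟩
  simp [flip, h, popGoto, Stacks.update_get]

/-- The embedding `e` and the exit label `ex` are quantified after the execution, so that the
induction hypothesis applies to a subprogram inside the machine of a larger program. The body of a
loop has the entry of the loop as its exit, hence the rest of the loop runs with the same `e` and
`ex`. -/
theorem Exec.reachesIn {p : Prog} {S S' : Stacks} {n : ℕ} (h : Exec p S S' n) :
    ∀ {L : Type} {M : L → MStmt L} {e : p.Label → L} {ex : L}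
      (_ : ∀ l, M (e l) = p.stmt e ex l), ReachesIn M n (e p.entry) S ex S' := by
  induction h with
  | push k b S =>
    intro L M e ex hM
    exact reachesIn_push S (hM ())
  | @seq p q S₁ S₂ S₃ m n _ _ ihp ihq =>
    intro L M e ex hM
    rw [add_comm]
    exact (ihp (e := fun l => e (Sum.inl l)) fun l => hM (Sum.inl l)).trans
      (ihq (e := fun l => e (Sum.inr l)) fun l => hM (Sum.inr l))
  | @popTrue k p q S S' n l h _ ih =>
    intro L M e ex hM
    have h₁ := reachesIn_pop S (hM none)
    rw [h] at h₁
    exact h₁.trans (ih (e := fun l => e (some (Sum.inl l))) fun l => hM (some (Sum.inl l)))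
  | @popFalse k p q S S' n l h _ ih =>
    intro L M e ex hM
    have h₁ := reachesIn_pop S (hM none)
    rw [h] at h₁
    exact h₁.trans (ih (e := fun l => e (some (Sum.inr l))) fun l => hM (some (Sum.inr l)))
  | @loopNil k p S h =>
    intro L M e ex hM
    have h₁ := reachesIn_pop S (hM none)
    rw [h] at h₁
    exact h₁
  | @loopFalse k p S l h =>
    intro L M e ex hM
    have h₁ := reachesIn_pop S (hM none)
    rw [h] at h₁
    exact h₁
  | @loopTrue k p S S' S'' m n l h _ _ ih ihl =>
    intro L M e ex hM
    have h₁ := reachesIn_pop S (hM none)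
    rw [h] at h₁
    exact h₁.trans
      ((ih (e := fun l => e (some l)) fun l => hM (some l)).trans (ihl hM))
  | @drainNil k p q S h =>
    intro L M e ex hM
    have h₁ := reachesIn_pop S (hM none)
    rw [h] at h₁
    exact h₁
  | @drainTrue k p q S S' S'' m n l h _ _ ih ihl =>
    intro L M e ex hM
    have h₁ := reachesIn_pop S (hM none)
    rw [h] at h₁
    exact h₁.trans
      ((ih (e := fun l => e (some (Sum.inl l))) fun l => hM (some (Sum.inl l))).trans (ihl hM))
  | @drainFalse k p q S S' S'' m n l h _ _ ih ihl =>
    intro L M e ex hM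
    have h₁ := reachesIn_pop S (hM none)
    rw [h] at h₁
    exact h₁.trans
      ((ih (e := fun l => e (some (Sum.inr l))) fun l => hM (some (Sum.inr l))).trans (ihl hM))

/-- The machine for a program, with input and output on the stack `main`. -/
noncomputable def Prog.machine (p : Prog) : Turing.FinTM2 where
  K := Reg
  k₀ := .main
  k₁ := .main
  Γ _ := Bool
  Λ := Option p.Label
  main := some p.entry
  ΛFin := letI := p.fintypeLabel; inferInstance
  σ := Option Bool
  initialState := none
  Γk₀Fin := inferInstance
  m
    -- A halting configuration must carry the initial internal state, so the last popped bit is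
    -- erased.
    | none => .load (fun _ => none) .halt
    | some l => p.stmt some none l

theorem Prog.exists_computableInTime (p : Prog) {α : Type} (inp out : α → Data) (time : ℕ → ℕ)
    (h : ∀ a, ∃ n, n < time (inp a).bits.length ∧
      Exec p ⟨(inp a).bits, [], [], [], []⟩ ⟨(out a).bits, [], [], [], []⟩ n) :
    ∃ c : Turing.TM2ComputableInTime (fun a => (inp a).bits) Data.bits out, c.time = time := by
  choose n hn hx using h
  -- The additional step executes the halting statement; the strict inequality in `h` leaves room
  -- for it.
  refine ⟨{ tm := p.machine, inputAlphabet := Equiv.refl _, outputAlphabet := Equiv.refl _,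
            time := time, outputsFun := fun a => ⟨⟨n a + 1, ?_⟩, hn a⟩ }, rfl⟩
  obtain ⟨v', hv⟩ := (hx a).reachesIn (M := p.machine.m) (e := some) (ex := none)
    (fun l => rfl) none
  have h₁ : Turing.initList p.machine (List.map (Equiv.refl Bool).invFun (inp a).bits) =
      ⟨some (some p.entry), none, (⟨(inp a).bits, [], [], [], []⟩ : Stacks).get⟩ := by
    unfold Turing.initList
    congr 1
    funext k
    cases k <;> simp [Prog.machine, Stacks.get]
    rfl
  have h₂ : Turing.haltList p.machine (List.map (Equiv.refl Bool).invFun (out a).bits) =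
      ⟨none, none, (⟨(out a).bits, [], [], [], []⟩ : Stacks).get⟩ := by
    unfold Turing.haltList
    congr 1
    funext k
    cases k <;> simp [Prog.machine, Stacks.get]
    rfl
  rw [Option.map_some]
  erw [h₁, h₂]
  rw [Function.iterate_succ_apply']
  erw [hv]
  rfl

end UnreliableSynthesis

namespace UnreliableSynthesis

/-! ### Moving trees between stacks -/

/-- The length of the bit string of a tree. -/
def Data.size (d : Data) : ℕ := d.bits.length

@[simp] theorem Data.size_nil : Data.nil.size = 1 := rfl

@[simp] theorem Data.size_cons (a b : Data) : (Data.cons a b).size = a.size + b.size + 1 := by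
  simp [Data.size, Data.bits]

theorem Data.size_pos (d : Data) : 1 ≤ d.size := by
  cases d <;> simp

/-- The body of the loop that reads a tree. -/
def Prog.readBody (k : Reg) : Prog :=
  .popIf k (.seq (.push .scratch true) (.seq (.push .count true) (.push .count true)))
    (.push .scratch false)

/-- Move the bits of a tree to the stack `scratch`, where they appear in reversed order. -/
def Prog.read (k : Reg) : Prog := .seq (.push .count true) (.loop .count (.readBody k))

/-- Move a tree. -/
def Prog.move (i j : Reg) : Prog :=
  .seq (.read i) (.drain .scratch (.push j true) (.push j false))

/-- Copy a tree. -/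
def Prog.copy (i j : Reg) : Prog :=
  .seq (.read i) (.drain .scratch (.seq (.push i true) (.push j true))
    (.seq (.push i false) (.push j false)))

/-- Do nothing. -/
def Prog.skip : Prog := .seq (.push .marks false) (.loop .marks (.push .marks false))

/-- Delete a tree. -/
def Prog.drop (k : Reg) : Prog := .seq (.read k) (.drain .scratch .skip .skip)

theorem exec_skip (S : Stacks) : Exec .skip S S 2 :=
  .seq (.push _ _ _) (.loopFalse (S := S.set .marks (false :: S.marks)) rfl)

/-- Each `true` on `count` stands for a subtree still to be read: a node replaces one by two and a
leaf removes one, so the prefix code is parsed with a counter only. The form is that of a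
continuation, because after the first subtree the same loop goes on with the second: a given
execution `h` of the rest is prolonged backwards by the reading of `d`. The factor 5 is the number
of steps spent on a node. -/
theorem exec_readLoop {k : Reg} (hk : k = .main ∨ k = .aux) (d : Data) :
    ∀ (S S' : Stacks) (r : List Bool) (n : ℕ), S.get k = d.bits ++ r →
      Exec (.loop .count (.readBody k))
        ((S.set k r).set .scratch (d.bits.reverse ++ S.scratch)) S' n →
      ∃ m ≤ n + 5 * d.size,
        Exec (.loop .count (.readBody k)) (S.set .count (true :: S.count)) S' m := by
  induction d with
  | nil =>
    intro S S' r n hS h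
    refine ⟨n + (1 + 1) + 1, by simp, .loopTrue rfl (.popFalse (l := r) ?_ (.push _ _ _)) ?_⟩
    · rcases hk with rfl | rfl <;> exact hS
    · rcases hk with rfl | rfl <;> exact h
  | cons a b iha ihb =>
    intro S S' r n hS h
    obtain ⟨m₁, hm₁, h₁⟩ := ihb
      ((S.set k (b.bits ++ r)).set .scratch (a.bits.reverse ++ true :: S.scratch)) S' r n
      (by rcases hk with rfl | rfl <;> rfl)
      (by
        have e : (Data.cons a b).bits.reverse ++ S.scratch =
            b.bits.reverse ++ (a.bits.reverse ++ true :: S.scratch) := by simp [Data.bits]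
        rw [e] at h
        rcases hk with rfl | rfl <;> exact h)
    obtain ⟨m₂, hm₂, h₂⟩ := iha
      (((S.set k (a.bits ++ (b.bits ++ r))).set .scratch (true :: S.scratch)).set .count
        (true :: S.count)) S' (b.bits ++ r) m₁
      (by rcases hk with rfl | rfl <;> rfl)
      (by rcases hk with rfl | rfl <;> exact h₁)
    refine ⟨m₂ + ((1 + (1 + 1)) + 1) + 1, by simp; omega, .loopTrue rfl
      (.popTrue (l := a.bits ++ (b.bits ++ r)) ?_
        (.seq (.push _ _ _) (.seq (.push _ _ _) (.push _ _ _)))) ?_⟩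
    · rw [Data.bits, List.cons_append, List.append_assoc] at hS
      rcases hk with rfl | rfl <;> exact hS
    · rcases hk with rfl | rfl <;> exact h₂

theorem exec_read {k : Reg} (hk : k = .main ∨ k = .aux) (d : Data) (S : Stacks) (r : List Bool)
    (hS : S.get k = d.bits ++ r) (hc : S.count = []) (hs : S.scratch = []) :
    ∃ m ≤ 5 * d.size + 2, Exec (.read k) S ((S.set k r).set .scratch d.bits.reverse) m := by
  obtain ⟨m, hm, h⟩ := exec_readLoop hk d S _ r 1 hS
    (.loopNil (by rcases hk with rfl | rfl <;> exact hc))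
  refine ⟨1 + m, by omega, ?_⟩
  have := Exec.seq (Exec.push .count true S) h
  rw [hs, List.append_nil] at this
  have e : ((S.set k r).set .scratch d.bits.reverse).set .count [] =
      (S.set k r).set .scratch d.bits.reverse := by
    obtain ⟨a, b, c, d, e⟩ := S
    subst hc
    rcases hk with rfl | rfl <;> rfl
  rwa [e] at this

/-- Emptying `scratch` reverses the bits for a second time, so the tree arrives in its original
order. -/
theorem exec_drainMove {j : Reg} (hj : j = .main ∨ j = .aux) (l : List Bool) :
    ∀ S : Stacks, S.scratch = l →
      ∃ m ≤ 2 * l.length + 1, Exec (.drain .scratch (.push j true) (.push j false)) S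
        ((S.set .scratch []).set j (l.reverse ++ S.get j)) m := by
  induction l with
  | nil =>
    intro S hS
    refine ⟨1, by simp, ?_⟩
    have := Exec.drainNil (k := .scratch) (p := .push j true) (q := .push j false) hS
    rcases hj with rfl | rfl <;> exact this
  | cons b l ih =>
    intro S hS
    obtain ⟨m, hm, h⟩ := ih ((S.set .scratch l).set j (b :: S.get j))
      (by rcases hj with rfl | rfl <;> rfl)
    have e : (b :: l).reverse ++ S.get j = l.reverse ++ (b :: S.get j) := by simp
    rw [e]
    refine ⟨m + 1 + 1, by simp; omega, ?_⟩
    cases b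
    · refine .drainFalse hS (.push _ _ _) ?_
      rcases hj with rfl | rfl <;> exact h
    · refine .drainTrue hS (.push _ _ _) ?_
      rcases hj with rfl | rfl <;> exact h

theorem exec_drainCopy (l : List Bool) :
    ∀ S : Stacks, S.scratch = l →
      ∃ m ≤ 3 * l.length + 1, Exec (.drain .scratch (.seq (.push .main true) (.push .aux true))
        (.seq (.push .main false) (.push .aux false))) S
        ⟨l.reverse ++ S.main, l.reverse ++ S.aux, S.marks, [], S.count⟩ m := by
  induction l with
  | nil =>
    intro S hS
    exact ⟨1, by simp, .drainNil hS⟩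
  | cons b l ih =>
    intro S hS
    obtain ⟨m, hm, h⟩ := ih ⟨b :: S.main, b :: S.aux, S.marks, l, S.count⟩ rfl
    have e (r : List Bool) : (b :: l).reverse ++ r = l.reverse ++ (b :: r) := by simp
    rw [e, e]
    refine ⟨m + (1 + 1) + 1, by simp; omega, ?_⟩
    cases b
    · exact .drainFalse hS (.seq (.push _ _ _) (.push _ _ _)) h
    · exact .drainTrue hS (.seq (.push _ _ _) (.push _ _ _)) h

theorem exec_drainSkip (l : List Bool) :
    ∀ S : Stacks, S.scratch = l →
      ∃ m ≤ 3 * l.length + 1, Exec (.drain .scratch .skip .skip) S (S.set .scratch []) m := by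
  induction l with
  | nil =>
    intro S hS
    exact ⟨1, by simp, .drainNil hS⟩
  | cons b l ih =>
    intro S hS
    obtain ⟨m, hm, h⟩ := ih (S.set .scratch l) rfl
    refine ⟨m + 2 + 1, by simp; omega, ?_⟩
    cases b
    · exact .drainFalse hS (exec_skip _) h
    · exact .drainTrue hS (exec_skip _) h

/-- `Within p S S' n`: the program `p` leads from `S` to `S'` in at most `n` steps. -/
def Within (p : Prog) (S S' : Stacks) (n : ℕ) : Prop := ∃ m ≤ n, Exec p S S' m

theorem Within.mono {p : Prog} {S S' : Stacks} {m n : ℕ} (h : Within p S S' m) (hmn : m ≤ n) :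
    Within p S S' n :=
  let ⟨l, hl, hx⟩ := h
  ⟨l, hl.trans hmn, hx⟩

theorem Within.seq {p q : Prog} {S₁ S₂ S₃ : Stacks} {m n : ℕ} (hp : Within p S₁ S₂ m)
    (hq : Within q S₂ S₃ n) : Within (.seq p q) S₁ S₃ (m + n) :=
  let ⟨_, hl, hx⟩ := hp
  let ⟨_, hl', hx'⟩ := hq
  ⟨_, Nat.add_le_add hl hl', .seq hx hx'⟩

theorem within_push (k : Reg) (b : Bool) (S : Stacks) :
    Within (.push k b) S (S.set k (b :: S.get k)) 1 := ⟨1, le_rfl, .push k b S⟩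

theorem Within.popTrue {k : Reg} {p q : Prog} {S S' : Stacks} {n : ℕ} {l : List Bool}
    (hp : Within p (S.set k l) S' n) (h : S.get k = true :: l) :
    Within (.popIf k p q) S S' (n + 1) :=
  let ⟨m, hm, hx⟩ := hp
  ⟨m + 1, Nat.succ_le_succ hm, .popTrue h hx⟩

theorem Within.popFalse {k : Reg} {p q : Prog} {S S' : Stacks} {n : ℕ} {l : List Bool}
    (hq : Within q (S.set k l) S' n) (h : S.get k = false :: l) :
    Within (.popIf k p q) S S' (n + 1) :=
  let ⟨m, hm, hx⟩ := hq
  ⟨m + 1, Nat.succ_le_succ hm, .popFalse h hx⟩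

theorem Within.loopTrue {k : Reg} {p : Prog} {S S' S'' : Stacks} {m n : ℕ} {l : List Bool}
    (hp : Within p (S.set k l) S' m) (hl : Within (.loop k p) S' S'' n)
    (h : S.get k = true :: l) : Within (.loop k p) S S'' (n + m + 1) :=
  let ⟨i, hi, hx⟩ := hp
  let ⟨j, hj, hy⟩ := hl
  ⟨j + i + 1, by omega, .loopTrue h hx hy⟩

theorem within_move_main_aux (d : Data) (r a m : List Bool) :
    Within (.move .main .aux) ⟨d.bits ++ r, a, m, [], []⟩ ⟨r, d.bits ++ a, m, [], []⟩
      (10 * d.size) := by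
  have h₁ := exec_read (.inl rfl) d ⟨d.bits ++ r, a, m, [], []⟩ r rfl rfl rfl
  have h₂ := exec_drainMove (j := .aux) (.inr rfl) d.bits.reverse
    ⟨r, a, m, d.bits.reverse, []⟩ rfl
  have := Within.seq h₁ h₂
  simp only [List.reverse_reverse] at this
  refine Within.mono this ?_
  have := d.size_pos
  simp only [List.length_reverse]
  change 5 * d.size + 2 + (2 * d.size + 1) ≤ _
  omega

theorem within_move_aux_main (d : Data) (r a m : List Bool) :
    Within (.move .aux .main) ⟨r, d.bits ++ a, m, [], []⟩ ⟨d.bits ++ r, a, m, [], []⟩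
      (10 * d.size) := by
  have h₁ := exec_read (.inr rfl) d ⟨r, d.bits ++ a, m, [], []⟩ a rfl rfl rfl
  have h₂ := exec_drainMove (j := .main) (.inl rfl) d.bits.reverse
    ⟨r, a, m, d.bits.reverse, []⟩ rfl
  have := Within.seq h₁ h₂
  simp only [List.reverse_reverse] at this
  refine Within.mono this ?_
  have := d.size_pos
  simp only [List.length_reverse]
  change 5 * d.size + 2 + (2 * d.size + 1) ≤ _
  omega

theorem within_copy (d : Data) (r a m : List Bool) :
    Within (.copy .main .aux) ⟨d.bits ++ r, a, m, [], []⟩ ⟨d.bits ++ r, d.bits ++ a, m, [], []⟩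
      (11 * d.size) := by
  have h₁ := exec_read (.inl rfl) d ⟨d.bits ++ r, a, m, [], []⟩ r rfl rfl rfl
  have h₂ := exec_drainCopy d.bits.reverse ⟨r, a, m, d.bits.reverse, []⟩ rfl
  have := Within.seq h₁ h₂
  simp only [List.reverse_reverse] at this
  refine Within.mono this ?_
  have := d.size_pos
  simp only [List.length_reverse]
  change 5 * d.size + 2 + (3 * d.size + 1) ≤ _
  omega

theorem within_drop (d : Data) (r a m : List Bool) :
    Within (.drop .main) ⟨d.bits ++ r, a, m, [], []⟩ ⟨r, a, m, [], []⟩ (11 * d.size) := by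
  have h₁ := exec_read (.inl rfl) d ⟨d.bits ++ r, a, m, [], []⟩ r rfl rfl rfl
  have h₂ := exec_drainSkip d.bits.reverse ⟨r, a, m, d.bits.reverse, []⟩ rfl
  refine Within.mono (Within.seq h₁ h₂) ?_
  have := d.size_pos
  simp only [List.length_reverse]
  change 5 * d.size + 2 + (3 * d.size + 1) ≤ _
  omega

/-! ### A functional language on trees -/

/-- The first component of a tree. -/
def Data.hd : Data → Data
  | .nil => .nil
  | .cons a _ => a

/-- The second component of a tree. -/
def Data.tl : Data → Data
  | .nil => .nil
  | .cons _ b => b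

/-- Is the tree empty? -/
def Data.isNil : Data → Bool
  | .nil => true
  | .cons _ _ => false

/-- Right fold over a tree, considered as a list. -/
def Data.foldr {β : Type} (F : Data → β → β) (s : β) : Data → β
  | .nil => s
  | .cons e l => F e (Data.foldr F s l)

/-- Expressions for functions on trees. -/
inductive Code : Type where
  | id
  | nil
  | hd
  | tl
  | count
  | pair (f g : Code)
  | comp (g f : Code)
  | cond (t f g : Code)
  | foldr (f : Code)

/-- The function given by an expression. -/
def Code.eval : Code → Data → Data
  | .id, x => x
  | .nil, _ => .nil
  | .hd, x => x.hd
  | .tl, x => x.tl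
  | .count, x => .ofNat x.size
  | .pair f g, x => .cons (f.eval x) (g.eval x)
  | .comp g f, x => g.eval (f.eval x)
  | .cond t f g, x => bif (t.eval x).isNil then f.eval x else g.eval x
  | .foldr f, x => x.hd.foldr (fun e s => f.eval (.cons e s)) x.tl

/-- An upper bound on the time for evaluating an expression. -/
def Code.cost : Code → Data → ℕ
  | .id, x => 40 * x.size
  | .nil, x => 40 * x.size
  | .hd, x => 40 * x.size
  | .tl, x => 40 * x.size
  | .count, x => 40 * x.size
  | .pair f g, x => 40 * x.size + f.cost x + g.cost x
  | .comp g f, x => f.cost x + g.cost (f.eval x)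
  | .cond t f g, x => 40 * (x.size + (t.eval x).size) + t.cost x +
      bif (t.eval x).isNil then f.cost x else g.cost x
  | .foldr f, x => 40 * x.size +
      (x.hd.foldr (fun e p => (f.eval (.cons e p.1), f.cost (.cons e p.1) + p.2)) (x.tl, 0)).2

/-- The program for an expression: it replaces a tree on top of the stack `main` by its image. -/
def Code.prog : Code → Prog
  | .id => .skip
  | .nil => .seq (.drop .main) (.push .main false)
  | .hd => .popIf .main (.seq (.move .main .aux) (.seq (.drop .main) (.move .aux .main)))
      (.push .main false)
  | .tl => .popIf .main (.drop .main) (.push .main false)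
  | .count => .seq (.read .main) (.seq (.push .main false) (.drain .scratch
      (.seq (.push .main false) (.push .main true)) (.seq (.push .main false) (.push .main true))))
  -- The second component is evaluated first, because it has to lie below the first one on the
  -- stack.
  | .pair f g => .seq (.copy .main .aux) (.seq g.prog (.seq (.move .aux .main)
      (.seq f.prog (.push .main true))))
  | .comp g f => .seq f.prog g.prog
  | .cond t f g => .seq (.copy .main .aux) (.seq t.prog (.popIf .main
      (.seq (.drop .main) (.seq (.drop .main) (.seq (.move .aux .main) g.prog)))
      (.seq (.move .aux .main) f.prog)))
  | .foldr f => .popIf .main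
      -- This `false` stops the second loop before it reaches the marks of an enclosing fold.
      (.seq (.push .marks false)
        (.seq (.loop .main (.seq (.move .main .aux) (.push .marks true)))
          (.loop .marks (.seq (.move .aux .main) (.seq (.push .main true) f.prog)))))
      (.push .main false)

/-- The elements of a tree, considered as a list, in front of a stack, in reversed order. -/
def Data.revBits (a : List Bool) : Data → List Bool
  | .nil => a
  | .cons e l => l.revBits (e.bits ++ a)

/-- One mark for each element of a tree, considered as a list. -/
def Data.revMarks (m : List Bool) : Data → List Bool
  | .nil => m
  | .cons _ l => l.revMarks (true :: m)

/-- In the code of a list every element is preceded by `true` and the end is `false`, so the bit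
popped from `main` tells whether an element follows. The last element ends up on top of `aux`, which
is where a right fold starts. -/
theorem within_unload (l : Data) : ∀ (r a m : List Bool),
    Within (.loop .main (.seq (.move .main .aux) (.push .marks true)))
      ⟨l.bits ++ r, a, m, [], []⟩ ⟨r, l.revBits a, l.revMarks m, [], []⟩ (12 * l.size) := by
  induction l with
  | nil =>
    intro r a m
    exact ⟨1, by simp, .loopFalse rfl⟩
  | cons e l _ ih =>
    intro r a m
    have := (((within_move_main_aux e (l.bits ++ r) a m).seq
      (within_push .marks true _)).loopTrue (ih r (e.bits ++ a) (true :: m))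
      (S := ⟨(Data.cons e l).bits ++ r, a, m, [], []⟩) (by simp [Data.bits, Stacks.get]))
    refine this.mono ?_
    have := e.size_pos
    simp
    omega

/-- The elements that are processed last lie deepest in `aux`; so the induction on `l` again
prolongs an execution of the rest of the loop backwards. The `true` pushed before `p` joins the
element and the accumulator into one tree. The fold with values in pairs carries the accumulator and
the total cost at once. -/
theorem within_fold {p : Prog} {F : Data → Data → Data} {c : Data → Data → ℕ}
    (hp : ∀ e s r a m, Within p ⟨(Data.cons e s).bits ++ r, a, m, [], []⟩
      ⟨(F e s).bits ++ r, a, m, [], []⟩ (c e s)) (l : Data) :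
    ∀ (s : Data) (r a m : List Bool) (S' : Stacks) (n : ℕ),
      Within (.loop .marks (.seq (.move .aux .main) (.seq (.push .main true) p)))
        ⟨(l.foldr F s).bits ++ r, a, m, [], []⟩ S' n →
      Within (.loop .marks (.seq (.move .aux .main) (.seq (.push .main true) p)))
        ⟨s.bits ++ r, l.revBits a, l.revMarks m, [], []⟩ S'
        (n + 12 * l.size + (l.foldr (fun e q => (F e q.1, c e q.1 + q.2)) (s, 0)).2) := by
  have hfst (s : Data) (l : Data) :
      (l.foldr (fun e q => (F e q.1, c e q.1 + q.2)) (s, 0)).1 = l.foldr F s := by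
    induction l with
    | nil => rfl
    | cons e l _ ih => simp [Data.foldr, ih]
  induction l with
  | nil =>
    intro s r a m S' n h
    exact h.mono (by omega)
  | cons e l _ ih =>
    intro s r a m S' n h
    have h₁ := ((within_move_aux_main e ((l.foldr F s).bits ++ r) a m).seq
      ((within_push .main true _).seq (by
        have := hp e (l.foldr F s) r a m
        simp only [Data.bits, List.cons_append, List.append_assoc] at this
        exact this))).loopTrue
      (S := ⟨(l.foldr F s).bits ++ r, e.bits ++ a, true :: m, [], []⟩) h rfl
    refine (ih s r (e.bits ++ a) (true :: m) S' _ h₁).mono ?_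
    have := e.size_pos
    simp only [Data.foldr, hfst, Data.size_cons]
    omega

/-- The code of `n + 1` is that of `n` with `true, false` in front, and these two bits are pushed
for every drained bit, whatever its value. -/
theorem within_countBits (n : ℕ) (l : List Bool) : ∀ (r a m : List Bool),
    Within (.drain .scratch (.seq (.push .main false) (.push .main true))
      (.seq (.push .main false) (.push .main true))) ⟨(Data.ofNat n).bits ++ r, a, m, l, []⟩
      ⟨(Data.ofNat (n + l.length)).bits ++ r, a, m, [], []⟩ (3 * l.length + 1) := by
  induction l generalizing n with
  | nil => exact fun r a m => ⟨1, by simp, .drainNil rfl⟩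
  | cons b l ih =>
    intro r a m
    obtain ⟨k, hk, h⟩ := ih (n + 1) r a m
    have e : n + (b :: l).length = n + 1 + l.length := by simp; omega
    rw [e]
    refine ⟨k + (1 + 1) + 1, by simp; omega, ?_⟩
    cases b
    · exact .drainFalse rfl (.seq (.push _ _ _) (.push _ _ _)) h
    · exact .drainTrue rfl (.seq (.push _ _ _) (.push _ _ _)) h

/-- The arbitrary rests `r`, `a`, `m` are what makes nesting possible: while a subexpression runs,
the enclosing ones keep saved inputs and marks below its data. -/
theorem Code.within_prog (c : Code) : ∀ (x : Data) (r a m : List Bool),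
    Within c.prog ⟨x.bits ++ r, a, m, [], []⟩ ⟨(c.eval x).bits ++ r, a, m, [], []⟩ (c.cost x) := by
  induction c with
  | id =>
    intro x r a m
    refine Within.mono ⟨2, le_rfl, exec_skip _⟩ ?_
    have := x.size_pos
    simp only [Code.cost]
    omega
  | nil =>
    intro x r a m
    refine ((within_drop x r a m).seq (within_push .main false _)).mono ?_
    have := x.size_pos
    simp only [Code.cost]
    omega
  | hd =>
    intro x r a m
    cases x with
    | nil => exact ((within_push .main false ⟨r, a, m, [], []⟩).popFalse rfl).mono (by simp [cost])
    | cons d e =>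
      refine (((within_move_main_aux d (e.bits ++ r) a m).seq
        ((within_drop e r _ m).seq (within_move_aux_main d r a m))).popTrue ?_).mono ?_
      · simp [Data.bits, Stacks.get]
      · simp only [Code.cost, Data.size_cons]
        omega
  | tl =>
    intro x r a m
    cases x with
    | nil => exact ((within_push .main false ⟨r, a, m, [], []⟩).popFalse rfl).mono (by simp [cost])
    | cons d e =>
      refine ((within_drop d (e.bits ++ r) a m).popTrue ?_).mono ?_
      · simp [Data.bits, Stacks.get]
      · simp only [Code.cost, Data.size_cons]
        omega
  | count =>
    intro x r a m
    have h₁ := exec_read (.inl rfl) x ⟨x.bits ++ r, a, m, [], []⟩ r rfl rfl rfl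
    have h₂ := within_countBits 0 x.bits.reverse r a m
    rw [Nat.zero_add, List.length_reverse] at h₂
    refine (Within.seq h₁ ((within_push .main false _).seq h₂)).mono ?_
    have := x.size_pos
    change 5 * x.size + 2 + (1 + (3 * x.size + 1)) ≤ 40 * x.size
    omega
  | pair f g ihf ihg =>
    intro x r a m
    have := (within_copy x r a m).seq ((ihg x r _ m).seq
      ((within_move_aux_main x _ a m).seq ((ihf x _ a m).seq (within_push .main true _))))
    have e : (Code.eval (.pair f g) x).bits ++ r =
        true :: ((f.eval x).bits ++ ((g.eval x).bits ++ r)) := by simp [Code.eval, Data.bits]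
    rw [e]
    refine this.mono ?_
    have := x.size_pos
    simp only [Code.cost]
    omega
  | comp g f ihg ihf =>
    intro x r a m
    exact (ihf x r a m).seq (ihg _ r a m)
  | cond t f g iht ihf ihg =>
    intro x r a m
    have hx := x.size_pos
    simp only [Code.eval, Code.cost]
    cases ht : t.eval x with
    | nil =>
      have ht' := iht x r (x.bits ++ a) m
      rw [ht] at ht'
      refine Within.mono ((within_copy x r a m).seq (ht'.seq
        (((within_move_aux_main x r a m).seq (ihf x r a m)).popFalse
          (k := .main) (S := ⟨false :: r, x.bits ++ a, m, [], []⟩) rfl))) ?_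
      simp [Data.isNil]
      omega
    | cons d e =>
      have ht' := iht x r (x.bits ++ a) m
      rw [ht] at ht'
      simp only [Data.bits, List.cons_append, List.append_assoc] at ht'
      refine Within.mono ((within_copy x r a m).seq (ht'.seq
        (((within_drop d _ _ m).seq ((within_drop e r _ m).seq
          ((within_move_aux_main x r a m).seq (ihg x r a m)))).popTrue
          (k := .main) (S := ⟨true :: (d.bits ++ (e.bits ++ r)), x.bits ++ a, m, [], []⟩) rfl))) ?_
      simp [Data.isNil]
      omega
  | foldr f ih =>
    intro x r a m
    cases x with
    | nil => exact ((within_push .main false ⟨r, a, m, [], []⟩).popFalse rfl).mono (by simp [cost]; omega)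
    | cons l s =>
      have h₂ := within_fold (p := f.prog) (c := fun e s => f.cost (.cons e s))
        (fun e s r a m => ih (.cons e s) r a m) l s r a (false :: m) _ 1
        ⟨1, le_rfl, .loopFalse rfl⟩
      refine Within.mono (((within_push .marks false ⟨l.bits ++ (s.bits ++ r), a, m, [], []⟩).seq
        ((within_unload l (s.bits ++ r) a (false :: m)).seq h₂)).popTrue
        (S := ⟨(Data.cons l s).bits ++ r, a, m, [], []⟩) (k := .main)
        (by simp [Data.bits, Stacks.get])) ?_
      have := l.size_pos
      simp only [Code.cost, Data.size_cons, Data.hd, Data.tl]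
      omega

theorem Code.exists_computableInTime (c : Code) {α : Type} (inp out : α → Data) (time : ℕ → ℕ)
    (hc : ∀ a, c.eval (inp a) = out a) (ht : ∀ a, c.cost (inp a) < time (inp a).size) :
    ∃ c : Turing.TM2ComputableInTime (fun a => (inp a).bits) Data.bits out, c.time = time := by
  refine c.prog.exists_computableInTime inp out time fun a => ?_
  obtain ⟨n, hn, h⟩ := c.within_prog (inp a) [] [] []
  rw [hc, List.append_nil, List.append_nil] at h
  exact ⟨n, hn.trans_lt (ht a), h⟩

end UnreliableSynthesis

namespace UnreliableSynthesis

/-! ### Growth rates -/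

/-- `f` is bounded by a polynomial in `g`. -/
def PolyLE {α : Type} (f g : α → ℕ) : Prop := ∃ k, ∀ a, f a ≤ (g a + 2) ^ k

section PolyLE

variable {α β : Type} {f f' g h : α → ℕ}

theorem PolyLE.mono (hf : PolyLE f g) (h : ∀ a, f' a ≤ f a) : PolyLE f' g :=
  let ⟨k, hk⟩ := hf
  ⟨k, fun a => (h a).trans (hk a)⟩

theorem PolyLE.of_le (h : ∀ a, f a ≤ g a) : PolyLE f g :=
  ⟨1, fun a => (h a).trans (by simp)⟩

theorem PolyLE.refl (f : α → ℕ) : PolyLE f f := .of_le fun _ => le_rfl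

/-- The base `g a + 2` is at least 2, so a constant is absorbed by the exponent, since `c < 2 ^ c`.
-/
theorem PolyLE.const (c : ℕ) : PolyLE (fun _ => c) g :=
  ⟨c, fun a => (Nat.lt_two_pow_self (n := c)).le.trans (Nat.pow_le_pow_left (by omega) c)⟩

theorem PolyLE.mul (hf : PolyLE f g) (hf' : PolyLE f' g) : PolyLE (fun a => f a * f' a) g :=
  let ⟨k, hk⟩ := hf
  let ⟨k', hk'⟩ := hf'
  ⟨k + k', fun a => by rw [pow_add]; exact Nat.mul_le_mul (hk a) (hk' a)⟩

/-- The sum is at most `(f a + 1) * (f' a + 1)`, and adding 1 costs one more power because the base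
is at least 2. -/
theorem PolyLE.add (hf : PolyLE f g) (hf' : PolyLE f' g) : PolyLE (fun a => f a + f' a) g := by
  have : PolyLE (fun a => (f a + 1) * (f' a + 1)) g := by
    have aux {f : α → ℕ} (hf : PolyLE f g) : PolyLE (fun a => f a + 1) g :=
      let ⟨k, hk⟩ := hf
      ⟨k + 1, fun a => by
        have := hk a
        have : 1 ≤ (g a + 2) ^ k := Nat.one_le_pow _ _ (by omega)
        rw [pow_succ]
        nlinarith⟩
    exact (aux hf).mul (aux hf')
  exact this.mono fun a => by nlinarith

theorem PolyLE.pow (hf : PolyLE f g) (n : ℕ) : PolyLE (fun a => f a ^ n) g :=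
  let ⟨k, hk⟩ := hf
  ⟨k * n, fun a => by rw [pow_mul]; exact Nat.pow_le_pow_left (hk a) n⟩

theorem PolyLE.trans (hf : PolyLE f g) (hg : PolyLE g h) : PolyLE f h :=
  let ⟨k, hk⟩ := hf
  ((hg.add (.const 2)).pow k).mono hk

theorem PolyLE.comp (hf : PolyLE f g) (φ : β → α) : PolyLE (fun b => f (φ b)) fun b => g (φ b) :=
  let ⟨k, hk⟩ := hf
  ⟨k, fun b => hk (φ b)⟩

end PolyLE

theorem expTower_mono (k : ℕ) : Monotone (expTower k) := by
  induction k with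
  | zero => exact fun _ _ h => h
  | succ k ih => exact fun _ _ h => Nat.pow_le_pow_right (by omega) (ih h)

theorem le_expTower (k n : ℕ) : n ≤ expTower k n := by
  induction k with
  | zero => exact le_rfl
  | succ k ih => exact ih.trans Nat.lt_two_pow_self.le

/-- Positive arguments make both powers at least 2, so that their sum is at most their product,
which is a power of the sum one level below. -/
theorem expTower_add_le (k : ℕ) {m n : ℕ} (hm : 1 ≤ m) (hn : 1 ≤ n) :
    expTower k m + expTower k n ≤ expTower k (m + n) := by
  induction k with
  | zero => exact le_rfl
  | succ k ih =>
    have aux {a b : ℕ} (ha : 2 ≤ a) (hb : 2 ≤ b) : a + b ≤ a * b := by nlinarith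
    have two {m : ℕ} (hm : 1 ≤ m) : 2 ≤ 2 ^ expTower k m :=
      Nat.le_self_pow (by have := le_expTower k m; omega) 2
    calc 2 ^ expTower k m + 2 ^ expTower k n
        ≤ 2 ^ expTower k m * 2 ^ expTower k n := aux (two hm) (two hn)
      _ = 2 ^ (expTower k m + expTower k n) := (pow_add _ _ _).symm
      _ ≤ 2 ^ expTower k (m + n) := Nat.pow_le_pow_right (by omega) ih

theorem expTower_expTower (j k n : ℕ) : expTower j (expTower k n) = expTower (j + k) n := by
  induction j with
  | zero => rw [Nat.zero_add]; rfl
  | succ j ih => rw [Nat.succ_add]; exact congrArg _ ih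

/-- A polynomial on the outside of a tower can be moved inside. With `T` the tower one level lower,
`(2 ^ T + 2) ^ i ≤ 2 ^ ((T + 2) * i)` and `i ≤ (T + 2) ^ i`, so the induction continues with the
power `i + 1` of `T + 2`. -/
theorem exists_expTower_pow_le (k : ℕ) :
    ∀ i : ℕ, ∃ j, ∀ n, (expTower k n + 2) ^ i ≤ expTower k ((n + 2) ^ j) := by
  induction k with
  | zero => exact fun i => ⟨i, fun n => le_rfl⟩
  | succ k ih =>
    intro i
    obtain ⟨j, hj⟩ := ih (i + 1)
    refine ⟨j, fun n => le_trans ?_ (Nat.pow_le_pow_right (by omega) (hj n))⟩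
    have h₁ : expTower (k + 1) n + 2 ≤ 2 ^ (expTower k n + 2) := by
      have : 1 ≤ 2 ^ expTower k n := Nat.one_le_two_pow
      rw [pow_add]
      change 2 ^ expTower k n + 2 ≤ _
      omega
    refine (Nat.pow_le_pow_left h₁ i).trans ?_
    rw [← pow_mul]
    refine Nat.pow_le_pow_right (by omega) ?_
    rw [pow_succ, mul_comm]
    refine Nat.mul_le_mul_right _ ?_
    exact (Nat.lt_two_pow_self (n := i)).le.trans (Nat.pow_le_pow_left (by omega) i)

/-! ### Feasible functions -/

theorem Data.size_hd_le (d : Data) : d.hd.size ≤ d.size := by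
  cases d <;> simp [Data.hd]; omega

theorem Data.size_tl_le (d : Data) : d.tl.size ≤ d.size := by
  cases d <;> simp [Data.tl]; omega

/-- Output has to be paid for with time. Thus a cost bound for one expression also bounds the size
of the input of the next one. -/
theorem Code.size_eval_le (c : Code) : ∀ x, (c.eval x).size ≤ c.cost x := by
  induction c with
  | id => intro x; simp only [eval, cost]; omega
  | nil => intro x; have := x.size_pos; simp [eval, cost]; omega
  | hd => intro x; have := x.size_hd_le; simp only [eval, cost]; omega
  | tl => intro x; have := x.size_tl_le; simp only [eval, cost]; omega
  | count =>
    intro x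
    have h (n : ℕ) : (Data.ofNat n).size = 2 * n + 1 := by
      induction n with
      | zero => rfl
      | succ n ih => simp only [Data.ofNat, Data.size_cons, ih, Data.size_nil]; omega
    have := x.size_pos
    simp only [eval, cost, h]
    omega
  | pair f g ihf ihg =>
    intro x
    have := ihf x
    have := ihg x
    have := x.size_pos
    simp only [eval, cost, Data.size_cons]
    omega
  | comp g f ihg ihf => intro x; have := ihg (f.eval x); simp only [eval, cost]; omega
  | cond t f g _ ihf ihg =>
    intro x
    have := ihf x
    have := ihg x
    simp only [eval, cost]
    cases (t.eval x).isNil <;> simp only [cond_true, cond_false] <;> omega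
  | foldr f ih =>
    intro x
    simp only [eval, cost]
    have key (s l : Data) : (l.foldr (fun e s => f.eval (.cons e s)) s).size ≤ s.size +
        (l.foldr (fun e p => (f.eval (.cons e p.1), f.cost (.cons e p.1) + p.2)) (s, 0)).2 ∧
        (l.foldr (fun e p => (f.eval (.cons e p.1), f.cost (.cons e p.1) + p.2)) (s, 0)).1 =
          l.foldr (fun e s => f.eval (.cons e s)) s := by
      induction l with
      | nil => simp [Data.foldr]
      | cons e l _ ihl =>
        refine ⟨?_, by simp only [Data.foldr, ihl.2]⟩
        simp only [Data.foldr, ihl.2]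
        have := ih (.cons e (l.foldr (fun e s => f.eval (.cons e s)) s))
        omega
    have h₁ := (key x.tl x.hd).1
    have h₂ := x.size_tl_le
    omega

/-- The function that sends `inp a` to `out a` is given by an expression that can be evaluated
in time `expTower k` of a polynomial. -/
def FeasibleIn (k : ℕ) {α : Type} (inp out : α → Data) : Prop :=
  ∃ c : Code, (∀ a, c.eval (inp a) = out a) ∧
    ∃ j, ∀ a, c.cost (inp a) ≤ expTower k (((inp a).size + 2) ^ j)

/-- The function that sends `inp a` to `out a` is given by an expression that can be evaluated
in polynomial time. -/
abbrev Feasible {α : Type} (inp out : α → Data) : Prop := FeasibleIn 0 inp out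

theorem FeasibleIn.computableInExpTime {k : ℕ} {α : Type} {inp out : α → Data}
    (h : FeasibleIn k inp out) : ComputableInExpTime k inp out := by
  obtain ⟨c, hc, j, hj⟩ := h
  have h₁ (x : ℕ) : 1 ≤ (x + 2) ^ j := Nat.one_le_pow _ _ (by omega)
  obtain ⟨m, hm⟩ := c.exists_computableInTime inp out
    -- The summand 1 makes the bound strict, which leaves a step for halting.
    (fun n => expTower k ((n + 2) ^ j + 1)) hc fun a => by
      refine (hj a).trans_lt (lt_of_lt_of_le ?_ (expTower_add_le k (h₁ _) le_rfl))
      have := le_expTower k 1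
      omega
  exact ⟨m, (Polynomial.X + 2) ^ j + 1, fun n => by simp [hm]⟩

section Feasible

variable {α β : Type} {inp mid out : α → Data}

/-- The intermediate result has size at most a tower of height `k`; the polynomial inside the bound
for `g` is moved into that tower, and `j` further exponentials are put on top. -/
theorem FeasibleIn.compose {j k : ℕ} (hg : FeasibleIn j mid out) (hf : FeasibleIn k inp mid) :
    FeasibleIn (j + k) inp out := by
  obtain ⟨f, hf, m, hm⟩ := hf
  obtain ⟨g, hg, n, hn⟩ := hg
  obtain ⟨i, hi⟩ := exists_expTower_pow_le k n
  have size (a) : (mid a).size ≤ expTower k (((inp a).size + 2) ^ m) := by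
    rw [← hf a]
    exact (f.size_eval_le _).trans (hm a)
  have h₁ (a) : f.cost (inp a) ≤ expTower (j + k) (((inp a).size + 2) ^ m) := by
    rw [← expTower_expTower]
    exact (hm a).trans (le_expTower j _)
  have h₂ (a) : g.cost (mid a) ≤ expTower (j + k) ((((inp a).size + 2) ^ m + 2) ^ i) := by
    rw [← expTower_expTower]
    refine (hn a).trans (expTower_mono j (le_trans ?_ (hi _)))
    exact Nat.pow_le_pow_left (Nat.add_le_add_right (size a) 2) n
  obtain ⟨l, hl⟩ : PolyLE (fun a => ((inp a).size + 2) ^ m + (((inp a).size + 2) ^ m + 2) ^ i)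
      (fun a => (inp a).size) := by
    have : PolyLE (fun a => ((inp a).size + 2) ^ m) (fun a => (inp a).size) :=
      ⟨m, fun a => le_rfl⟩
    exact this.add ((this.add (.const 2)).pow i)
  refine ⟨.comp g f, fun a => by simp only [Code.eval, hf, hg], l, fun a => ?_⟩
  simp only [Code.cost, hf]
  refine (Nat.add_le_add (h₁ a) (h₂ a)).trans ?_
  exact (expTower_add_le _ (Nat.one_le_pow _ _ (by omega)) (Nat.one_le_pow _ _ (by omega))).trans
    (expTower_mono _ (hl a))

theorem FeasibleIn.comp (hg : Feasible mid out) (hf : Feasible inp mid) : Feasible inp out :=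
  FeasibleIn.compose (j := 0) (k := 0) hg hf

theorem FeasibleIn.reindex {k : ℕ} (h : FeasibleIn k inp out) (φ : β → α) :
    FeasibleIn k (fun b => inp (φ b)) (fun b => out (φ b)) :=
  let ⟨c, hc, j, hj⟩ := h
  ⟨c, fun _ => hc _, j, fun _ => hj _⟩

theorem feasible_of_cost {k : ℕ} (c : Code) (hc : ∀ a, c.eval (inp a) = out a)
    (h : PolyLE (fun a => c.cost (inp a)) fun a => (inp a).size) : FeasibleIn k inp out := by
  obtain ⟨j, hj⟩ := h
  exact ⟨c, hc, j, fun a => (hj a).trans (le_expTower k _)⟩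

/-- Here `B` bounds intermediate data that may be much larger than the input. A cost that is
polynomial in both stays below a tower of the same height as the one for `B`. -/
theorem feasible_of_cost_add {k : ℕ} (c : Code) (hc : ∀ a, c.eval (inp a) = out a) {B : α → ℕ}
    (h : PolyLE (fun a => c.cost (inp a)) fun a => (inp a).size + B a)
    (hB : ∃ j, ∀ a, B a ≤ expTower k (((inp a).size + 2) ^ j)) : FeasibleIn k inp out := by
  obtain ⟨i, hi⟩ := h
  obtain ⟨j, hj⟩ := hB
  obtain ⟨m, hm⟩ := exists_expTower_pow_le k i
  obtain ⟨n, hn⟩ : PolyLE (fun a => ((inp a).size + ((inp a).size + 2) ^ j + 2) ^ m)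
      (fun a => (inp a).size) :=
    (((PolyLE.refl _).add ⟨j, fun a => le_rfl⟩).add (.const 2)).pow m
  refine ⟨c, hc, n, fun a => (hi a).trans (le_trans (Nat.pow_le_pow_left ?_ i)
    ((hm _).trans (expTower_mono k (hn a))))⟩
  refine Nat.add_le_add_right ((Nat.add_le_add (le_expTower k _) (hj a)).trans ?_) 2
  exact expTower_add_le k (inp a).size_pos (Nat.one_le_pow _ _ (by omega))

theorem FeasibleIn.cost (h : Feasible inp out) : ∃ c : Code, (∀ a, c.eval (inp a) = out a) ∧
    PolyLE (fun a => c.cost (inp a)) fun a => (inp a).size := h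

theorem FeasibleIn.size (h : Feasible inp out) :
    PolyLE (fun a => (out a).size) fun a => (inp a).size := by
  obtain ⟨c, hc, hp⟩ := FeasibleIn.cost h
  exact hp.mono fun a => by rw [← hc]; exact c.size_eval_le _

theorem polyLE_mul_size (n : ℕ) : PolyLE (fun a => n * (inp a).size) fun a => (inp a).size :=
  (PolyLE.const n).mul (PolyLE.refl _)

theorem feasible_id (inp : α → Data) : Feasible inp inp :=
  feasible_of_cost .id (fun _ => rfl) (polyLE_mul_size 40)

theorem FeasibleIn.mono {k : ℕ} (h : Feasible inp out) : FeasibleIn k inp out := by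
  obtain ⟨c, hc, hp⟩ := FeasibleIn.cost h
  exact feasible_of_cost c hc hp

theorem FeasibleIn.cons {k : ℕ} {f g : α → Data} (hf : FeasibleIn k inp f)
    (hg : FeasibleIn k inp g) : FeasibleIn k inp fun a => .cons (f a) (g a) := by
  obtain ⟨f, hf, m, hm⟩ := hf
  obtain ⟨g, hg, n, hn⟩ := hg
  have one (x m : ℕ) : 1 ≤ (x + 2) ^ m := Nat.one_le_pow _ _ (by omega)
  obtain ⟨j, hj⟩ : PolyLE (fun a => 40 * (inp a).size + ((inp a).size + 2) ^ m +
      ((inp a).size + 2) ^ n) (fun a => (inp a).size) :=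
    ((polyLE_mul_size 40).add ⟨m, fun _ => le_rfl⟩).add ⟨n, fun _ => le_rfl⟩
  refine ⟨.pair f g, fun a => by simp only [Code.eval, hf, hg], j, fun a => ?_⟩
  simp only [Code.cost]
  have h₀ := (inp a).size_pos
  refine le_trans (Nat.add_le_add (Nat.add_le_add (le_expTower k _) (hm a)) (hn a)) ?_
  refine le_trans (Nat.add_le_add_right (expTower_add_le k (by omega) (one _ _)) _) ?_
  refine le_trans (expTower_add_le k ?_ (one _ _)) (expTower_mono k (hj a))
  omega

theorem feasible_hd {f g : α → Data} : Feasible (fun a => .cons (f a) (g a)) f :=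
  feasible_of_cost .hd (fun _ => rfl) (polyLE_mul_size 40)

theorem feasible_tl {f g : α → Data} : Feasible (fun a => .cons (f a) (g a)) g :=
  feasible_of_cost .tl (fun _ => rfl) (polyLE_mul_size 40)

theorem FeasibleIn.fst {f g : α → Data} (h : Feasible inp fun a => .cons (f a) (g a)) :
    Feasible inp f := feasible_hd.comp h

theorem FeasibleIn.snd {f g : α → Data} (h : Feasible inp fun a => .cons (f a) (g a)) :
    Feasible inp g := feasible_tl.comp h

theorem FeasibleIn.tl {f : α → Data} (h : Feasible inp f) : Feasible inp fun a => (f a).tl :=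
  FeasibleIn.comp (feasible_of_cost .tl (fun _ => rfl) (polyLE_mul_size 40)) h

theorem FeasibleIn.hd {f : α → Data} (h : Feasible inp f) : Feasible inp fun a => (f a).hd :=
  FeasibleIn.comp (feasible_of_cost .hd (fun _ => rfl) (polyLE_mul_size 40)) h

theorem FeasibleIn.count {f : α → Data} (h : Feasible inp f) :
    Feasible inp fun a => .ofNat (f a).size :=
  FeasibleIn.comp (feasible_of_cost .count (fun _ => rfl) (polyLE_mul_size 40)) h

theorem feasible_nil : Feasible inp fun _ => .nil :=
  feasible_of_cost .nil (fun _ => rfl) (polyLE_mul_size 40)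

theorem feasible_const (d : Data) : Feasible inp fun _ => d := by
  induction d with
  | nil => exact feasible_nil
  | cons a b iha ihb => exact iha.cons ihb

/-- A function that is feasible stays so in a larger environment. -/
theorem FeasibleIn.weaken (h : Feasible inp out) {φ : β → α} {e : β → Data} :
    Feasible (fun b => .cons (inp (φ b)) (e b)) fun b => out (φ b) :=
  (h.reindex φ).comp feasible_hd

/-- This transports a fact about an outer environment into the body of a loop: the environment there
is a larger tree, from which the outer one can be extracted by `hφ`. -/
theorem FeasibleIn.via (h : Feasible inp out) {inp' : β → Data} {φ : β → α}
    (hφ : Feasible inp' fun b => inp (φ b)) : Feasible inp' fun b => out (φ b) :=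
  (h.reindex φ).comp hφ

/-- Name the environment in order to access its components. -/
theorem feasible_env (h : Feasible inp inp → Feasible inp out) : Feasible inp out :=
  h (feasible_id inp)

theorem FeasibleIn.condNil {t f g : α → Data} (ht : Feasible inp t) (hf : Feasible inp f)
    (hg : Feasible inp g) : Feasible inp fun a => bif (t a).isNil then f a else g a := by
  have hs := FeasibleIn.size ht
  obtain ⟨t, ht, hpt⟩ := FeasibleIn.cost ht
  obtain ⟨f, hf, hpf⟩ := FeasibleIn.cost hf
  obtain ⟨g, hg, hpg⟩ := FeasibleIn.cost hg
  refine feasible_of_cost (.cond t f g) (fun a => by simp only [Code.eval, ht, hf, hg])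
    (((((PolyLE.const 40).mul ((PolyLE.refl _).add hs)).add hpt).add (hpf.add hpg)).mono
      fun a => ?_)
  simp only [Code.cost, ht]
  cases (Data.isNil _) <;> simp only [cond_true, cond_false] <;> omega

/-- The branches are exchanged because `false` is encoded by the empty tree. -/
theorem FeasibleIn.cond {t : α → Bool} {f g : α → Data} (ht : Feasible inp fun a => .ofBool (t a))
    (hf : Feasible inp f) (hg : Feasible inp g) :
    Feasible inp fun a => bif t a then f a else g a := by
  convert ht.condNil hg hf using 2 with a
  cases t a <;> rfl

end Feasible

/-! ### Lists -/

theorem Data.size_ofList_le {l : List Data} {B : ℕ} (h : ∀ d ∈ l, d.size ≤ B) :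
    (Data.ofList l).size ≤ l.length * (B + 1) + 1 := by
  induction l with
  | nil => simp [Data.ofList]
  | cons d l ih =>
    have h₁ := ih fun e he => h e (List.mem_cons_of_mem d he)
    have h₂ := h d List.mem_cons_self
    simp only [Data.ofList, Data.size_cons, List.length_cons]
    nlinarith

theorem Data.length_lt_size_ofList (l : List Data) : l.length < (Data.ofList l).size := by
  induction l with
  | nil => simp [Data.ofList]
  | cons d l ih =>
    simp only [Data.ofList, Data.size_cons, List.length_cons]
    omega

theorem Data.size_le_size_ofList {l : List Data} {d : Data} (h : d ∈ l) :
    d.size ≤ (Data.ofList l).size := by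
  induction l with
  | nil => simp at h
  | cons e l ih =>
    simp only [Data.ofList, Data.size_cons]
    rcases List.mem_cons.1 h with rfl | h
    · omega
    · have := ih h
      omega

/-! ### Right folds with a bound on the accumulator -/

section Fold

variable {α : Type} {inp : α → Data}

/-- Iterating a polynomial-time step may square the size each time, so a polynomial step alone
proves nothing. The bound `hb` on the accumulator after every suffix prevents this: each step costs
a polynomial in the input size and `B`, and there are as many steps as elements. -/
theorem FeasibleIn.foldrIn {k : ℕ} {β σ : α → Type} {encβ : ∀ a, β a → Data} {encσ : ∀ a, σ a → Data}
    {l : ∀ a, List (β a)} {s : ∀ a, σ a} {F : ∀ a, β a → σ a → σ a}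
    (hl : Feasible inp fun a => .ofList ((l a).map (encβ a)))
    (hs : Feasible inp fun a => encσ a (s a))
    (hF : Feasible
      (fun q : (a : α) × β a × σ a => .cons (inp q.1) (.cons (encβ _ q.2.1) (encσ _ q.2.2)))
      fun q => encσ _ (F q.1 q.2.1 q.2.2))
    {B : α → ℕ} (hB : ∃ j, ∀ a, B a ≤ expTower k (((inp a).size + 2) ^ j))
    (hb : ∀ a t, t <:+ l a → (encσ a (t.foldr (F a) (s a))).size ≤ B a) :
    FeasibleIn k inp fun a => encσ a ((l a).foldr (F a) (s a)) := by
  -- The body of `Code.foldr` sees only an element and the accumulator; therefore the environment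
  -- `inp a` travels as the first half of the accumulator and is removed at the end by
  -- `feasible_tl`.
  have hst : Feasible
      (fun q : (a : α) × β a × σ a => .cons (encβ _ q.2.1) (.cons (inp q.1) (encσ _ q.2.2)))
      fun q => .cons (inp q.1) (encσ _ (F q.1 q.2.1 q.2.2)) :=
    have h₁ := (feasible_id _).snd.fst
    h₁.cons (hF.comp (h₁.cons ((feasible_id _).fst.cons (feasible_id _).snd.snd)))
  have hi : Feasible inp fun a => .cons (.ofList ((l a).map (encβ a)))
      (.cons (inp a) (encσ a (s a))) := hl.cons ((feasible_id _).cons hs)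
  rw [← Nat.zero_add k]
  refine FeasibleIn.compose (feasible_tl (f := inp)) ?_
  rw [← Nat.add_zero k]
  refine FeasibleIn.compose ?_ hi
  obtain ⟨c, hc, i, hk⟩ := FeasibleIn.cost hst
  -- In the base of the power, 4 consists of the two nodes that join the three parts of the input of
  -- a step, and of the 2 in the definition of a polynomial bound.
  have key (a) (t : List (β a)) : t <:+ l a →
      ((Data.ofList (t.map (encβ a))).foldr
        (fun e p => (c.eval (.cons e p.1), c.cost (.cons e p.1) + p.2))
        (.cons (inp a) (encσ a (s a)), 0)).1 =
          .cons (inp a) (encσ a (t.foldr (F a) (s a))) ∧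
      ((Data.ofList (t.map (encβ a))).foldr
        (fun e p => (c.eval (.cons e p.1), c.cost (.cons e p.1) + p.2))
        (.cons (inp a) (encσ a (s a)), 0)).2 ≤
          t.length * ((Data.ofList ((l a).map (encβ a))).size + (inp a).size + B a + 4) ^ i := by
    induction t with
    | nil => simp [Data.ofList, Data.foldr]
    | cons e t ih =>
      intro ht
      obtain ⟨ih₁, ih₂⟩ := ih ((List.suffix_cons e t).trans ht)
      simp only [List.map_cons, Data.ofList, Data.foldr, ih₁]
      refine ⟨by rw [hc ⟨a, e, t.foldr (F a) (s a)⟩]; rfl, ?_⟩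
      have h₁ := hk ⟨a, e, t.foldr (F a) (s a)⟩
      have h₂ := hb a t ((List.suffix_cons e t).trans ht)
      have h₃ : (encβ a e).size ≤ (Data.ofList ((l a).map (encβ a))).size :=
        Data.size_le_size_ofList (List.mem_map_of_mem (ht.subset List.mem_cons_self))
      have h₄ := h₁.trans (Nat.pow_le_pow_left (m := (Data.ofList ((l a).map (encβ a))).size +
        (inp a).size + B a + 4) (by simp only [Data.size_cons]; omega) i)
      rw [List.length_cons, Nat.add_one_mul]
      exact (Nat.add_le_add h₄ ih₂).trans (Nat.add_comm _ _).le
  have hev (a) : Code.eval (.foldr c) (.cons (.ofList ((l a).map (encβ a)))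
      (.cons (inp a) (encσ a (s a)))) = .cons (inp a) (encσ a ((l a).foldr (F a) (s a))) := by
    rw [← (key a _ List.suffix_rfl).1]
    simp only [Code.eval, Data.hd, Data.tl]
    generalize Data.ofList ((l a).map (encβ a)) = d
    induction d with
    | nil => rfl
    | cons e d _ ih => simp only [Data.foldr, ih]
  have hB' : ∃ j, ∀ a, B a ≤ expTower k (((Data.cons (.ofList ((l a).map (encβ a)))
      (.cons (inp a) (encσ a (s a)))).size + 2) ^ j) := by
    obtain ⟨j, hj⟩ := hB
    refine ⟨j, fun a => (hj a).trans (expTower_mono k (Nat.pow_le_pow_left ?_ j))⟩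
    simp only [Data.size_cons]
    omega
  refine feasible_of_cost_add (.foldr c) hev ?_ hB'
  have le {f : α → ℕ} (h : ∀ a, f a ≤ (Data.cons (.ofList ((l a).map (encβ a)))
      (.cons (inp a) (encσ a (s a)))).size + B a) := PolyLE.of_le h
  refine (((PolyLE.const 40).mul (le fun a => Nat.le_add_right _ _)).add
    ((le (f := fun a => (l a).length) fun a => ?_).mul (((((le fun a => ?_).add
    (le fun a => ?_)).add
    (le fun a => Nat.le_add_left _ _)).add (.const 4)).pow i))).mono fun a =>
      Nat.add_le_add_left ((key a _ List.suffix_rfl).2.trans (Nat.mul_le_mul_right _ ?_)) _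
  · have := Data.length_lt_size_ofList ((l a).map (encβ a))
    rw [List.length_map] at this
    simp only [Data.size_cons]
    omega
  · simp only [Data.size_cons]
    omega
  · simp only [Data.size_cons]
    omega
  · exact le_rfl

theorem FeasibleIn.foldr {β σ : α → Type} {encβ : ∀ a, β a → Data} {encσ : ∀ a, σ a → Data}
    {l : ∀ a, List (β a)} {s : ∀ a, σ a} {F : ∀ a, β a → σ a → σ a}
    (hl : Feasible inp fun a => .ofList ((l a).map (encβ a)))
    (hs : Feasible inp fun a => encσ a (s a))
    (hF : Feasible
      (fun q : (a : α) × β a × σ a => .cons (inp q.1) (.cons (encβ _ q.2.1) (encσ _ q.2.2)))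
      fun q => encσ _ (F q.1 q.2.1 q.2.2))
    {B : α → ℕ} (hB : PolyLE B fun a => (inp a).size)
    (hb : ∀ a t, t <:+ l a → (encσ a (t.foldr (F a) (s a))).size ≤ B a) :
    Feasible inp fun a => encσ a ((l a).foldr (F a) (s a)) :=
  FeasibleIn.foldrIn (k := 0) hl hs hF hB hb

end Fold

end UnreliableSynthesis

namespace UnreliableSynthesis

/-! ### Feasible operations on lists and numbers -/

theorem Data.size_ofList_append (l l' : List Data) :
    (Data.ofList (l ++ l')).size + 1 = (Data.ofList l).size + (Data.ofList l').size := by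
  induction l with
  | nil => simp [Data.ofList, Nat.add_comm]
  | cons d l ih =>
    simp only [List.cons_append, Data.ofList, Data.size_cons]
    omega

theorem Data.size_ofList_le_of_suffix {l l' : List Data} (h : l <:+ l') :
    (Data.ofList l).size ≤ (Data.ofList l').size := by
  obtain ⟨t, rfl⟩ := h
  have := Data.size_ofList_append t l
  have := (Data.ofList t).size_pos
  omega

theorem Data.size_ofList_flatten_le (ll : List (List Data)) :
    (Data.ofList ll.flatten).size ≤ (Data.ofList (ll.map Data.ofList)).size := by
  induction ll with
  | nil => exact le_rfl
  | cons l ll ih =>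
    have := Data.size_ofList_append l ll.flatten
    simp only [List.flatten_cons, List.map_cons, Data.ofList, Data.size_cons]
    omega

theorem Data.ofNat_eq (n : ℕ) : Data.ofNat n = Data.ofList (List.replicate n .nil) := by
  induction n with
  | zero => rfl
  | succ n ih => rw [Data.ofNat, ih]; rfl

@[simp] theorem Data.size_ofNat (n : ℕ) : (Data.ofNat n).size = 2 * n + 1 := by
  induction n with
  | zero => rfl
  | succ n ih => simp only [Data.ofNat, Data.size_cons, ih, Data.size_nil]; omega

theorem Data.size_ofBool_le (b : Bool) : (Data.ofBool b).size ≤ 3 := by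
  cases b <;> simp [Data.ofBool]

/-- Optional values as trees. -/
def Data.ofOption {σ : Type} (enc : σ → Data) : Option σ → Data
  | none => .nil
  | some x => .cons .nil (enc x)

section Lists

variable {α : Type} {inp : α → Data}

theorem FeasibleIn.map {β : α → Type} {enc : ∀ a, β a → Data} {l : ∀ a, List (β a)}
    {g : ∀ a, β a → Data} (hl : Feasible inp fun a => .ofList ((l a).map (enc a)))
    (hg : Feasible (fun q : (a : α) × β a => .cons (inp q.1) (enc _ q.2)) fun q => g q.1 q.2) :
    Feasible inp fun a => .ofList ((l a).map (g a)) := by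
  have h := FeasibleIn.foldr (σ := fun _ => List Data) (encσ := fun _ => Data.ofList)
    (s := fun _ => []) (F := fun a e r => g a e :: r) hl feasible_nil
    (((hg.reindex fun q : (a : α) × β a × List Data => ⟨q.1, q.2.1⟩).comp
      ((feasible_id _).fst.cons (feasible_id _).snd.fst)).cons (feasible_id _).snd.snd)
    (B := fun a => (Data.ofList ((l a).map (g a))).size) ?_ ?_
  · simpa only [← List.map_eq_foldr] using h
  · have h₁ := FeasibleIn.size hl
    obtain ⟨k, hk⟩ := FeasibleIn.size hg
    refine PolyLE.mono ((h₁.mul (((((PolyLE.refl _).add h₁).add (.const 3)).pow k).add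
      (.const 1))).add (.const 1)) fun a => ?_
    refine (Data.size_ofList_le (B := ((inp a).size +
      (Data.ofList ((l a).map (enc a))).size + 3) ^ k) ?_).trans ?_
    · intro d hd
      obtain ⟨b, hb, rfl⟩ := List.mem_map.1 hd
      refine (hk ⟨a, b⟩).trans (Nat.pow_le_pow_left ?_ k)
      have := Data.size_le_size_ofList (List.mem_map_of_mem (f := enc a) hb)
      simp only [Data.size_cons]
      omega
    · refine Nat.add_le_add_right (Nat.mul_le_mul_right _ ?_) 1
      have := Data.length_lt_size_ofList ((l a).map (enc a))
      rw [List.length_map] at this ⊢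
      exact this.le
  · intro a t ht
    simp only [← List.map_eq_foldr]
    exact Data.size_ofList_le_of_suffix (ht.map _)

theorem FeasibleIn.append {l l' : α → List Data} (hl : Feasible inp fun a => .ofList (l a))
    (hl' : Feasible inp fun a => .ofList (l' a)) :
    Feasible inp fun a => .ofList (l a ++ l' a) := by
  have foldr (t s : List Data) : t.foldr (fun e r => e :: r) s = t ++ s := by
    induction t with
    | nil => rfl
    | cons e t ih => rw [List.foldr_cons, ih, List.cons_append]
  have h := FeasibleIn.foldr (β := fun _ => Data) (encβ := fun _ d => d) (l := l)
    (σ := fun _ => List Data) (encσ := fun _ => Data.ofList)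
    (F := fun a e r => e :: r) (by simpa using hl) hl'
    ((feasible_id _).snd.fst.cons (feasible_id _).snd.snd)
    (hl.size.add hl'.size) ?_
  · simpa only [foldr] using h
  · intro a t ht
    have h₁ := Data.size_ofList_append t (l' a)
    have h₂ := Data.size_ofList_le_of_suffix ht
    rw [foldr]
    omega

theorem FeasibleIn.flatten {ll : α → List (List Data)}
    (h : Feasible inp fun a => .ofList ((ll a).map Data.ofList)) :
    Feasible inp fun a => .ofList (ll a).flatten := by
  have foldr (t : List (List Data)) : t.foldr (fun e r => e ++ r) [] = t.flatten := by
    induction t with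
    | nil => rfl
    | cons e t ih => rw [List.foldr_cons, ih, List.flatten_cons]
  have h' := FeasibleIn.foldr (β := fun _ => List Data) (encβ := fun _ => Data.ofList) (l := ll)
    (σ := fun _ => List Data) (encσ := fun _ => Data.ofList) (s := fun _ => [])
    (F := fun a e r => e ++ r) h feasible_nil
    ((feasible_id _).snd.fst.append (feasible_id _).snd.snd) h.size ?_
  · simpa only [foldr] using h'
  · intro a t ht
    simp only [foldr]
    exact (Data.size_ofList_flatten_le t).trans (Data.size_ofList_le_of_suffix (ht.map _))

theorem FeasibleIn.reverse {l : α → List Data} (hl : Feasible inp fun a => .ofList (l a)) :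
    Feasible inp fun a => .ofList (l a).reverse := by
  have size (t : List Data) : (Data.ofList t.reverse).size = (Data.ofList t).size := by
    induction t with
    | nil => rfl
    | cons e t ih =>
      have := Data.size_ofList_append t.reverse [e]
      rw [List.reverse_cons]
      simp only [Data.ofList, Data.size_cons, Data.size_nil] at this ⊢
      omega
  have foldr (t : List Data) : t.foldr (fun e r => r ++ [e]) [] = t.reverse := by
    induction t with
    | nil => rfl
    | cons e t ih => rw [List.foldr_cons, ih, List.reverse_cons]
  have h := FeasibleIn.foldr (β := fun _ => Data) (encβ := fun _ d => d) (l := l)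
    (σ := fun _ => List Data) (encσ := fun _ => Data.ofList) (s := fun _ => [])
    (F := fun a e r => r ++ [e]) (by simpa using hl) feasible_nil
    ((feasible_id _).snd.snd.append ((feasible_id _).snd.fst.cons feasible_nil)) hl.size ?_
  · simpa only [foldr] using h
  · intro a t ht
    rw [foldr, size]
    exact Data.size_ofList_le_of_suffix ht

/-- A unary number is a list of empty trees, so iteration is a fold that ignores the elements. -/
theorem FeasibleIn.iterateIn {k : ℕ} {σ : α → Type} {enc : ∀ a, σ a → Data} {n : α → ℕ}
    {s : ∀ a, σ a} {F : ∀ a, σ a → σ a} (hn : Feasible inp fun a => .ofNat (n a))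
    (hs : Feasible inp fun a => enc a (s a))
    (hF : Feasible (fun q : (a : α) × σ a => .cons (inp q.1) (enc _ q.2)) fun q => enc _ (F _ q.2))
    {B : α → ℕ} (hB : ∃ j, ∀ a, B a ≤ expTower k (((inp a).size + 2) ^ j))
    (hb : ∀ a, ∀ i ≤ n a, (enc a ((F a)^[i] (s a))).size ≤ B a) :
    FeasibleIn k inp fun a => enc a ((F a)^[n a] (s a)) := by
  have foldr (a) (m : ℕ) : (List.replicate m ()).foldr (fun _ => F a) (s a) = (F a)^[m] (s a) := by
    induction m with
    | zero => rfl
    | succ m ih =>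
      rw [List.replicate_succ, List.foldr_cons, ih, Function.iterate_succ_apply']
  have h := FeasibleIn.foldrIn (k := k) (β := fun _ => Unit) (encβ := fun _ _ => .nil)
    (l := fun a => List.replicate (n a) ()) (σ := σ) (encσ := enc) (s := s)
    (F := fun a _ r => F a r) (by simpa [← Data.ofNat_eq] using hn) hs
    ((hF.reindex fun q : (a : α) × Unit × σ a => ⟨q.1, q.2.2⟩).comp
      ((feasible_id _).fst.cons (feasible_id _).snd.snd)) hB ?_
  · simpa only [foldr] using h
  · intro a t ht
    obtain ⟨i, hi, rfl⟩ : ∃ i ≤ n a, t = List.replicate i () := by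
      refine ⟨t.length, by simpa using ht.length_le, ?_⟩
      exact List.eq_replicate_iff.2 ⟨rfl, fun _ _ => rfl⟩
    rw [foldr]
    exact hb a i hi

theorem FeasibleIn.iterate {σ : α → Type} {enc : ∀ a, σ a → Data} {n : α → ℕ}
    {s : ∀ a, σ a} {F : ∀ a, σ a → σ a} (hn : Feasible inp fun a => .ofNat (n a))
    (hs : Feasible inp fun a => enc a (s a))
    (hF : Feasible (fun q : (a : α) × σ a => .cons (inp q.1) (enc _ q.2)) fun q => enc _ (F _ q.2))
    {B : α → ℕ} (hB : PolyLE B fun a => (inp a).size)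
    (hb : ∀ a, ∀ i ≤ n a, (enc a ((F a)^[i] (s a))).size ≤ B a) :
    Feasible inp fun a => enc a ((F a)^[n a] (s a)) :=
  FeasibleIn.iterateIn (k := 0) hn hs hF hB hb

theorem FeasibleIn.drop {l : α → List Data} {i : α → ℕ} (hl : Feasible inp fun a => .ofList (l a))
    (hi : Feasible inp fun a => .ofNat (i a)) :
    Feasible inp fun a => .ofList ((l a).drop (i a)) := by
  have it (i : ℕ) : ∀ l : List Data, List.tail^[i] l = l.drop i := by
    induction i with
    | zero => exact fun l => rfl
    | succ i ih => exact fun l => by rw [Function.iterate_succ_apply, ih, List.drop_tail]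
  have h := FeasibleIn.iterate (σ := fun _ => List Data) (enc := fun _ => Data.ofList) (s := l)
    (F := fun _ => List.tail) hi hl (by
      have := (feasible_id (fun q : (_ : α) × List Data => .cons (inp q.1) (.ofList q.2))).snd.tl
      convert this using 2 with q
      cases q.2 <;> rfl) hl.size ?_
  · simpa only [it] using h
  · intro a i _
    rw [it]
    exact Data.size_ofList_le_of_suffix (List.drop_suffix i (l a))

theorem FeasibleIn.getD {l : α → List Data} {i : α → ℕ} (hl : Feasible inp fun a => .ofList (l a))
    (hi : Feasible inp fun a => .ofNat (i a)) :
    Feasible inp fun a => (l a).getD (i a) .nil := by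
  convert (hl.drop hi).hd using 2 with a
  rw [List.getD_eq_getElem?_getD, ← List.head?_drop]
  cases (l a).drop (i a) <;> rfl

theorem FeasibleIn.all {β : α → Type} {enc : ∀ a, β a → Data} {l : ∀ a, List (β a)}
    {p : ∀ a, β a → Bool} (hl : Feasible inp fun a => .ofList ((l a).map (enc a)))
    (hp : Feasible (fun q : (a : α) × β a => .cons (inp q.1) (enc _ q.2))
      fun q => .ofBool (p q.1 q.2)) :
    Feasible inp fun a => .ofBool ((l a).all (p a)) := by
  have foldr (a) (t : List (β a)) : t.foldr (fun e r => p a e && r) true = t.all (p a) := by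
    induction t with
    | nil => rfl
    | cons e t ih => rw [List.foldr_cons, ih, List.all_cons]
  have h := FeasibleIn.foldr (σ := fun _ => Bool) (encσ := fun _ => Data.ofBool)
    (s := fun _ => true) (F := fun a e r => p a e && r) hl (feasible_const (.ofBool true)) ?_
    (PolyLE.const 3) fun _ _ _ => Data.size_ofBool_le _
  · simpa only [foldr] using h
  · have := FeasibleIn.cond ((hp.reindex fun q : (a : α) × β a × Bool => ⟨q.1, q.2.1⟩).comp
      ((feasible_id (fun q : (a : α) × β a × Bool =>
        .cons (inp q.1) (.cons (enc _ q.2.1) (.ofBool q.2.2)))).fst.cons (feasible_id _).snd.fst))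
      (feasible_id _).snd.snd (feasible_const (.ofBool false))
    convert this using 2 with q
    cases p q.1 q.2.1 <;> rfl

theorem FeasibleIn.not {b : α → Bool} (h : Feasible inp fun a => .ofBool (b a)) :
    Feasible inp fun a => .ofBool (!b a) := by
  convert h.cond (feasible_const (.ofBool false)) (feasible_const (.ofBool true)) using 2 with a
  cases b a <;> rfl

theorem FeasibleIn.and {b c : α → Bool} (h : Feasible inp fun a => .ofBool (b a))
    (h' : Feasible inp fun a => .ofBool (c a)) : Feasible inp fun a => .ofBool (b a && c a) := by
  convert h.cond h' (feasible_const (.ofBool false)) using 2 with a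
  cases b a <;> rfl

theorem FeasibleIn.or {b c : α → Bool} (h : Feasible inp fun a => .ofBool (b a))
    (h' : Feasible inp fun a => .ofBool (c a)) : Feasible inp fun a => .ofBool (b a || c a) := by
  convert h.cond (feasible_const (.ofBool true)) h' using 2 with a
  cases b a <;> rfl

theorem FeasibleIn.any {β : α → Type} {enc : ∀ a, β a → Data} {l : ∀ a, List (β a)}
    {p : ∀ a, β a → Bool} (hl : Feasible inp fun a => .ofList ((l a).map (enc a)))
    (hp : Feasible (fun q : (a : α) × β a => .cons (inp q.1) (enc _ q.2))
      fun q => .ofBool (p q.1 q.2)) :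
    Feasible inp fun a => .ofBool ((l a).any (p a)) := by
  convert (hl.all (p := fun a b => !p a b) hp.not).not using 3 with a
  exact List.any_eq_not_all_not

theorem FeasibleIn.find? {β : α → Type} {enc : ∀ a, β a → Data} {l : ∀ a, List (β a)}
    {p : ∀ a, β a → Bool} (hl : Feasible inp fun a => .ofList ((l a).map (enc a)))
    (hp : Feasible (fun q : (a : α) × β a => .cons (inp q.1) (enc _ q.2))
      fun q => .ofBool (p q.1 q.2)) :
    Feasible inp fun a => .ofOption (enc a) ((l a).find? (p a)) := by
  have foldr (a) (t : List (β a)) :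
      t.foldr (fun e r => bif p a e then some e else r) none = t.find? (p a) := by
    induction t with
    | nil => rfl
    | cons e t ih => rw [List.foldr_cons, ih, List.find?_cons]; cases p a e <;> rfl
  have h := FeasibleIn.foldr (σ := fun a => Option (β a)) (encσ := fun a => .ofOption (enc a))
    (s := fun _ => none) (F := fun a e r => bif p a e then some e else r) hl feasible_nil ?_
    (hl.size.add (.const 2)) ?_
  · simpa only [foldr] using h
  · have := FeasibleIn.cond ((hp.reindex fun q : (a : α) × β a × Option (β a) => ⟨q.1, q.2.1⟩).comp
      ((feasible_id (fun q : (a : α) × β a × Option (β a) => .cons (inp q.1) (.cons (enc _ q.2.1)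
        (.ofOption (enc _) q.2.2)))).fst.cons (feasible_id _).snd.fst))
      (feasible_nil.cons (feasible_id _).snd.fst) (feasible_id _).snd.snd
    convert this using 2 with q
    cases p q.1 q.2.1 <;> rfl
  · intro a t ht
    rw [foldr]
    rcases h : t.find? (p a) with _ | e
    · simp [Data.ofOption]
    · have := Data.size_le_size_ofList (List.mem_map_of_mem (f := enc a)
        (ht.subset (List.mem_of_find?_eq_some h)))
      simp only [Data.ofOption, Data.size_cons, Data.size_nil]
      omega

/-! #### Numbers -/

theorem polyLE_of_feasible_ofNat {n : α → ℕ} (hn : Feasible inp fun a => .ofNat (n a)) :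
    PolyLE n fun a => (inp a).size :=
  hn.size.mono fun a => by simp only [Data.size_ofNat]; omega

theorem FeasibleIn.add {m n : α → ℕ} (hm : Feasible inp fun a => .ofNat (m a))
    (hn : Feasible inp fun a => .ofNat (n a)) : Feasible inp fun a => .ofNat (m a + n a) := by
  simp only [Data.ofNat_eq] at hm hn ⊢
  simpa only [List.replicate_append_replicate] using hm.append hn

theorem FeasibleIn.succ {n : α → ℕ} (hn : Feasible inp fun a => .ofNat (n a)) :
    Feasible inp fun a => .ofNat (n a + 1) := feasible_nil.cons hn

theorem FeasibleIn.mul {m n : α → ℕ} (hm : Feasible inp fun a => .ofNat (m a))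
    (hn : Feasible inp fun a => .ofNat (n a)) : Feasible inp fun a => .ofNat (m a * n a) := by
  have it (a) (i : ℕ) : (fun x => n a + x)^[i] 0 = i * n a := by simp [add_left_iterate]
  have h := FeasibleIn.iterate (σ := fun _ => ℕ) (enc := fun _ => Data.ofNat) (s := fun _ => 0)
    (F := fun a x => n a + x) hm feasible_nil (hn.weaken.add (feasible_id _).snd)
    (((PolyLE.const 2).mul ((polyLE_of_feasible_ofNat hm).mul
      (polyLE_of_feasible_ofNat hn))).add (.const 1)) ?_
  · simpa only [it] using h
  · intro a i hi
    rw [it, Data.size_ofNat]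
    exact Nat.add_le_add_right (Nat.mul_le_mul_left 2 (Nat.mul_le_mul_right _ hi)) 1

/-- Without `hp` the repeated doubling would leave polynomial time. The hypothesis holds whenever
the input already contains an object of this size, such as a transition table. -/
theorem FeasibleIn.two_pow {n : α → ℕ} (hn : Feasible inp fun a => .ofNat (n a))
    (hp : PolyLE (fun a => 2 ^ n a) fun a => (inp a).size) :
    Feasible inp fun a => .ofNat (2 ^ n a) := by
  have it (i : ℕ) : (fun x => x + x)^[i] 1 = 2 ^ i := by
    induction i with
    | zero => rfl
    | succ i ih => rw [Function.iterate_succ_apply', ih, pow_succ, Nat.mul_two]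
  have h := FeasibleIn.iterate (σ := fun _ => ℕ) (enc := fun _ => Data.ofNat) (s := fun _ => 1)
    (F := fun a x => x + x) hn (feasible_const (.ofNat 1))
    ((feasible_id _).snd.add (feasible_id _).snd) (((PolyLE.const 2).mul hp).add (.const 1)) ?_
  · simpa only [it] using h
  · intro a i hi
    rw [it, Data.size_ofNat]
    exact Nat.add_le_add_right (Nat.mul_le_mul_left 2 (Nat.pow_le_pow_right (by omega) hi)) 1

/-- This is the only place where exponential time arises. All constructions below are polynomial
relative to an environment that contains the required powers in unary, and the environment is
produced beforehand by this lemma. -/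
theorem feasibleIn_one_two_pow {n : α → ℕ} (hn : Feasible inp fun a => .ofNat (n a)) :
    FeasibleIn 1 inp fun a => .ofNat (2 ^ n a) := by
  have it (i : ℕ) : (fun x => x + x)^[i] 1 = 2 ^ i := by
    induction i with
    | zero => rfl
    | succ i ih => rw [Function.iterate_succ_apply', ih, pow_succ, Nat.mul_two]
  have h := FeasibleIn.iterateIn (k := 1) (σ := fun _ => ℕ) (enc := fun _ => Data.ofNat)
    (s := fun _ => 1) (F := fun a x => x + x) hn (feasible_const (.ofNat 1))
    ((feasible_id _).snd.add (feasible_id _).snd) (B := fun a => 2 ^ (n a + 2)) ?_ ?_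
  · simpa only [it] using h
  · obtain ⟨j, hj⟩ := (polyLE_of_feasible_ofNat hn).add (.const 2)
    exact ⟨j, fun a => Nat.pow_le_pow_right (by omega) (hj a)⟩
  · intro a i hi
    have h₁ : 2 ^ i ≤ 2 ^ n a := Nat.pow_le_pow_right (by omega) hi
    have h₂ : 1 ≤ 2 ^ n a := Nat.one_le_two_pow
    rw [it, Data.size_ofNat, pow_add]
    omega

theorem feasible_range {n : α → ℕ} (hn : Feasible inp fun a => .ofNat (n a)) :
    Feasible inp fun a => .ofList ((List.range (n a)).map Data.ofNat) := by
  have it (i : ℕ) : (fun l : List ℕ => 0 :: l.map Nat.succ)^[i] [] = List.range i := by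
    induction i with
    | zero => rfl
    | succ i ih => rw [Function.iterate_succ_apply', ih, List.range_succ_eq_map]
  have h := FeasibleIn.iterate (σ := fun _ => List ℕ) (enc := fun _ l => .ofList (l.map Data.ofNat))
    (s := fun _ => []) (F := fun a l => 0 :: l.map Nat.succ) hn feasible_nil (by
      refine feasible_nil.cons ?_
      have := FeasibleIn.map (l := fun q : (_ : α) × List ℕ => q.2) (β := fun _ => ℕ)
        (enc := fun _ => Data.ofNat) (g := fun _ i => Data.ofNat (i + 1))
        (feasible_id (fun q : (_ : α) × List ℕ => .cons (inp q.1)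
          (.ofList (q.2.map Data.ofNat)))).snd (feasible_id _).snd.succ
      simp only [List.map_map]
      exact this)
    (((polyLE_of_feasible_ofNat hn).mul (((PolyLE.const 2).mul
      (polyLE_of_feasible_ofNat hn)).add (.const 2))).add (.const 1)) ?_
  · simpa only [it] using h
  · intro a i hi
    rw [it]
    refine (Data.size_ofList_le (B := 2 * n a + 1) ?_).trans ?_
    · intro d hd
      obtain ⟨j, hj, rfl⟩ := List.mem_map.1 hd
      have := List.mem_range.1 hj
      rw [Data.size_ofNat]
      omega
    · rw [List.length_map, List.length_range]
      exact Nat.add_le_add_right (Nat.mul_le_mul_right _ hi) 1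

theorem feasible_finRange {n : α → ℕ} (hn : Feasible inp fun a => .ofNat (n a)) :
    Feasible inp fun a => .ofList ((List.finRange (n a)).map fun i => Data.ofNat i.1) := by
  convert feasible_range hn using 3 with a
  rw [← List.map_coe_finRange_eq_range, List.map_map]
  rfl

theorem feasible_ofFn {n : α → ℕ} {f : ∀ a, Fin (n a) → Data}
    (hn : Feasible inp fun a => .ofNat (n a))
    (hf : Feasible (fun q : (a : α) × Fin (n a) => .cons (inp q.1) (.ofNat q.2.1))
      fun q => f q.1 q.2) :
    Feasible inp fun a => .ofFn (f a) := by
  simp only [Data.ofFn, List.ofFn_eq_map]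
  exact (feasible_finRange hn).map (β := fun a => Fin (n a)) (enc := fun _ i => .ofNat i.1) hf

theorem FeasibleIn.apply {n : α → ℕ} {f : ∀ a, Fin (n a) → Data} {i : ∀ a, Fin (n a)}
    (hf : Feasible inp fun a => .ofFn (f a)) (hi : Feasible inp fun a => .ofNat (i a).1) :
    Feasible inp fun a => f a (i a) := by
  convert FeasibleIn.getD hf hi using 2 with a
  simp

end Lists

end UnreliableSynthesis

namespace UnreliableSynthesis

/-! ### Valuations -/

/-- All valuations of `k` variables, in the order in which they appear in a table. -/
def vals : (k : ℕ) → List (Val (Fin k))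
  | 0 => [Fin.elim0]
  | k + 1 => (vals k).map (fun v => Fin.cons false v) ++ (vals k).map fun v => Fin.cons true v

/-- The position of a valuation in `vals k`. -/
def valIdx : {k : ℕ} → Val (Fin k) → ℕ
  | 0, _ => 0
  | k + 1, v => (bif v 0 then 2 ^ k else 0) + valIdx (Fin.tail v)

/-- Variable `0` is the most significant bit: the block of valuations with value `false` there comes
first and has length `2 ^ k`. Hence the order of the list, the order of a table and the numbering
agree. -/
theorem map_valIdx_vals (k : ℕ) : (vals k).map valIdx = List.range (2 ^ k) := by
  induction k with
  | zero => rfl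
  | succ k ih =>
    rw [vals, List.map_append, List.map_map, List.map_map, pow_succ, Nat.mul_two, List.range_add,
      ← ih, List.map_map]
    congr 1
    exact List.map_congr_left fun v _ => by simp [valIdx]

theorem valIdx_lt {k : ℕ} (v : Val (Fin k)) : valIdx v < 2 ^ k := by
  induction k with
  | zero => exact Nat.one_pos
  | succ k ih =>
    have := ih (Fin.tail v)
    rw [valIdx, pow_succ]
    cases v 0 <;> simp only [cond_true, cond_false] <;> omega

theorem valIdx_injective (k : ℕ) : Function.Injective (valIdx (k := k)) := by
  induction k with
  | zero => exact fun v w _ => funext fun i => i.elim0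
  | succ k ih =>
    intro v w h
    have hv := valIdx_lt (Fin.tail v)
    have hw := valIdx_lt (Fin.tail w)
    rw [← Fin.cons_self_tail v, ← Fin.cons_self_tail w]
    rw [valIdx, valIdx] at h
    have h₀ : v 0 = w 0 := by
      cases h₁ : v 0 <;> cases h₂ : w 0 <;> simp only [h₁, h₂, cond_true, cond_false] at h <;>
        first | rfl | omega
    rw [h₀] at h ⊢
    rw [ih (Nat.add_left_cancel h)]

/-- The numbering of the valuations given by `valIdx`. -/
noncomputable def valEquiv (k : ℕ) : Val (Fin k) ≃ Fin (2 ^ k) :=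
  .ofBijective (fun v => ⟨valIdx v, valIdx_lt v⟩) <| by
    rw [Fintype.bijective_iff_injective_and_card]
    refine ⟨fun v w h => valIdx_injective k (Fin.mk.inj h), by simp⟩

theorem map_valEquiv_vals (k : ℕ) : (vals k).map (valEquiv k) = List.finRange (2 ^ k) := by
  refine List.map_injective_iff.2 Fin.val_injective ?_
  rw [List.map_map, List.map_coe_finRange_eq_range, ← map_valIdx_vals]
  rfl

theorem mem_vals {k : ℕ} (v : Val (Fin k)) : v ∈ vals k := by
  have h : valEquiv k v ∈ (vals k).map (valEquiv k) := by
    rw [map_valEquiv_vals]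
    exact List.mem_finRange _
  obtain ⟨w, hw, h⟩ := List.mem_map.1 h
  rwa [← (valEquiv k).injective h]

theorem length_vals (k : ℕ) : (vals k).length = 2 ^ k := by
  rw [← List.length_map (valEquiv k), map_valEquiv_vals, List.length_finRange]

theorem Data.ofVal_cons {k : ℕ} (b : Bool) (v : Val (Fin k)) :
    Data.ofVal (Fin.cons b v : Val (Fin (k + 1))) = .cons (.ofBool b) (.ofVal v) := by
  simp [Data.ofVal, Data.ofFn, List.ofFn_succ, Data.ofList]

theorem Data.size_ofVal_le {k : ℕ} (v : Val (Fin k)) : (Data.ofVal v).size ≤ k * 4 + 1 := by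
  refine (Data.size_ofList_le (B := 3) fun d hd => ?_).trans (by simp)
  obtain ⟨i, rfl⟩ := List.mem_ofFn.1 hd
  exact Data.size_ofBool_le _

/-! ### Pairing up the elements of a list -/

/-- One step of `pairUp`. -/
def pairStep (e : Data) (s : Option Data × List Data) : Option Data × List Data :=
  match s.1 with
  | none => (some e, s.2)
  | some d => (none, .cons e d :: s.2)

/-- Pair the first element of a list with the second one, and so on. -/
def pairUp (l : List Data) : List Data := (l.foldr pairStep (none, [])).2

/-- Pairs that have been produced are never inspected again; later ones are only put in front. -/
theorem foldr_pairStep (l r : List Data) : l.foldr pairStep (none, r) =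
    ((l.foldr pairStep (none, [])).1, pairUp l ++ r) := by
  unfold pairUp
  induction l with
  | nil => rfl
  | cons e l ih =>
    rw [List.foldr_cons, List.foldr_cons, ih, pairStep, pairStep]
    cases (l.foldr pairStep (none, [])).1 <;> rfl

theorem foldr_pairStep_length (l : List Data) :
    2 * (pairUp l).length + (l.foldr pairStep (none, [])).1.toList.length = l.length := by
  unfold pairUp
  induction l with
  | nil => rfl
  | cons e l ih =>
    rw [List.foldr_cons, List.length_cons, ← ih, pairStep]
    cases (l.foldr pairStep (none, [])).1 <;> simp
    omega

theorem foldr_pairStep_size (l : List Data) :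
    (Data.ofOption id (l.foldr pairStep (none, [])).1).size + (Data.ofList (pairUp l)).size =
      (Data.ofList l).size + 1 := by
  unfold pairUp
  induction l with
  | nil => rfl
  | cons e l ih =>
    rw [List.foldr_cons, Data.ofList, Data.size_cons, pairStep]
    rcases h : (l.foldr pairStep (none, [])).1 with _ | d
    · rw [h] at ih
      simp only [Data.ofOption, Data.size_cons, id_eq, Data.size_nil] at ih ⊢
      omega
    · rw [h] at ih
      simp only [Data.ofOption, Data.ofList, Data.size_cons, id_eq, Data.size_nil] at ih ⊢
      omega

/-- The fold starts at the right end. When it reaches `l` after an even number of elements, no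
element is waiting for a partner, so no pair crosses the boundary. -/
theorem pairUp_append {l r : List Data} (hr : Even r.length) :
    pairUp (l ++ r) = pairUp l ++ pairUp r ∧ (pairUp r).length = r.length / 2 := by
  have h := foldr_pairStep_length r
  rcases h₀ : (r.foldr pairStep (none, [])).1 with _ | d
  · refine ⟨?_, by rw [h₀] at h; simp at h; omega⟩
    have h₁ : r.foldr pairStep (none, []) = (none, pairUp r) := Prod.ext h₀ rfl
    rw [pairUp, List.foldr_append, h₁, foldr_pairStep]
  · rw [h₀] at h
    obtain ⟨m, hm⟩ := hr
    simp at h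
    omega

theorem iterate_pairUp_append {k : ℕ} : ∀ {l r : List Data}, 2 ^ k ∣ r.length →
    pairUp^[k] (l ++ r) = pairUp^[k] l ++ pairUp^[k] r := by
  induction k with
  | zero => exact fun _ => rfl
  | succ k ih =>
    intro l r h
    rw [pow_succ] at h
    have h₂ : 2 ∣ r.length := (Dvd.intro_left _ rfl).trans h
    obtain ⟨h₃, h₄⟩ := pairUp_append (l := l) (even_iff_two_dvd.2 h₂)
    simp only [Function.iterate_succ_apply, h₃]
    refine ih ?_
    rw [h₄]
    exact (Nat.dvd_div_iff_mul_dvd h₂).2 (by rwa [mul_comm])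

/-- This builds a full binary tree from the list of its leaves without tree recursion, which `Code`
does not offer. The halves for the two values of variable `0` have length `2 ^ k`, so each collapses
to one subtree after `k` rounds, and the last round joins them. -/
theorem iterate_pairUp_vals : ∀ (k : ℕ) (f : Val (Fin k) → Data),
    pairUp^[k] ((vals k).map f) = [.ofTable k f] := by
  intro k
  induction k with
  | zero => exact fun f => rfl
  | succ k ih =>
    intro f
    rw [vals, List.map_append, List.map_map, List.map_map, Function.iterate_succ_apply',
      iterate_pairUp_append (by rw [List.length_map, length_vals]), ih, ih]
    rfl

section Valuations

variable {α : Type} {inp : α → Data}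

theorem feasible_vals {k : α → ℕ} (hk : Feasible inp fun a => .ofNat (k a))
    (hp : PolyLE (fun a => 2 ^ k a) fun a => (inp a).size) :
    Feasible inp fun a => .ofList ((vals (k a)).map Data.ofVal) := by
  have it (i : ℕ) : (fun l : List Data => l.map (Data.cons (.ofBool false)) ++
      l.map (Data.cons (.ofBool true)))^[i] [.nil] = (vals i).map Data.ofVal := by
    induction i with
    | zero => rfl
    | succ i ih =>
      rw [Function.iterate_succ_apply', ih]
      simp [vals, Function.comp_def, Data.ofVal_cons]
  have step (b : Bool) : Feasible (fun q : (_ : α) × List Data => .cons (inp q.1) (.ofList q.2))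
      fun q => .ofList (q.2.map (Data.cons (.ofBool b))) :=
    FeasibleIn.map (β := fun _ => Data) (enc := fun _ d => d) (l := fun q : (_ : α) × List Data => q.2)
      (g := fun _ d => .cons (.ofBool b) d) (by simp only [List.map_id']; exact (feasible_id _).snd)
      ((feasible_const _).cons (feasible_id _).snd)
  have h := FeasibleIn.iterate (σ := fun _ => List Data) (enc := fun _ => Data.ofList)
    (s := fun _ => [.nil]) (F := fun a l => l.map (Data.cons (.ofBool false)) ++
      l.map (Data.cons (.ofBool true))) hk (feasible_const (.ofList [.nil]))
    ((step false).append (step true)) ((hp.mul ((((polyLE_of_feasible_ofNat hk).mul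
      (.const 4)).add (.const 1)).add (.const 1))).add (.const 1)) ?_
  · simpa only [it] using h
  · intro a i hi
    rw [it]
    refine (Data.size_ofList_le (B := k a * 4 + 1) ?_).trans ?_
    · intro d hd
      obtain ⟨v, _, rfl⟩ := List.mem_map.1 hd
      have := Data.size_ofVal_le v
      omega
    · rw [List.length_map, length_vals]
      exact Nat.add_le_add_right (Nat.mul_le_mul_right _ (Nat.pow_le_pow_right (by omega) hi)) 1

theorem FeasibleIn.pairUp {l : α → List Data} (hl : Feasible inp fun a => .ofList (l a)) :
    Feasible inp fun a => .ofList (pairUp (l a)) := by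
  have hF : Feasible (fun q : (_ : α) × Data × Option Data × List Data => .cons (inp q.1)
      (.cons q.2.1 (.cons (.ofOption id q.2.2.1) (.ofList q.2.2.2)))) fun q =>
        .cons (.ofOption id (pairStep q.2.1 q.2.2).1) (.ofList (pairStep q.2.1 q.2.2).2) := by
    have he := (feasible_id (fun q : (_ : α) × Data × Option Data × List Data => .cons (inp q.1)
      (.cons q.2.1 (.cons (.ofOption id q.2.2.1) (.ofList q.2.2.2))))).snd.fst
    have ho := (feasible_id (fun q : (_ : α) × Data × Option Data × List Data => .cons (inp q.1)
      (.cons q.2.1 (.cons (.ofOption id q.2.2.1) (.ofList q.2.2.2))))).snd.snd.fst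
    have hr := (feasible_id (fun q : (_ : α) × Data × Option Data × List Data => .cons (inp q.1)
      (.cons q.2.1 (.cons (.ofOption id q.2.2.1) (.ofList q.2.2.2))))).snd.snd.snd
    convert ho.condNil ((feasible_nil.cons he).cons hr)
      (feasible_nil.cons ((he.cons ho.tl).cons hr)) using 2 with q
    obtain ⟨a, e, _ | d, r⟩ := q <;> rfl
  have h := FeasibleIn.foldr (β := fun _ => Data) (encβ := fun _ d => d) (l := l)
    (σ := fun _ => Option Data × List Data)
    (encσ := fun _ s => .cons (.ofOption id s.1) (.ofList s.2)) (s := fun _ => (none, []))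
    (F := fun _ => pairStep) (by simpa using hl) (feasible_nil.cons feasible_nil) hF
    (hl.size.add (.const 2)) ?_
  · exact h.snd
  · intro a t ht
    have h₁ := foldr_pairStep_size t
    have h₂ := Data.size_ofList_le_of_suffix ht
    rw [Data.size_cons]
    unfold UnreliableSynthesis.pairUp at h₁
    omega

theorem feasible_ofTable {k : α → ℕ} {f : ∀ a, Val (Fin (k a)) → Data}
    (hk : Feasible inp fun a => .ofNat (k a))
    (hp : PolyLE (fun a => 2 ^ k a) fun a => (inp a).size)
    (hf : Feasible (fun q : (a : α) × Val (Fin (k a)) => .cons (inp q.1) (.ofVal q.2))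
      fun q => f q.1 q.2) :
    Feasible inp fun a => .ofTable (k a) (f a) := by
  have h₁ := FeasibleIn.map (β := fun a => Val (Fin (k a))) (enc := fun _ => Data.ofVal)
    (feasible_vals hk hp) hf
  have h := FeasibleIn.iterate (σ := fun _ => List Data) (enc := fun _ => Data.ofList)
    (F := fun _ => pairUp) hk h₁ (feasible_id _).snd.pairUp h₁.size ?_
  · simp only [iterate_pairUp_vals] at h
    exact h.fst
  · intro a i _
    induction i with
    | zero => exact le_rfl
    | succ i ih =>
      rw [Function.iterate_succ_apply']
      refine le_trans ?_ (ih (by omega))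
      -- A round does not enlarge the list, since the encoding of the waiting element takes at least
      -- one bit.
      have h₁ := foldr_pairStep_size (pairUp^[i] ((vals (k a)).map (f a)))
      have := Data.size_pos (.ofOption id
        (List.foldr pairStep (none, []) (pairUp^[i] ((vals (k a)).map (f a)))).1)
      omega

/-- A sequence indexed by numbers is written by running through the valuations in the matching
order. Entries are computed from the valuation itself, so a number never has to be decoded. -/
theorem feasible_ofFn_two_pow {k : α → ℕ} {f : ∀ a, Fin (2 ^ k a) → Data}
    (hk : Feasible inp fun a => .ofNat (k a))
    (hp : PolyLE (fun a => 2 ^ k a) fun a => (inp a).size)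
    (hf : Feasible (fun q : (a : α) × Val (Fin (k a)) => .cons (inp q.1) (.ofVal q.2))
      fun q => f q.1 (valEquiv _ q.2)) :
    Feasible inp fun a => .ofFn (f a) := by
  have h := FeasibleIn.map (β := fun a => Val (Fin (k a))) (enc := fun _ => Data.ofVal)
    (feasible_vals hk hp) (g := fun a v => f a (valEquiv _ v)) hf
  convert h using 3 with a
  rw [Data.ofFn, List.ofFn_eq_map, ← map_valEquiv_vals, List.map_map]
  rfl

/-- Follow a path in a table, starting with the last bit. -/
theorem ofTable_eq_foldr : ∀ (k : ℕ) (f : Val (Fin k) → Data) (v : Val (Fin k)),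
    ((List.ofFn fun i => Data.ofBool (v i)).reverse).foldr
      (fun b d => bif b.isNil then d.hd else d.tl) (.ofTable k f) = f v := by
  intro k
  induction k with
  | zero => exact fun f v => congrArg f (funext fun i => i.elim0)
  | succ k ih =>
    intro f v
    rw [List.foldr_reverse, List.ofFn_succ, List.foldl_cons, ← List.foldr_reverse]
    have h : (bif (Data.ofBool (v 0)).isNil then (Data.ofTable (k + 1) f).hd
        else (Data.ofTable (k + 1) f).tl) = .ofTable k fun w => f (Fin.cons (v 0) w) := by
      cases v 0 <;> rfl
    rw [h]
    have := ih (fun w => f (Fin.cons (v 0) w)) (Fin.tail v)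
    rw [Fin.cons_self_tail] at this
    exact this

/-- The accumulator is always a subtree of the table or empty, so the size of the table bounds it.
-/
theorem FeasibleIn.tableApply {k : α → ℕ} {f : ∀ a, Val (Fin (k a)) → Data}
    {v : ∀ a, Val (Fin (k a))} (hf : Feasible inp fun a => .ofTable (k a) (f a))
    (hv : Feasible inp fun a => .ofVal (v a)) : Feasible inp fun a => f a (v a) := by
  have h := FeasibleIn.foldr (β := fun _ => Data) (encβ := fun _ d => d)
    (l := fun a => (List.ofFn fun i => Data.ofBool (v a i)).reverse)
    (σ := fun _ => Data) (encσ := fun _ d => d) (s := fun a => .ofTable (k a) (f a))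
    (F := fun _ b d => bif b.isNil then d.hd else d.tl)
    (by simp only [List.map_id']; exact FeasibleIn.reverse hv) hf
    ((feasible_id _).snd.fst.condNil (feasible_id _).snd.snd.hd (feasible_id _).snd.snd.tl)
    hf.size ?_
  · simpa only [ofTable_eq_foldr] using h
  · intro a t _
    induction t with
    | nil => exact le_rfl
    | cons b t ih =>
      rw [List.foldr_cons]
      have ih := ih ((List.suffix_cons b t).trans ‹_›)
      cases b.isNil
      · exact (Data.size_tl_le _).trans ih
      · exact (Data.size_hd_le _).trans ih

theorem FeasibleIn.valApply {k : α → ℕ} {v : ∀ a, Val (Fin (k a))} {i : ∀ a, Fin (k a)}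
    (hv : Feasible inp fun a => .ofVal (v a)) (hi : Feasible inp fun a => .ofNat (i a).1) :
    Feasible inp fun a => .ofBool (v a (i a)) :=
  FeasibleIn.apply (f := fun a i => .ofBool (v a i)) hv hi

/-- The second component is the weight of the variable that comes next; the last variable has weight
1. -/
theorem valIdx_eq_foldr {k : ℕ} (v : Val (Fin k)) :
    (List.ofFn v).foldr (fun b p => ((bif b then p.2 else 0) + p.1, p.2 + p.2)) (0, 1) =
      (valIdx v, 2 ^ k) := by
  induction k with
  | zero => rfl
  | succ k ih =>
    have := ih (Fin.tail v)
    rw [List.ofFn_succ, List.foldr_cons]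
    change _ = _ at this
    unfold Fin.tail at this
    rw [this, valIdx, pow_succ, Nat.mul_two]
    rfl

theorem FeasibleIn.valIdx {k : α → ℕ} {v : ∀ a, Val (Fin (k a))}
    (hv : Feasible inp fun a => .ofVal (v a))
    (hp : PolyLE (fun a => 2 ^ k a) fun a => (inp a).size) :
    Feasible inp fun a => .ofNat (valIdx (v a)) := by
  have h := FeasibleIn.foldr (β := fun _ => Bool) (encβ := fun _ => Data.ofBool)
    (l := fun a => List.ofFn (v a))
    (σ := fun _ => ℕ × ℕ) (encσ := fun _ p => .cons (.ofNat p.1) (.ofNat p.2))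
    (s := fun _ => (0, 1)) (F := fun _ b p => ((bif b then p.2 else 0) + p.1, p.2 + p.2))
    (by simp only [List.map_ofFn]; exact hv) (feasible_const (.cons (.ofNat 0) (.ofNat 1)))
    (FeasibleIn.cons (FeasibleIn.add (by
      convert (feasible_id _).snd.fst.cond (feasible_id _).snd.snd.snd (feasible_const (.ofNat 0))
        using 2 with q
      obtain ⟨a, b, p⟩ := q
      cases b <;> rfl) (feasible_id _).snd.snd.fst)
      ((feasible_id _).snd.snd.snd.add (feasible_id _).snd.snd.snd))
    (((PolyLE.const 4).mul hp).add (.const 3)) ?_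
  · simp only [valIdx_eq_foldr] at h
    exact h.fst
  · intro a t ht
    have key (t : List Bool) :
        (t.foldr (fun b p => ((bif b then p.2 else 0) + p.1, p.2 + p.2)) (0, 1)).1 <
          2 ^ t.length ∧
        (t.foldr (fun b p => ((bif b then p.2 else 0) + p.1, p.2 + p.2)) (0, 1)).2 =
          2 ^ t.length := by
      induction t with
      | nil => simp
      | cons b t ih =>
        rw [List.foldr_cons, List.length_cons, pow_succ]
        refine ⟨?_, by dsimp only; omega⟩
        cases b <;> dsimp only [cond_true, cond_false] <;> omega
    have h₁ := key t
    have h₂ : 2 ^ t.length ≤ 2 ^ k a :=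
      Nat.pow_le_pow_right (by omega) (by simpa using ht.length_le)
    simp only [Data.size_cons, Data.size_ofNat]
    omega

end Valuations

end UnreliableSynthesis

namespace UnreliableSynthesis

/-! ### Runs of automata on plays -/

section Play

variable {X Y S : Type}

theorem play_succ (σ : Strategy X Y) (w : ℕ → Val X) (k : ℕ) :
    play σ w (k + 1) =
      play σ w k ++ [Sum.elim (w (k + 1)) (σ ((List.range (k + 1)).map w))] := by
  rw [play, List.range_succ, List.map_append]
  rfl

theorem play_zero (σ : Strategy X Y) (w : ℕ → Val X) : play σ w 0 = [Sum.elim (w 0) (σ [])] := rfl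

theorem play_ne_nil (σ : Strategy X Y) (w : ℕ → Val X) (k : ℕ) : play σ w k ≠ [] := by
  simp [play]

/-- If the states `st` follow the moves of a play, then they are the states of the run on it. -/
theorem eval_play (M : DFA (Val (X ⊕ Y)) S) (σ : Strategy X Y) (w : ℕ → Val X) (st : ℕ → S)
    (h₀ : st 0 = M.start)
    (h : ∀ i, st (i + 1) = M.step (st i) (Sum.elim (w i) (σ ((List.range i).map w)))) (k : ℕ) :
    M.eval (play σ w k) = st (k + 1) := by
  induction k with
  | zero =>
    rw [play_zero, DFA.eval_singleton, h, h₀]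
    rfl
  | succ k ih => rw [play_succ, DFA.eval_append_singleton, ih, h (k + 1)]

end Play

/-! ### The synchronous product -/

/-- The synchronous product of explicitly given automata. -/
def ExplicitDFA.prod {nX nY : ℕ} (A B : ExplicitDFA nX nY) : ExplicitDFA nX nY where
  n := A.n * B.n
  start := finProdFinEquiv (A.start, B.start)
  step s x y := finProdFinEquiv (A.step (finProdFinEquiv.symm s).1 x y,
    B.step (finProdFinEquiv.symm s).2 x y)
  accept s := A.accept (finProdFinEquiv.symm s).1 && B.accept (finProdFinEquiv.symm s).2

theorem ExplicitDFA.prod_presents {nX nY : ℕ} (A B : ExplicitDFA nX nY) :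
    (A.prod B).Presents (A.toDFA.inter B.toDFA) := by
  refine ⟨finProdFinEquiv.symm, ?_, fun s a => ?_, fun s => ?_⟩
  · exact Equiv.symm_apply_apply _ _
  · exact Equiv.symm_apply_apply _ _
  · exact Bool.and_eq_true_iff

/-! ### The belief-state automaton -/

/-- Do the valuations agree on all inputs that are not marked by `u`? -/
def agreeOff {k : ℕ} (u x x' : Val (Fin k)) : Bool :=
  (List.finRange k).all fun i => u i || (x i == x' i)

theorem agreeOff_iff {k : ℕ} (u x x' : Val (Fin k)) :
    agreeOff u x x' = true ↔ ∀ i, i ∉ markedSet u → x i = x' i := by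
  simp only [agreeOff, List.all_eq_true, List.mem_finRange, true_implies, Bool.or_eq_true,
    beq_iff_eq, markedSet, Set.mem_ofPred_eq]
  exact forall_congr' fun i => by rw [or_iff_not_imp_left]

/-- The set of successors of a set of states. -/
def ExplicitDFA.beliefStep {nX nY : ℕ} (u : Val (Fin nX)) (A : ExplicitDFA nX nY)
    (B : Val (Fin A.n)) (x : Val (Fin nX)) (y : Val (Fin nY)) : Val (Fin A.n) :=
  fun s' => (List.finRange A.n).any fun s => B s &&
    (vals nX).any fun x' => agreeOff u x x' && decide ((A.step s x' y).1 = s'.1)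

/-- The belief-state automaton of an explicitly given automaton. -/
noncomputable def ExplicitDFA.belief {nX nY : ℕ} (u : Val (Fin nX)) (A : ExplicitDFA nX nY) :
    ExplicitDFA nX nY where
  n := 2 ^ A.n
  start := valEquiv _ fun s => decide (s.1 = A.start.1)
  step B x y := valEquiv _ (A.beliefStep u ((valEquiv _).symm B) x y)
  accept B := (List.finRange A.n).all fun s => !((valEquiv _).symm B s) || A.accept s

/-- Valuations are sets. -/
noncomputable def valSetEquiv (X : Type) : Val X ≃ Set X where
  toFun v := {i | v i = true}
  invFun B := by classical exact fun i => decide (i ∈ B)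
  left_inv v := by simp
  right_inv B := by simp

theorem ExplicitDFA.belief_presents {nX nY : ℕ} (u : Val (Fin nX)) (A : ExplicitDFA nX nY) :
    (A.belief u).Presents (beliefDFA (markedSet u) A.toDFA) := by
  refine ⟨(valEquiv A.n).symm.trans (valSetEquiv _), ?_, fun B a => ?_, fun B => ?_⟩
  · ext s
    change (valEquiv A.n).symm (valEquiv A.n fun s => decide (s.1 = A.start.1)) s = true ↔
      s = A.start
    rw [Equiv.symm_apply_apply, decide_eq_true_eq, Fin.ext_iff]
  · ext s'
    change (valEquiv A.n).symm (valEquiv A.n (A.beliefStep u ((valEquiv A.n).symm B)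
      (fun i => a (Sum.inl i)) fun j => a (Sum.inr j))) s' = true ↔
      ∃ s, (valEquiv A.n).symm B s = true ∧ ∃ x', (∀ i, i ∉ markedSet u → a (Sum.inl i) = x' i) ∧
        A.step s x' (fun j => a (Sum.inr j)) = s'
    rw [Equiv.symm_apply_apply]
    simp only [beliefStep, List.any_eq_true, Bool.and_eq_true, agreeOff_iff, decide_eq_true_eq,
      List.mem_finRange, true_and, mem_vals, Fin.ext_iff]
  · change ((List.finRange A.n).all fun s => !((valEquiv A.n).symm B s) || A.accept s) = true ↔
      ∀ s, (valEquiv A.n).symm B s = true → A.accept s = true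
    simp only [List.all_eq_true, List.mem_finRange, true_implies, Bool.or_eq_true,
      Bool.not_eq_true']
    refine forall_congr' fun i => ?_
    cases (valEquiv A.n).symm B i <;> simp

/-! ### Solving games -/

section Solve

variable {nX nY : ℕ} (A : ExplicitDFA nX nY)

/-- One round of the attractor computation: states from which the agent can force a final state
or a state with a known move obtain a move. -/
def ExplicitDFA.winStep (W : Fin A.n → Option (Val (Fin nY))) (s : Fin A.n) :
    Option (Val (Fin nY)) :=
  bif (W s).isSome then W s else (vals nY).find? fun y => (vals nX).all fun x =>
    A.accept (A.step s x y) || (W (A.step s x y)).isSome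

/-- The moves in the winning region. -/
def ExplicitDFA.moves : Fin A.n → Option (Val (Fin nY)) := A.winStep^[A.n] fun _ => none

/-- The transducer that plays the moves of the winning region. -/
def ExplicitDFA.winner : Transducer nX nY where
  n := A.n
  start := A.start
  step s x := A.step s x ((A.moves s).getD fun _ => false)
  out s := (A.moves s).getD fun _ => false

/-- Solve a game. -/
def ExplicitDFA.solve : Option (Transducer nX nY) :=
  bif (A.moves A.start).isSome then some A.winner else none

/-- As long as the iteration moves, the measure increases in every step; with values in `0, …, n`
this happens at most `n` times. -/
theorem iterate_fixed {β : Type} {f : β → β} {μ : β → ℕ} (h : ∀ b, f b ≠ b → μ b < μ (f b))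
    {n : ℕ} (hn : ∀ b, μ b ≤ n) (b : β) : f (f^[n] b) = f^[n] b := by
  have key (i : ℕ) : f (f^[i] b) = f^[i] b ∨ i < μ (f (f^[i] b)) := by
    induction i with
    | zero => exact or_iff_not_imp_left.2 fun h' => (Nat.zero_le _).trans_lt (h _ h')
    | succ i ih =>
      rw [Function.iterate_succ_apply']
      rcases ih with ih | ih
      · exact .inl (congrArg f ih)
      · exact or_iff_not_imp_left.2 fun h' => Nat.lt_of_le_of_lt ih (h _ h')
  exact (key n).resolve_right (hn _).not_gt

theorem ExplicitDFA.winStep_of_some {W : Fin A.n → Option (Val (Fin nY))} {s : Fin A.n}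
    {y : Val (Fin nY)} (h : W s = some y) : A.winStep W s = some y := by
  simp [winStep, h]

/-- The measure is the number of states with a move. A round never removes or changes a move, so a
round without gain changes nothing. -/
theorem ExplicitDFA.winStep_moves : A.winStep A.moves = A.moves := by
  refine iterate_fixed (μ := fun W => (Finset.univ.filter fun s => (W s).isSome = true).card)
    (n := A.n) (fun W hW => ?_) (fun W => ?_) _
  · refine Finset.card_lt_card (Finset.ssubset_iff_subset_ne.2 ⟨fun s hs => ?_, fun h => hW ?_⟩)
    · simp only [Finset.mem_filter, Finset.mem_univ, true_and] at hs ⊢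
      obtain ⟨y, hy⟩ := Option.isSome_iff_exists.1 hs
      rw [A.winStep_of_some hy]
      rfl
    · funext s
      rcases hs : W s with _ | y
      · have : s ∉ Finset.univ.filter fun s => (A.winStep W s).isSome = true := by
          rw [← h]
          simp [hs]
        simpa using this
      · exact A.winStep_of_some hs
  · exact (Finset.card_le_univ _).trans (Fintype.card_fin _).le

/-- The first move found for a state is kept. This matters: a move recomputed later might only lead
around inside the winning region, while the first one leads to a final state or to a state of
smaller rank. -/
theorem ExplicitDFA.moves_eq_of_iterate {s : Fin A.n} {y : Val (Fin nY)} {i : ℕ} (hi : i ≤ A.n)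
    (h : A.winStep^[i] (fun _ => none) s = some y) : A.moves s = some y := by
  obtain ⟨j, hj⟩ := Nat.exists_eq_add_of_le' hi
  have key (j : ℕ) : A.winStep^[j + i] (fun _ => none) s = some y := by
    induction j with
    | zero => rwa [Nat.zero_add]
    | succ j ih =>
      rw [Nat.succ_add, Function.iterate_succ_apply']
      exact A.winStep_of_some ih
  have h₁ := key j
  rwa [← hj] at h₁

/-- The rank of a state is the round in which it obtains its move. Along the play the rank drops
until a final state is entered. Finality is tested on successors only, since a win takes at least
one round. -/
theorem ExplicitDFA.winner_wins (h : (A.moves A.start).isSome = true) :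
    WinsGame A.toDFA A.winner.strategy := by
  intro w
  let st (i : ℕ) : Fin A.n := ((List.range i).map w).foldl A.winner.step A.start
  have st_succ (i : ℕ) :
      st (i + 1) = A.step (st i) (w i) ((A.moves (st i)).getD fun _ => false) := by
    change ((List.range (i + 1)).map w).foldl A.winner.step A.winner.start = _
    rw [List.range_succ, List.map_append]
    exact List.foldl_append
  have key : ∀ r ≤ A.n, ∀ i, (A.winStep^[r] (fun _ => none) (st i)).isSome = true →
      ∃ k, A.accept (st (k + 1)) = true := by
    intro r
    induction r with
    | zero => exact fun _ i h => by simp at h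
    | succ r ih =>
      intro hr i h
      rcases hs : A.winStep^[r] (fun _ => none) (st i) with _ | y
      · obtain ⟨y, hy⟩ := Option.isSome_iff_exists.1 h
        -- The transducer plays the move of the last round, which is the one found in this round.
        have hm := A.moves_eq_of_iterate hr hy
        rw [Function.iterate_succ_apply', winStep, hs] at hy
        have hy' := List.find?_some hy
        have hx := List.all_eq_true.1 hy' (w i) (mem_vals _)
        have hst := st_succ i
        rw [hm, Option.getD_some] at hst
        rw [← hst, Bool.or_eq_true] at hx
        rcases hx with hx | hx
        · exact ⟨i, hx⟩
        · exact ih (Nat.le_of_succ_le hr) _ hx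
      · exact ih (Nat.le_of_succ_le hr) i (by rw [hs]; rfl)
  obtain ⟨k, hk⟩ := key A.n le_rfl 0 h
  refine ⟨k, ?_⟩
  rw [DFA.mem_accepts]
  rw [eval_play A.toDFA A.winner.strategy w st rfl st_succ k]
  exact hk

/-- Since the region is a fixed point, at a state without a move each output has an input that leads
to a nonfinal state without a move. Answering with such inputs defeats every strategy, in particular
those with infinite memory. -/
theorem ExplicitDFA.not_wins (h : A.moves A.start = none) (σ : Strategy (Fin nX) (Fin nY)) :
    ¬ WinsGame A.toDFA σ := by
  have hx (s : Fin A.n) (hs : A.moves s = none) (y : Val (Fin nY)) : ∃ x,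
      A.accept (A.step s x y) = false ∧ A.moves (A.step s x y) = none := by
    have h₁ := congrFun A.winStep_moves s
    rw [winStep, hs, Option.isSome_none, cond_false, List.find?_eq_none] at h₁
    have h₂ := h₁ y (mem_vals y)
    simpa [mem_vals] using h₂
  have : ∃ f : Fin A.n → Val (Fin nY) → Val (Fin nX), ∀ s, A.moves s = none → ∀ y,
      A.accept (A.step s (f s y) y) = false ∧ A.moves (A.step s (f s y) y) = none := by
    classical
    refine ⟨fun s y => if hs : A.moves s = none then (hx s hs y).choose else fun _ => false,
      fun s hs y => ?_⟩
    simp only [dif_pos hs]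
    exact (hx s hs y).choose_spec
  obtain ⟨f, hf⟩ := this
  -- The next input depends on the output, which depends on the history. So history and state are
  -- built by one recursion, and the input sequence is read off afterwards.
  let hist : ℕ → List (Val (Fin nX)) × Fin A.n := fun i => Nat.rec ([], A.start)
    (fun _ p => (p.1 ++ [f p.2 (σ p.1)], A.step p.2 (f p.2 (σ p.1)) (σ p.1))) i
  let w (i : ℕ) : Val (Fin nX) := f (hist i).2 (σ (hist i).1)
  have hw (i : ℕ) : (List.range i).map w = (hist i).1 := by
    induction i with
    | zero => rfl
    | succ i ih => rw [List.range_succ, List.map_append, ih]; rfl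
  have hn (i : ℕ) : A.moves (hist i).2 = none := by
    induction i with
    | zero => exact h
    | succ i ih => exact (hf _ ih _).2
  intro hσ
  obtain ⟨k, hk⟩ := hσ w
  rw [DFA.mem_accepts] at hk
  rw [eval_play A.toDFA σ w (fun i => (hist i).2) rfl (fun i => by rw [hw]; rfl) k] at hk
  have := (hf _ (hn k) (σ (hist k).1)).1
  change A.accept _ = true at hk
  rw [this] at hk
  exact Bool.noConfusion hk

theorem ExplicitDFA.solve_correct : CorrectAnswer (WinsGame A.toDFA) A.solve := by
  unfold solve
  rcases h : A.moves A.start with _ | y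
  · exact fun ⟨σ, hσ⟩ => A.not_wins h σ hσ
  · exact A.winner_wins (by rw [h]; rfl)

end Solve

/-! ### The technique solves synthesis under unreliable input -/

theorem DFA.mem_accepts_inter {α S₁ S₂ : Type} (M : DFA α S₁) (N : DFA α S₂) (t : List α) :
    t ∈ (M.inter N).accepts ↔ t ∈ M.accepts ∧ t ∈ N.accepts := by
  rw [DFA.accepts_inter]
  rfl

theorem ExplicitDFA.Presents.mem_accepts {nX nY : ℕ} {S : Type} {A : ExplicitDFA nX nY}
    {M : DFA (Val (Fin nX ⊕ Fin nY)) S} (h : A.Presents M) (t : List (Val (Fin nX ⊕ Fin nY))) :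
    t ∈ A.toDFA.accepts ↔ t ∈ M.accepts := by
  obtain ⟨e, h₀, h₁, h₂⟩ := h
  have key (t : List (Val (Fin nX ⊕ Fin nY))) : e (A.toDFA.eval t) = M.eval t := by
    induction t using List.reverseRecOn with
    | nil => exact h₀
    | append_singleton t a ih =>
      rw [DFA.eval_append_singleton, DFA.eval_append_singleton, h₁, ih]
  rw [DFA.mem_accepts, DFA.mem_accepts, h₂, key]

/-! ### Belief states as sets of reachable states -/

section Belief

theorem simOff_append_singleton {P : Type} (V : Set P) (t' t : List (Val P)) (a : Val P) :
    SimOff V t' (t ++ [a]) ↔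
      ∃ t₀ a', t' = t₀ ++ [a'] ∧ SimOff V t₀ t ∧ ∀ p, p ∉ V → a' p = a p := by
  change proj V t' = proj V (t ++ [a]) ↔ ∃ t₀ a', t' = t₀ ++ [a'] ∧ proj V t₀ = proj V t ∧ _
  simp only [proj, List.map_append, List.map_eq_append_iff, List.map_cons, List.map_nil]
  constructor
  · rintro ⟨t₀, t₁, rfl, h₀, h₁⟩
    obtain ⟨a', l, rfl, ha, hl⟩ := List.map_eq_cons_iff.1 h₁
    rw [List.map_eq_nil_iff] at hl
    subst hl
    exact ⟨t₀, a', rfl, h₀, fun p hp => congrFun ha ⟨p, hp⟩⟩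
  · rintro ⟨t₀, a', rfl, h₀, h₁⟩
    exact ⟨t₀, [a'], rfl, h₀, by
      simpa using funext fun p : {p // p ∉ V} => h₁ p.1 p.2⟩

theorem simOff_nil {P : Type} (V : Set P) (t' : List (Val P)) : SimOff V t' [] ↔ t' = [] :=
  List.map_eq_nil_iff

variable {X Y S : Type} (U : Set X)

/-- A trace similar to `t ++ [a]` is one similar to `t`, followed by a letter that differs from `a`
in unreliable inputs only; this is the choice made by a belief transition. Outputs are never
unreliable, so such a letter is determined by its inputs. -/
theorem mem_eval_beliefDFA (M : DFA (Val (X ⊕ Y)) S) (t : List (Val (X ⊕ Y))) : ∀ s : S,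
    s ∈ (beliefDFA U M).eval t ↔ ∃ t', SimOff (Sum.inl '' U) t' t ∧ M.eval t' = s := by
  induction t using List.reverseRecOn with
  | nil =>
    intro s
    simp only [simOff_nil, exists_eq_left]
    exact eq_comm
  | append_singleton t a ih =>
    intro s
    rw [DFA.eval_append_singleton]
    change (∃ s₀ ∈ (beliefDFA U M).eval t, ∃ x' : Val X, (∀ i, i ∉ U → a (Sum.inl i) = x' i) ∧
      M.step s₀ (Sum.elim x' fun j => a (Sum.inr j)) = s) ↔ _
    simp only [simOff_append_singleton, ih]
    constructor
    · rintro ⟨_, ⟨t', ht', rfl⟩, x', hx', rfl⟩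
      refine ⟨t' ++ [Sum.elim x' fun j => a (Sum.inr j)], ⟨t', _, rfl, ht', ?_⟩,
        DFA.eval_append_singleton _ _ _⟩
      rintro (i | j) hp
      · exact (hx' i fun hi => hp ⟨i, hi, rfl⟩).symm
      · rfl
    · rintro ⟨_, ⟨t', a', rfl, ht', ha'⟩, rfl⟩
      refine ⟨_, ⟨t', ht', rfl⟩, fun i => a' (Sum.inl i), fun i hi => (ha' _ ?_).symm, ?_⟩
      · rintro ⟨j, hj, h⟩
        exact hi (Sum.inl_injective h ▸ hj)
      · rw [DFA.eval_append_singleton]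
        congr 1
        funext p
        rcases p with i | j
        · rfl
        · exact (ha' (Sum.inr j) (by simp)).symm

theorem mem_accepts_beliefDFA (M : DFA (Val (X ⊕ Y)) S) (t : List (Val (X ⊕ Y))) :
    t ∈ (beliefDFA U M).accepts ↔ ∀ t', SimOff (Sum.inl '' U) t' t → t' ∈ M.accepts := by
  change (∀ s, s ∈ (beliefDFA U M).eval t → s ∈ M.accept) ↔ _
  simp only [mem_eval_beliefDFA]
  exact ⟨fun h t' ht' => h _ ⟨t', ht', rfl⟩, fun h s ⟨t', ht', hs⟩ => hs ▸ h t' ht'⟩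

end Belief

/-- The equivalence holds for the same input sequence and the same `k` on both sides, so no strategy
has to be transformed. The automata reject the empty word, which is harmless: plays are nonempty,
and similar traces have the same length. -/
theorem solvesUnreliable_iff_winsGame {nX nY : ℕ} {u : Val (Fin nX)}
    {φm φb : LTLf (Fin nX ⊕ Fin nY)} {Am Ab R G : ExplicitDFA nX nY}
    (hm : RecognizesFormula Am.toDFA φm) (hb : RecognizesFormula Ab.toDFA φb)
    (hR : R.Presents (beliefDFA (markedSet u) Ab.toDFA))
    (hG : G.Presents (Am.toDFA.inter R.toDFA)) (σ : Strategy (Fin nX) (Fin nY)) :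
    SolvesUnreliable (markedSet u) φm φb σ ↔ WinsGame G.toDFA σ := by
  refine forall_congr' fun w => exists_congr fun k => ?_
  rw [hG.mem_accepts, DFA.mem_accepts_inter, hR.mem_accepts, mem_accepts_beliefDFA, hm]
  refine and_congr (by simp [play_ne_nil]) (forall₂_congr fun t' ht' => ?_)
  rw [hb]
  refine (and_iff_right ?_).symm
  rintro rfl
  exact play_ne_nil σ w k (List.map_eq_nil_iff.1 (Eq.symm ht'))

end UnreliableSynthesis

namespace UnreliableSynthesis

/-! ### Running times of the constructions on automata -/

section Compare

variable {α : Type} {inp : α → Data}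

/-- In unary, `m ≤ n` means that removing `n` elements from a list of length `m` leaves nothing. -/
theorem FeasibleIn.natLe {m n : α → ℕ} (hm : Feasible inp fun a => .ofNat (m a))
    (hn : Feasible inp fun a => .ofNat (n a)) :
    Feasible inp fun a => .ofBool (decide (m a ≤ n a)) := by
  have h : Feasible inp fun a => .ofList (List.replicate (m a) .nil) := by
    simpa only [Data.ofNat_eq] using hm
  convert (h.drop hn).condNil (feasible_const (.ofBool true)) (feasible_const (.ofBool false))
    using 2 with a
  rw [List.drop_replicate]
  by_cases h : m a ≤ n a
  · simp [h, Nat.sub_eq_zero_of_le h, Data.ofList, Data.isNil]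
  · obtain ⟨d, hd⟩ := Nat.exists_eq_succ_of_ne_zero (Nat.sub_ne_zero_of_lt (not_le.1 h))
    simp [h, hd, List.replicate_succ, Data.ofList, Data.isNil]

theorem FeasibleIn.natEq {m n : α → ℕ} (hm : Feasible inp fun a => .ofNat (m a))
    (hn : Feasible inp fun a => .ofNat (n a)) :
    Feasible inp fun a => .ofBool (decide (m a = n a)) := by
  convert (hm.natLe hn).and (hn.natLe hm) using 3 with a
  rw [← Bool.decide_and]
  exact decide_eq_decide.2 le_antisymm_iff

theorem FeasibleIn.boolEq {b c : α → Bool} (hb : Feasible inp fun a => .ofBool (b a))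
    (hc : Feasible inp fun a => .ofBool (c a)) :
    Feasible inp fun a => .ofBool (b a == c a) := by
  convert hb.cond hc hc.not using 2 with a
  cases b a <;> cases c a <;> rfl

theorem feasible_allFin {n : α → ℕ} {p : ∀ a, Fin (n a) → Bool}
    (hn : Feasible inp fun a => .ofNat (n a))
    (hp : Feasible (fun q : (a : α) × Fin (n a) => .cons (inp q.1) (.ofNat q.2.1))
      fun q => .ofBool (p q.1 q.2)) :
    Feasible inp fun a => .ofBool ((List.finRange (n a)).all (p a)) :=
  (feasible_finRange hn).all (β := fun a => Fin (n a)) (enc := fun _ i => .ofNat i.1) hp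

theorem feasible_anyFin {n : α → ℕ} {p : ∀ a, Fin (n a) → Bool}
    (hn : Feasible inp fun a => .ofNat (n a))
    (hp : Feasible (fun q : (a : α) × Fin (n a) => .cons (inp q.1) (.ofNat q.2.1))
      fun q => .ofBool (p q.1 q.2)) :
    Feasible inp fun a => .ofBool ((List.finRange (n a)).any (p a)) :=
  (feasible_finRange hn).any (β := fun a => Fin (n a)) (enc := fun _ i => .ofNat i.1) hp

theorem feasible_ofVal {n : α → ℕ} {v : ∀ a, Val (Fin (n a))}
    (hn : Feasible inp fun a => .ofNat (n a))
    (hv : Feasible (fun q : (a : α) × Fin (n a) => .cons (inp q.1) (.ofNat q.2.1))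
      fun q => .ofBool (v q.1 q.2)) :
    Feasible inp fun a => .ofVal (v a) :=
  feasible_ofFn (f := fun a i => .ofBool (v a i)) hn hv

theorem FeasibleIn.optionIsSome {σ : α → Type} {enc : ∀ a, σ a → Data} {o : ∀ a, Option (σ a)}
    (h : Feasible inp fun a => .ofOption (enc a) (o a)) :
    Feasible inp fun a => .ofBool (o a).isSome := by
  convert h.condNil (feasible_const (.ofBool false)) (feasible_const (.ofBool true)) using 2 with a
  cases o a <;> rfl

theorem FeasibleIn.optionGetD {σ : α → Type} {enc : ∀ a, σ a → Data} {o : ∀ a, Option (σ a)}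
    {d : ∀ a, σ a} (h : Feasible inp fun a => .ofOption (enc a) (o a))
    (hd : Feasible inp fun a => enc a (d a)) :
    Feasible inp fun a => enc a ((o a).getD (d a)) := by
  convert h.condNil hd h.tl using 2 with a
  cases o a <;> rfl

theorem feasible_ofFn_mul {m n : α → ℕ} {f : ∀ a, Fin (m a * n a) → Data}
    (hm : Feasible inp fun a => .ofNat (m a)) (hn : Feasible inp fun a => .ofNat (n a))
    (hf : Feasible (fun q : (p : (a : α) × Fin (m a)) × Fin (n p.1) =>
      .cons (.cons (inp q.1.1) (.ofNat q.1.2.1)) (.ofNat q.2.1))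
      fun q => f q.1.1 (finProdFinEquiv (q.1.2, q.2))) :
    Feasible inp fun a => .ofFn (f a) := by
  have h₁ : Feasible (fun q : (a : α) × Fin (m a) => .cons (inp q.1) (.ofNat q.2.1))
      fun q => .ofFn fun j => f q.1 (finProdFinEquiv (q.2, j)) :=
    feasible_ofFn (n := fun q : (a : α) × Fin (m a) => n q.1) hn.weaken hf
  have h₂ := FeasibleIn.flatten (ll := fun a => List.ofFn fun i : Fin (m a) =>
    List.ofFn fun j => f a (finProdFinEquiv (i, j))) (by
      simp only [List.map_ofFn]
      exact feasible_ofFn hm h₁)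
  convert h₂ using 2 with a
  rw [Data.ofFn, List.ofFn_mul]
  congr 4
  funext i
  congr 1
  funext j
  congr 1
  exact Fin.ext (by simp [Nat.add_comm, Nat.mul_comm])

end Compare

/-! #### Reading and writing automata -/

theorem Data.size_le_size_ofTable : ∀ {k : ℕ} (f : Val (Fin k) → Data) (v : Val (Fin k)),
    (f v).size ≤ (Data.ofTable k f).size := by
  intro k
  induction k with
  | zero => exact fun f v => (congrArg (fun v => (f v).size) (funext fun i => i.elim0)).le
  | succ k ih =>
    intro f v
    have h := ih (fun w => f (Fin.cons (v 0) w)) (Fin.tail v)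
    rw [Fin.cons_self_tail] at h
    rw [Data.ofTable, Data.size_cons]
    cases h₀ : v 0 <;> rw [h₀] at h <;> omega

theorem Data.two_pow_le_size_ofTable : ∀ (k : ℕ) (f : Val (Fin k) → Data),
    2 ^ k ≤ (Data.ofTable k f).size := by
  intro k
  induction k with
  | zero => exact fun f => Data.size_pos _
  | succ k ih =>
    intro f
    have h₁ := ih fun v => f (Fin.cons false v)
    have h₂ := ih fun v => f (Fin.cons true v)
    rw [Data.ofTable, Data.size_cons, pow_succ]
    omega

section Automata

variable {α : Type} {inp : α → Data} {nX nY : α → ℕ} {A : ∀ a, ExplicitDFA (nX a) (nY a)}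

theorem FeasibleIn.dfaX (h : Feasible inp fun a => (A a).data) :
    Feasible inp fun a => .ofNat (nX a) := h.fst

theorem FeasibleIn.dfaY (h : Feasible inp fun a => (A a).data) :
    Feasible inp fun a => .ofNat (nY a) := h.snd.fst

theorem FeasibleIn.dfaN (h : Feasible inp fun a => (A a).data) :
    Feasible inp fun a => .ofNat (A a).n := h.snd.snd.fst

theorem FeasibleIn.dfaStart (h : Feasible inp fun a => (A a).data) :
    Feasible inp fun a => .ofNat (A a).start.1 := h.snd.snd.snd.fst

theorem FeasibleIn.dfaRow (h : Feasible inp fun a => (A a).data) {s : ∀ a, Fin (A a).n}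
    (hs : Feasible inp fun a => .ofNat (s a).1) :
    Feasible inp fun a => .ofTable (nX a) fun x => .ofTable (nY a) fun y =>
      .ofNat ((A a).step (s a) x y).1 :=
  FeasibleIn.apply (f := fun a s => .ofTable (nX a) fun x => .ofTable (nY a) fun y =>
    .ofNat ((A a).step s x y).1) h.snd.snd.snd.snd.fst hs

theorem FeasibleIn.dfaStep (h : Feasible inp fun a => (A a).data) {s : ∀ a, Fin (A a).n}
    {x : ∀ a, Val (Fin (nX a))} {y : ∀ a, Val (Fin (nY a))}
    (hs : Feasible inp fun a => .ofNat (s a).1) (hx : Feasible inp fun a => .ofVal (x a))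
    (hy : Feasible inp fun a => .ofVal (y a)) :
    Feasible inp fun a => .ofNat ((A a).step (s a) (x a) (y a)).1 :=
  FeasibleIn.tableApply (f := fun a y => .ofNat ((A a).step (s a) (x a) y).1)
    (FeasibleIn.tableApply (f := fun a x => .ofTable (nY a) fun y =>
      .ofNat ((A a).step (s a) x y).1) (h.dfaRow hs) hx) hy

theorem FeasibleIn.dfaAccept (h : Feasible inp fun a => (A a).data) {s : ∀ a, Fin (A a).n}
    (hs : Feasible inp fun a => .ofNat (s a).1) :
    Feasible inp fun a => .ofBool ((A a).accept (s a)) :=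
  FeasibleIn.apply (f := fun a s => .ofBool ((A a).accept s)) h.snd.snd.snd.snd.snd.fst hs

/-- The table is written out for every state, and the start state shows that there is one; its row
has `2 ^ nX` entries. Hence running through all valuations is polynomial in the size of an explicit
automaton. -/
theorem FeasibleIn.polyLE_dfaX (h : Feasible inp fun a => (A a).data) :
    PolyLE (fun a => 2 ^ nX a) fun a => (inp a).size :=
  (h.dfaRow h.dfaStart).size.mono fun _ => Data.two_pow_le_size_ofTable _ _

theorem FeasibleIn.polyLE_dfaY (h : Feasible inp fun a => (A a).data) :
    PolyLE (fun a => 2 ^ nY a) fun a => (inp a).size :=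
  (h.dfaRow h.dfaStart).size.mono fun a => (Data.two_pow_le_size_ofTable _ _).trans
    (Data.size_le_size_ofTable (fun x => .ofTable (nY a) fun y =>
      .ofNat ((A a).step (A a).start x y).1) fun _ => false)

/-- A transition table is feasible if single transitions are. -/
theorem feasible_stepTable {m : ∀ a, Val (Fin (nX a)) → Val (Fin (nY a)) → ℕ}
    (hX : Feasible inp fun a => .ofNat (nX a)) (hY : Feasible inp fun a => .ofNat (nY a))
    (pX : PolyLE (fun a => 2 ^ nX a) fun a => (inp a).size)
    (pY : PolyLE (fun a => 2 ^ nY a) fun a => (inp a).size)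
    (h : Feasible (fun q : (p : (a : α) × Val (Fin (nX a))) × Val (Fin (nY p.1)) =>
      .cons (.cons (inp q.1.1) (.ofVal q.1.2)) (.ofVal q.2))
      fun q => .ofNat (m q.1.1 q.1.2 q.2)) :
    Feasible inp fun a => .ofTable (nX a) fun x => .ofTable (nY a) fun y => .ofNat (m a x y) :=
  feasible_ofTable hX pX (feasible_ofTable (k := fun q : (a : α) × Val (Fin (nX a)) => nY q.1)
    (f := fun q y => .ofNat (m q.1 q.2 y)) hY.weaken
    ((pY.comp Sigma.fst).trans (.of_le fun q => by simp only [Data.size_cons]; omega)) h)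

end Automata

/-! #### The synchronous product -/

theorem feasible_prod {α : Type} {inp : α → Data} {nX nY : α → ℕ}
    {A B : ∀ a, ExplicitDFA (nX a) (nY a)} (hA : Feasible inp fun a => (A a).data)
    (hB : Feasible inp fun a => (B a).data) : Feasible inp fun a => ((A a).prod (B a)).data := by
  -- `finProdFinEquiv` numbers pairs row by row: the number of `(i, j)` is `j + n * i`.
  have pair {β : Type} {inp : β → Data} {m n : β → ℕ} {i : ∀ b, Fin (m b)} {j : ∀ b, Fin (n b)}
      (hn : Feasible inp fun b => .ofNat (n b)) (hi : Feasible inp fun b => .ofNat (i b).1)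
      (hj : Feasible inp fun b => .ofNat (j b).1) :
      Feasible inp fun b => .ofNat (finProdFinEquiv (i b, j b)).1 :=
    hj.add (hn.mul hi)
  refine hA.dfaX.cons (hA.dfaY.cons ((hA.dfaN.mul hB.dfaN).cons
    ((pair hB.dfaN hA.dfaStart hB.dfaStart).cons (FeasibleIn.cons ?_ (FeasibleIn.cons ?_
      feasible_nil)))))
  · refine feasible_ofFn_mul hA.dfaN hB.dfaN (feasible_env fun v => ?_)
    have hA' := hA.via v.fst.fst
    refine feasible_stepTable hA'.dfaX hA'.dfaY hA'.polyLE_dfaX hA'.polyLE_dfaY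
      (feasible_env fun v => ?_)
    simp only [ExplicitDFA.prod, Equiv.symm_apply_apply]
    have hA' := hA.via v.fst.fst.fst.fst
    have hB' := hB.via v.fst.fst.fst.fst
    exact pair hB'.dfaN (hA'.dfaStep v.fst.fst.fst.snd v.fst.snd v.snd)
      (hB'.dfaStep v.fst.fst.snd v.fst.snd v.snd)
  · refine feasible_ofFn_mul hA.dfaN hB.dfaN (feasible_env fun v => ?_)
    simp only [ExplicitDFA.prod, Equiv.symm_apply_apply]
    exact ((hA.via v.fst.fst).dfaAccept v.fst.snd).and ((hB.via v.fst.fst).dfaAccept v.snd)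

/-! #### The belief-state automaton -/

theorem feasible_agreeOff {α : Type} {inp : α → Data} {k : α → ℕ} {u x x' : ∀ a, Val (Fin (k a))}
    (hk : Feasible inp fun a => .ofNat (k a)) (hu : Feasible inp fun a => .ofVal (u a))
    (hx : Feasible inp fun a => .ofVal (x a)) (hx' : Feasible inp fun a => .ofVal (x' a)) :
    Feasible inp fun a => .ofBool (agreeOff (u a) (x a) (x' a)) := by
  refine feasible_allFin hk (feasible_env fun v => ?_)
  exact ((hu.via v.fst).valApply v.snd).or
    (((hx.via v.fst).valApply v.snd).boolEq ((hx'.via v.fst).valApply v.snd))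

theorem feasible_beliefStep {α : Type} {inp : α → Data} {nX nY : α → ℕ}
    {A : ∀ a, ExplicitDFA (nX a) (nY a)} {u x : ∀ a, Val (Fin (nX a))}
    {B : ∀ a, Val (Fin (A a).n)} {y : ∀ a, Val (Fin (nY a))}
    (hA : Feasible inp fun a => (A a).data) (hu : Feasible inp fun a => .ofVal (u a))
    (hB : Feasible inp fun a => .ofVal (B a)) (hx : Feasible inp fun a => .ofVal (x a))
    (hy : Feasible inp fun a => .ofVal (y a)) :
    Feasible inp fun a => .ofVal ((A a).beliefStep (u a) (B a) (x a) (y a)) := by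
  refine feasible_ofVal hA.dfaN (feasible_env fun v => ?_)
  refine feasible_anyFin (hA.via v.fst).dfaN (feasible_env fun v => ?_)
  have hA₁ := hA.via v.fst.fst
  refine ((hB.via v.fst.fst).valApply v.snd).and ?_
  refine (feasible_vals hA₁.dfaX hA₁.polyLE_dfaX).any (feasible_env fun v => ?_)
  have hA₂ := hA.via v.fst.fst.fst
  exact (feasible_agreeOff hA₂.dfaX (hu.via v.fst.fst.fst) (hx.via v.fst.fst.fst) v.snd).and
    ((hA₂.dfaStep v.fst.snd v.snd (hy.via v.fst.fst.fst)).natEq v.fst.fst.snd)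

/-- The exponential part is isolated in `hp`. Given the number of belief states in unary, the table
is filled by polynomially many polynomial computations. -/
theorem feasible_belief {α : Type} {inp : α → Data} {nX nY : α → ℕ}
    {A : ∀ a, ExplicitDFA (nX a) (nY a)} {u : ∀ a, Val (Fin (nX a))}
    (hA : Feasible inp fun a => (A a).data) (hu : Feasible inp fun a => .ofVal (u a))
    (hp : Feasible inp fun a => .ofNat (2 ^ (A a).n)) :
    Feasible inp fun a => ((A a).belief (u a)).data := by
  have hn := polyLE_of_feasible_ofNat hp
  refine hA.dfaX.cons (hA.dfaY.cons (hp.cons (FeasibleIn.cons ?_ (FeasibleIn.cons ?_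
    (FeasibleIn.cons ?_ feasible_nil)))))
  · exact (feasible_ofVal hA.dfaN (feasible_env fun v =>
      v.snd.natEq (hA.via v.fst).dfaStart)).valIdx hn
  · refine feasible_ofFn_two_pow hA.dfaN hn (feasible_env fun v => ?_)
    have hA₁ := hA.via v.fst
    refine feasible_stepTable hA₁.dfaX hA₁.dfaY hA₁.polyLE_dfaX hA₁.polyLE_dfaY
      (feasible_env fun v => ?_)
    simp only [ExplicitDFA.belief, Equiv.symm_apply_apply]
    exact (feasible_beliefStep (hA.via v.fst.fst.fst) (hu.via v.fst.fst.fst) v.fst.fst.snd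
      v.fst.snd v.snd).valIdx (polyLE_of_feasible_ofNat (hp.via v.fst.fst.fst))
  · refine feasible_ofFn_two_pow hA.dfaN hn (feasible_env fun v => ?_)
    simp only [ExplicitDFA.belief, Equiv.symm_apply_apply]
    refine feasible_allFin (hA.via v.fst).dfaN (feasible_env fun v => ?_)
    exact (v.fst.snd.valApply v.snd).not.or ((hA.via v.fst.fst).dfaAccept v.snd)

/-! #### Solving games -/

section Solve

variable {α : Type} {inp : α → Data} {nX nY : α → ℕ} {A : ∀ a, ExplicitDFA (nX a) (nY a)}

theorem feasible_winStep {W : ∀ a, Fin (A a).n → Option (Val (Fin (nY a)))}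
    (hA : Feasible inp fun a => (A a).data)
    (hW : Feasible inp fun a => .ofFn fun s => .ofOption Data.ofVal (W a s)) :
    Feasible inp fun a => .ofFn fun s => .ofOption Data.ofVal ((A a).winStep (W a) s) := by
  refine feasible_ofFn hA.dfaN (feasible_env fun v => ?_)
  have hA₁ := hA.via v.fst
  have hs := (hW.via v.fst).apply (f := fun q s => .ofOption Data.ofVal (W q.1 s)) v.snd
  have h : Feasible (fun q => .cons (inp q.1) (.ofNat q.2.1))
      fun q : (a : α) × Fin (A a).n => .ofOption Data.ofVal
      ((vals (nY q.1)).find? fun y => (vals (nX q.1)).all fun x =>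
        (A q.1).accept ((A q.1).step q.2 x y) || (W q.1 ((A q.1).step q.2 x y)).isSome) := by
    refine (feasible_vals hA₁.dfaY hA₁.polyLE_dfaY).find?
      (β := fun q : (a : α) × Fin (A a).n => Val (Fin (nY q.1))) (enc := fun _ => Data.ofVal) (feasible_env fun v => ?_)
    have hA₂ := hA.via v.fst.fst
    refine (feasible_vals hA₂.dfaX hA₂.polyLE_dfaX).all (feasible_env fun v => ?_)
    have hA₃ := hA.via v.fst.fst.fst
    have hst := hA₃.dfaStep v.fst.fst.snd v.snd v.fst.snd
    refine (hA₃.dfaAccept hst).or (FeasibleIn.optionIsSome (enc := fun _ => Data.ofVal) ?_)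
    exact (hW.via v.fst.fst.fst).apply (f := fun q s => .ofOption Data.ofVal (W q.1.1.1 s)) hst
  convert (FeasibleIn.optionIsSome (enc := fun _ => Data.ofVal) hs).cond hs h using 2 with q
  simp only [ExplicitDFA.winStep]
  cases (W q.1 q.2).isSome <;> rfl

theorem feasible_moves (hA : Feasible inp fun a => (A a).data) :
    Feasible inp fun a => .ofFn fun s => .ofOption Data.ofVal ((A a).moves s) := by
  have hn := polyLE_of_feasible_ofNat hA.dfaN
  have hY := polyLE_of_feasible_ofNat hA.dfaY
  refine FeasibleIn.iterate (σ := fun a => Fin (A a).n → Option (Val (Fin (nY a))))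
    (enc := fun a W => .ofFn fun s => .ofOption Data.ofVal (W s)) (s := fun _ _ => none)
    (F := fun a => (A a).winStep) hA.dfaN (feasible_ofFn hA.dfaN feasible_nil)
    (feasible_env fun v => feasible_winStep (hA.via v.fst) v.snd)
    ((hn.mul (((hY.mul (.const 4)).add (.const 3)).add (.const 1))).add (.const 1)) ?_
  intro a i _
  -- A move takes at most 4 bits per output variable, the end of the list, and two bits for the
  -- option.
  refine (Data.size_ofList_le (B := nY a * 4 + 3) fun d hd => ?_).trans (by simp)
  obtain ⟨s, rfl⟩ := List.mem_ofFn.1 hd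
  rcases (A a).winStep^[i] (fun _ => none) s with _ | y
  · simp [Data.ofOption]
  · have := Data.size_ofVal_le y
    simp only [Data.ofOption, Data.size_cons, Data.size_nil]
    omega

theorem feasible_solve (hA : Feasible inp fun a => (A a).data) :
    Feasible inp fun a => answerData (A a).solve := by
  have hW := feasible_moves hA
  have hout {β : Type} {inp' : β → Data} {φ : β → α} {s : ∀ b, Fin (A (φ b)).n}
      (hφ : Feasible inp' fun b => inp (φ b)) (hs : Feasible inp' fun b => .ofNat (s b).1) :
      Feasible inp' fun b => .ofVal (((A (φ b)).moves (s b)).getD fun _ => false) := by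
    refine FeasibleIn.optionGetD (enc := fun _ => Data.ofVal) (d := fun b _ => false) ?_ ?_
    · exact (hW.via hφ).apply (f := fun b s => .ofOption Data.ofVal ((A (φ b)).moves s)) hs
    · exact feasible_ofVal (hA.via hφ).dfaY (feasible_const (.ofBool false))
  have hwin : Feasible inp fun a => (A a).winner.data := by
    refine hA.dfaX.cons (hA.dfaY.cons (hA.dfaN.cons (hA.dfaStart.cons (FeasibleIn.cons ?_
      (FeasibleIn.cons ?_ feasible_nil)))))
    · refine feasible_ofFn hA.dfaN (feasible_env fun v => ?_)
      have hA₁ := hA.via v.fst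
      refine feasible_ofTable hA₁.dfaX hA₁.polyLE_dfaX (feasible_env fun v => ?_)
      exact (hA.via v.fst.fst).dfaStep v.fst.snd v.snd (hout v.fst.fst v.fst.snd)
    · exact feasible_ofFn hA.dfaN (feasible_env fun v => hout v.fst v.snd)
  convert (FeasibleIn.optionIsSome (enc := fun _ => Data.ofVal) (hW.apply
    (f := fun a s => .ofOption Data.ofVal ((A a).moves s)) hA.dfaStart)).cond
      (feasible_nil.cons hwin) feasible_nil using 2 with a
  unfold ExplicitDFA.solve
  cases ((A a).moves (A a).start).isSome <;> rfl

end Solve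

end UnreliableSynthesis

namespace UnreliableSynthesis

/-! ### Automata for formulas

A trace is read backwards: from the truth values of the subformulas at the next position and the
letter at a position one obtains the truth values at the position. The automaton reads the trace
forwards and maintains the map from values at the current position to values at the first one. -/

section FormulaDFA

variable {P : Type}

/-- The occurrences of subformulas, every formula before its subformulas. -/
def LTLf.subs : LTLf P → List (LTLf P)
  | .atom A => [.atom A]
  | .neg φ => .neg φ :: φ.subs
  | .and φ ψ => .and φ ψ :: (φ.subs ++ ψ.subs)
  | .next φ => .next φ :: φ.subs
  | .until φ ψ => .until φ ψ :: (φ.subs ++ ψ.subs)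

/-- The formula whose value at the next position is relevant for the value at a position. -/
def LTLf.pending : LTLf P → LTLf P
  | .next φ => φ
  | φ => φ

/-- The value of a formula at a position. -/
noncomputable def holds (t : List (Val P)) (i : ℕ) (φ : LTLf P) : Bool := by
  classical exact decide (Sat t φ i)

theorem holds_iff {t : List (Val P)} {i : ℕ} {φ : LTLf P} :
    holds t i φ = true ↔ Sat t φ i := by
  simp [holds]

/-- The value of `φ.pending` at a position, which is false if the position does not exist. -/
noncomputable def memo (t : List (Val P)) (i : ℕ) (φ : LTLf P) : Bool :=
  decide (i < t.length) && holds t i φ.pending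

/-- A stack of values, values of pending formulas at a position, and remaining values of pending
formulas at the next position. -/
abbrev BackState : Type := List Bool × List Bool × List Bool

/-- Evaluate a formula, with the values of its immediate subformulas on the stack. -/
def nodeStep (a : Val P) : LTLf P → BackState → BackState
  | .atom A, s => (a A :: s.1, a A :: s.2.1, s.2.2.tail)
  | .neg _, s => ((!s.1.headD false) :: s.1.tail, (!s.1.headD false) :: s.2.1, s.2.2.tail)
  | .and _ _, s => ((s.1.headD false && s.1.tail.headD false) :: s.1.tail.tail,
      (s.1.headD false && s.1.tail.headD false) :: s.2.1, s.2.2.tail)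
  | .next _, s => (s.2.2.headD false :: s.1.tail, s.1.headD false :: s.2.1, s.2.2.tail)
  | .until _ _, s =>
      ((s.1.tail.headD false || (s.1.headD false && s.2.2.headD false)) :: s.1.tail.tail,
      (s.1.tail.headD false || (s.1.headD false && s.2.2.headD false)) :: s.2.1, s.2.2.tail)

/-! ### Backward evaluation at one position -/

section Holds

variable {t : List (Val P)} {i : ℕ}

theorem holds_atom (hi : i < t.length) (A : P) : holds t i (.atom A) = t[i] A := by
  rw [Bool.eq_iff_iff, holds_iff]
  simp [Sat, hi]

theorem holds_neg (φ : LTLf P) : holds t i (.neg φ) = !holds t i φ := by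
  rw [Bool.eq_iff_iff, holds_iff, Bool.not_eq_true', ← Bool.not_eq_true, holds_iff]
  rfl

theorem holds_and (φ ψ : LTLf P) : holds t i (.and φ ψ) = (holds t i φ && holds t i ψ) := by
  rw [Bool.eq_iff_iff, holds_iff, Bool.and_eq_true, holds_iff, holds_iff]
  rfl

theorem holds_next (φ : LTLf P) : holds t i (.next φ) = memo t (i + 1) (.next φ) := by
  rw [Bool.eq_iff_iff, holds_iff, memo, Bool.and_eq_true, decide_eq_true_eq, holds_iff]
  rfl

/-- This is the expansion law of until. At the last position the second alternative vanishes,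
because `memo` is false beyond the end. -/
theorem holds_until (hi : i < t.length) (φ ψ : LTLf P) : holds t i (.until φ ψ) =
    (holds t i ψ || (holds t i φ && memo t (i + 1) (.until φ ψ))) := by
  rw [Bool.eq_iff_iff, memo]
  simp only [Bool.or_eq_true, Bool.and_eq_true, decide_eq_true_eq, holds_iff]
  constructor
  · rintro ⟨j, hij, hj, h, h'⟩
    rcases hij.eq_or_lt with rfl | hij
    · exact .inl h
    · exact .inr ⟨h' i le_rfl hij, by omega, j, hij, hj, h, fun k hk => h' k (by omega)⟩
  · rintro (h | ⟨h, -, j, hij, hj, h₁, h₂⟩)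
    · exact ⟨i, le_rfl, hi, h, fun k _ _ => by omega⟩
    · refine ⟨j, by omega, hj, h₁, fun k hk hkj => ?_⟩
      rcases hk.eq_or_lt with rfl | hk
      · exact h
      · exact h₂ k hk hkj

theorem memo_eq (hi : i < t.length) (φ : LTLf P) : memo t i φ = holds t i φ.pending := by
  rw [memo, decide_eq_true hi, Bool.true_and]

/-- A right fold over the preorder visits subformulas before their formula, so it is a postfix
evaluation on a stack. It meets the formulas from last to first, which is why the values from the
next position are supplied in reversed order. The rests `stk`, `es`, `rr` allow the two arguments of
a binary connective to be evaluated one after the other. -/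
theorem foldr_nodeStep (hi : i < t.length) (φ : LTLf P) : ∀ stk es rr : List Bool,
    φ.subs.foldr (nodeStep t[i]) (stk, es, (φ.subs.map (memo t (i + 1))).reverse ++ rr) =
      (holds t i φ :: stk, φ.subs.map (memo t i) ++ es, rr) := by
  induction φ with
  | atom A =>
    intro stk es rr
    simp [LTLf.subs, nodeStep, memo_eq hi, LTLf.pending, holds_atom hi]
  | neg φ ih =>
    intro stk es rr
    simp [LTLf.subs, ih, nodeStep, memo_eq hi, LTLf.pending, holds_neg]
  | and φ ψ ihφ ihψ =>
    intro stk es rr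
    simp [LTLf.subs, ihφ, ihψ, nodeStep, memo_eq hi, LTLf.pending, holds_and]
  | next φ ih =>
    intro stk es rr
    simp [LTLf.subs, ih, nodeStep, memo_eq hi, LTLf.pending, holds_next]
  | _ φ ψ ihφ ihψ =>
    intro stk es rr
    simp [LTLf.subs, ihφ, ihψ, nodeStep, memo_eq hi, LTLf.pending, holds_until hi]

end Holds

/-- The number of values that are maintained for a formula. -/
def LTLf.width (φ : LTLf P) : ℕ := φ.subs.length + 1

theorem LTLf.width_pos (φ : LTLf P) : 0 < φ.width := Nat.succ_pos _

/-- The value of a formula, followed by the values of its pending subformulas. -/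
def backList (φ : LTLf P) (a : Val P) (v : List Bool) : List Bool :=
  (φ.subs.foldr (nodeStep a) ([], [], v.reverse)).1.headD false ::
    (φ.subs.foldr (nodeStep a) ([], [], v.reverse)).2.1

/-- Values at a position, computed from the values at the next position. -/
def back (φ : LTLf P) (a : Val P) (v : Val (Fin φ.width)) : Val (Fin φ.width) :=
  fun j => (backList φ a (List.ofFn v)).getD j.1 false

/-- The vector of all `false` is correct just beyond the end, where every `memo` is false. From
there the fold computes the values at each position back to the first one. -/
theorem foldr_back (t : List (Val P)) (φ : LTLf P) :
    List.ofFn (t.foldr (back φ) fun _ => false) =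
      (decide (0 < t.length) && holds t 0 φ) :: φ.subs.map (memo t 0) := by
  have key (j : ℕ) : ∀ i, i + j = t.length →
      List.ofFn ((t.drop i).foldr (back φ) fun _ => false) =
        (decide (i < t.length) && holds t i φ) :: φ.subs.map (memo t i) := by
    induction j with
    | zero =>
      intro i hi
      have h : decide (i < t.length) = false := decide_eq_false (by omega)
      have h' : memo t i = fun _ => false := by
        funext χ
        rw [memo, h, Bool.false_and]
      rw [List.drop_eq_nil_of_le (by omega), List.foldr_nil, List.ofFn_const, LTLf.width,
        List.replicate_succ, h, h', List.map_const', Bool.false_and]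
    | succ j ih =>
      intro i hi
      have hi' : i < t.length := by omega
      -- The value of the whole formula heads the vector, so after the reversal it comes last and is
      -- the part `rr` that is never consumed. It needs an entry of its own, because for a next
      -- formula `memo` stores the value of its argument.
      have h₁ := foldr_nodeStep hi' φ [] [] [decide (i + 1 < t.length) && holds t (i + 1) φ]
      have h₂ : backList φ t[i] (List.ofFn ((t.drop (i + 1)).foldr (back φ) fun _ => false)) =
          (decide (i < t.length) && holds t i φ) :: φ.subs.map (memo t i) := by
        rw [ih (i + 1) (by omega), backList, List.reverse_cons, h₁]
        simp [hi']
      rw [List.drop_eq_getElem_cons hi', List.foldr_cons]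
      refine List.ext_getElem (by rw [List.length_ofFn]; simp [LTLf.width]) fun k hk hk' => ?_
      rw [List.getElem_ofFn]
      change (backList φ t[i] _).getD k false = _
      rw [h₂, List.getD_eq_getElem?_getD, List.getElem?_eq_getElem hk', Option.getD_some]
  exact key t.length 0 (Nat.zero_add _)

end FormulaDFA

/-- The automaton of a formula. The states are the sets of valuations of `φ.width` variables. -/
noncomputable def formulaDFA {nX nY : ℕ} (φ : LTLf (Fin nX ⊕ Fin nY)) : ExplicitDFA nX nY where
  n := 2 ^ 2 ^ φ.width
  -- For the empty prefix the map from later values to first values is the identity, and only entry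
  -- 0 is observed.
  start := valEquiv _ fun j => (valEquiv φ.width).symm j ⟨0, φ.width_pos⟩
  step B x y := valEquiv _ fun j => (valEquiv (2 ^ φ.width)).symm B
    (valEquiv _ (back φ (Sum.elim x y) ((valEquiv φ.width).symm j)))
  -- At the end of the trace, the values to be inserted are those beyond its last position, all
  -- false. On the empty word this gives rejection.
  accept B := (valEquiv (2 ^ φ.width)).symm B (valEquiv _ fun _ => false)

/-- The invariant: the state after a prefix, as a set of vectors, contains `v` iff evaluating the
prefix backwards from `v` gives a true formula at the first position. A new letter acts innermost in
the backward fold, so a transition precomposes with `back`. -/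
theorem formulaDFA_recognizes {nX nY : ℕ} (φ : LTLf (Fin nX ⊕ Fin nY)) :
    RecognizesFormula (formulaDFA φ).toDFA φ := by
  intro t
  have key (t : List (Val (Fin nX ⊕ Fin nY))) : ∀ v,
      (valEquiv (2 ^ φ.width)).symm ((formulaDFA φ).toDFA.eval t) (valEquiv _ v) =
        t.foldr (back φ) v ⟨0, φ.width_pos⟩ := by
    induction t using List.reverseRecOn with
    | nil =>
      intro v
      change (valEquiv (2 ^ φ.width)).symm (valEquiv (2 ^ φ.width) fun j =>
        (valEquiv φ.width).symm j ⟨0, φ.width_pos⟩) (valEquiv _ v) = v ⟨0, φ.width_pos⟩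
      rw [Equiv.symm_apply_apply, Equiv.symm_apply_apply]
    | append_singleton t a ih =>
      intro v
      rw [DFA.eval_append_singleton, List.foldr_append, List.foldr_cons, List.foldr_nil, ← ih]
      change (valEquiv (2 ^ φ.width)).symm (valEquiv (2 ^ φ.width) fun j =>
        (valEquiv (2 ^ φ.width)).symm ((formulaDFA φ).toDFA.eval t) (valEquiv _ (back φ
          (Sum.elim (fun i => a (.inl i)) fun j => a (.inr j)) ((valEquiv φ.width).symm j))))
          (valEquiv _ v) = _
      rw [Equiv.symm_apply_apply, Equiv.symm_apply_apply]
      have ha : (Sum.elim (fun i => a (.inl i)) fun j => a (.inr j)) = a := Sum.elim_comp_inl_inr a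
      rw [ha]
  have h := key t fun _ => false
  have h₀ : t.foldr (back φ) (fun _ => false) ⟨0, φ.width_pos⟩ = true ↔
      0 < t.length ∧ Sat t φ 0 := by
    have h₁ := congrArg List.head? (foldr_back t φ)
    have h₂ {m : ℕ} (hm : 0 < m) (v : Val (Fin m)) : (List.ofFn v).head? = some (v ⟨0, hm⟩) := by
      cases m with
      | zero => exact absurd hm (lt_irrefl 0)
      | succ m => rw [List.ofFn_succ]; rfl
    rw [List.head?_cons, h₂ (φ.width_pos), Option.some_inj] at h₁
    rw [← holds_iff, ← decide_eq_true_iff (p := 0 < t.length), ← Bool.and_eq_true]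
    exact Eq.congr_left h₁
  rw [← List.length_pos_iff_ne_nil, Models, ← h₀, ← h]
  rfl

end UnreliableSynthesis

namespace UnreliableSynthesis

/-! ### Running time of the translation of formulas -/

/-- Lists of Booleans as trees. -/
def Data.ofBools (l : List Bool) : Data := .ofList (l.map Data.ofBool)

/-- The list whose tree is given. -/
def Data.toList : Data → List Data
  | .nil => []
  | .cons a b => a :: b.toList

@[simp] theorem Data.ofList_toList (d : Data) : .ofList d.toList = d := by
  induction d with
  | nil => rfl
  | cons a b _ ih => rw [toList, ofList, ih]

theorem Data.length_toList_ofNat (n : ℕ) : (Data.ofNat n).toList.length = n := by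
  induction n with
  | zero => rfl
  | succ n ih => rw [ofNat, toList, List.length_cons, ih]

theorem Data.size_ofBools_le (l : List Bool) : (Data.ofBools l).size ≤ l.length * 4 + 1 := by
  refine (Data.size_ofList_le (B := 3) fun d hd => ?_).trans (by simp)
  obtain ⟨b, _, rfl⟩ := List.mem_map.1 hd
  exact Data.size_ofBool_le _

section Bools

variable {α : Type} {inp : α → Data}

theorem FeasibleIn.length {l : α → List Data} (hl : Feasible inp fun a => .ofList (l a)) :
    Feasible inp fun a => .ofNat (l a).length := by
  have h := FeasibleIn.map (β := fun _ => Data) (enc := fun _ d => d) (l := l)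
    (g := fun _ _ => .nil) (by simpa only [List.map_id'] using hl) feasible_nil
  simpa only [List.map_const', ← Data.ofNat_eq] using h

theorem FeasibleIn.headD {l : α → List Bool} (hl : Feasible inp fun a => .ofBools (l a)) :
    Feasible inp fun a => .ofBool ((l a).headD false) := by
  convert hl.hd using 2 with a
  cases l a <;> rfl

theorem FeasibleIn.tail {l : α → List Bool} (hl : Feasible inp fun a => .ofBools (l a)) :
    Feasible inp fun a => .ofBools (l a).tail := by
  convert hl.tl using 2 with a
  cases l a <;> rfl

theorem FeasibleIn.ofVal_getD {k : α → ℕ} {l : α → List Bool}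
    (hk : Feasible inp fun a => .ofNat (k a)) (hl : Feasible inp fun a => .ofBools (l a)) :
    Feasible inp fun a => .ofVal fun j : Fin (k a) => (l a).getD j.1 false := by
  refine feasible_ofVal hk (feasible_env fun v => ?_)
  convert FeasibleIn.getD (hl.via v.fst) v.snd using 2 with q
  rw [List.getD_eq_getElem?_getD, List.getD_eq_getElem?_getD, List.getElem?_map]
  cases (l q.1)[q.2.1]? <;> rfl

end Bools

/-! #### Reading formulas -/

section Formulas

variable {α : Type} {inp : α → Data}

theorem FeasibleIn.tagCases {d f₀ f₁ f₂ f₃ f₄ f₅ : α → Data} (h : Feasible inp d)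
    (h₀ : Feasible inp f₀) (h₁ : Feasible inp f₁) (h₂ : Feasible inp f₂) (h₃ : Feasible inp f₃)
    (h₄ : Feasible inp f₄) (h₅ : Feasible inp f₅) :
    Feasible inp fun a => bif (d a).isNil then f₀ a else bif (d a).tl.isNil then f₁ a else
      bif (d a).tl.tl.isNil then f₂ a else bif (d a).tl.tl.tl.isNil then f₃ a else
      bif (d a).tl.tl.tl.tl.isNil then f₄ a else f₅ a :=
  h.condNil h₀ (h.tl.condNil h₁ (h.tl.tl.condNil h₂ (h.tl.tl.tl.condNil h₃
    (h.tl.tl.tl.tl.condNil h₄ h₅))))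

/-- The immediate subformulas. -/
def LTLf.children {P : Type} : LTLf P → List (LTLf P)
  | .atom _ => []
  | .neg φ => [φ]
  | .and φ ψ => [φ, ψ]
  | .next φ => [φ]
  | .until φ ψ => [φ, ψ]

/-- Move the first formula of a work list to the result. -/
def expandStep {P : Type} : List (LTLf P) × List (LTLf P) → List (LTLf P) × List (LTLf P)
  | ([], o) => ([], o)
  | (φ :: w, o) => (φ.children ++ w, φ :: o)

/-- The recursion over a formula is replaced by a work list treated as a stack; one occurrence of a
subformula is finished per step, in preorder. -/
theorem iterate_expandStep {P : Type} (φ : LTLf P) : ∀ w o : List (LTLf P),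
    expandStep^[φ.subs.length] (φ :: w, o) = (w, φ.subs.reverse ++ o) := by
  induction φ with
  | atom A => exact fun w o => rfl
  | neg φ ih =>
    intro w o
    simp [LTLf.subs, expandStep, LTLf.children, ih]
  | and φ ψ ihφ ihψ =>
    intro w o
    simp [LTLf.subs, expandStep, LTLf.children, ihφ, ihψ, Nat.add_comm φ.subs.length,
      Function.iterate_add_apply]
  | next φ ih =>
    intro w o
    simp [LTLf.subs, expandStep, LTLf.children, ih]
  | _ φ ψ ihφ ihψ =>
    intro w o
    simp [LTLf.subs, expandStep, LTLf.children, ihφ, ihψ, Nat.add_comm φ.subs.length,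
      Function.iterate_add_apply]

theorem LTLf.length_subs_le {nX nY : ℕ} (φ : LTLf (Fin nX ⊕ Fin nY)) :
    φ.subs.length ≤ φ.data.size := by
  induction φ with
  | atom A => exact Data.size_pos _
  | neg φ ih =>
    simp only [subs, data, Data.size_cons, List.length_cons]
    omega
  | and φ ψ ihφ ihψ =>
    simp only [subs, data, Data.size_cons, List.length_cons, List.length_append]
    omega
  | next φ ih =>
    simp only [subs, data, Data.size_cons, List.length_cons]
    omega
  | _ φ ψ ihφ ihψ =>
    simp only [subs, data, Data.size_cons, List.length_cons, List.length_append]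
    omega

theorem LTLf.size_le_of_mem_children {nX nY : ℕ} {φ χ : LTLf (Fin nX ⊕ Fin nY)}
    (h : χ ∈ φ.children) : χ.data.size ≤ φ.data.size := by
  cases φ with
  | atom A => simp [children] at h
  | neg φ =>
    obtain rfl : χ = φ := by simpa [children] using h
    simp only [data, Data.size_cons]
    omega
  | and φ ψ =>
    obtain rfl | rfl : χ = φ ∨ χ = ψ := by simpa [children] using h
    all_goals simp only [data, Data.size_cons]; omega
  | next φ =>
    obtain rfl : χ = φ := by simpa [children] using h
    simp only [data, Data.size_cons]
    omega
  | _ φ ψ =>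
    obtain rfl | rfl : χ = φ ∨ χ = ψ := by simpa [children] using h
    all_goals simp only [data, Data.size_cons]; omega

theorem LTLf.length_children_le {P : Type} (φ : LTLf P) : φ.children.length ≤ 2 := by
  cases φ <;> simp [children]

/-- Each step lengthens the lists by at most one, and all entries are subformulas of `φ`. Thus the
intermediate data are quadratic in the size of `φ`. -/
theorem iterate_expandStep_bound {nX nY : ℕ} (φ : LTLf (Fin nX ⊕ Fin nY)) (i : ℕ) :
    (expandStep^[i] ([φ], [])).1.length ≤ i + 1 ∧ (expandStep^[i] ([φ], [])).2.length ≤ i ∧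
      ∀ χ, χ ∈ (expandStep^[i] ([φ], [])).1 ∨ χ ∈ (expandStep^[i] ([φ], [])).2 →
        χ.data.size ≤ φ.data.size := by
  induction i with
  | zero => simp
  | succ i ih =>
    rw [Function.iterate_succ_apply']
    revert ih
    rcases expandStep^[i] ([φ], []) with ⟨_ | ⟨χ, w⟩, o⟩ <;> intro ih
    · exact ⟨by simp [expandStep], ih.2.1.trans (Nat.le_succ i), ih.2.2⟩
    · obtain ⟨h₁, h₂, h₃⟩ := ih
      have := χ.length_children_le
      simp only [expandStep, List.length_append, List.length_cons] at h₁ h₂ ⊢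
      refine ⟨by omega, by omega, fun ξ hξ => ?_⟩
      simp only [List.mem_append, List.mem_cons] at h₃ hξ
      rcases hξ with (h | h) | h | h
      · exact (LTLf.size_le_of_mem_children h).trans (h₃ χ (.inl (.inl rfl)))
      · exact h₃ ξ (.inl (.inr h))
      · exact h ▸ h₃ χ (.inl (.inl rfl))
      · exact h₃ ξ (.inr h)

/-- Pairs of lists of formulas as trees. -/
def expandData {nX nY : ℕ} (s : List (LTLf (Fin nX ⊕ Fin nY)) × List (LTLf (Fin nX ⊕ Fin nY))) :
    Data := .cons (.ofList (s.1.map LTLf.data)) (.ofList (s.2.map LTLf.data))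

variable {nX nY : α → ℕ}

theorem feasible_expandStep
    {s : ∀ a, List (LTLf (Fin (nX a) ⊕ Fin (nY a))) × List (LTLf (Fin (nX a) ⊕ Fin (nY a)))}
    (h : Feasible inp fun a => expandData (s a)) :
    Feasible inp fun a => expandData (expandStep (s a)) := by
  have hw := h.fst
  have ho := h.snd
  have hd := hw.hd
  -- Tags 2 and 4 belong to unary connectives and tags 3 and 5 to binary ones; atoms, with tags 0
  -- and 1, leave only the tail of the work list.
  have one := hd.tl.cons hw.tl
  have two := hd.tl.hd.cons (hd.tl.tl.cons hw.tl)
  convert hw.condNil h ((hd.hd.tagCases hw.tl hw.tl one two one two).cons (hd.cons ho)) using 2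
    with a
  rcases s a with ⟨_ | ⟨(i | j) | _ | _ | _ | _, w⟩, o⟩ <;> rfl

/-- The exact number of steps is not known in advance, but the size of the tree is computable and
large enough; once the work list is empty, further steps change nothing. -/
theorem feasible_subs {φ : ∀ a, LTLf (Fin (nX a) ⊕ Fin (nY a))}
    (hφ : Feasible inp fun a => (φ a).data) :
    Feasible inp fun a => .ofList ((φ a).subs.map LTLf.data) := by
  have hD := polyLE_of_feasible_ofNat hφ.count
  have h := FeasibleIn.iterate
    (σ := fun a => List (LTLf (Fin (nX a) ⊕ Fin (nY a))) × List (LTLf (Fin (nX a) ⊕ Fin (nY a))))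
    (enc := fun _ => expandData) (s := fun a => ([φ a], [])) (F := fun _ => expandStep)
    hφ.count ((hφ.cons feasible_nil).cons feasible_nil)
    (feasible_env fun v => feasible_expandStep v.snd)
    (((PolyLE.const 2).mul (((hD.add (.const 1)).mul (hD.add (.const 1))).add (.const 1))).add
      (.const 1)) ?_
  · have it (a) : expandStep^[(φ a).data.size] ([φ a], []) = ([], (φ a).subs.reverse) := by
      have fix (o : List (LTLf (Fin (nX a) ⊕ Fin (nY a)))) (i : ℕ) :
          expandStep^[i] ([], o) = ([], o) := Function.iterate_fixed rfl i
      rw [← Nat.sub_add_cancel (φ a).length_subs_le, Function.iterate_add_apply,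
        iterate_expandStep, fix, List.append_nil]
    simp only [it] at h
    simpa only [expandData, List.map_reverse, List.reverse_reverse] using h.snd.reverse
  · intro a i hi
    obtain ⟨h₁, h₂, h₃⟩ := iterate_expandStep_bound (φ a) i
    have key (l : List (LTLf (Fin (nX a) ⊕ Fin (nY a)))) (hl : l.length ≤ i + 1)
        (h : ∀ χ ∈ l, χ.data.size ≤ (φ a).data.size) : (Data.ofList (l.map LTLf.data)).size ≤
          ((φ a).data.size + 1) * ((φ a).data.size + 1) + 1 := by
      refine (Data.size_ofList_le (B := (φ a).data.size) fun d hd => ?_).trans ?_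
      · obtain ⟨χ, hχ, rfl⟩ := List.mem_map.1 hd
        exact h χ hχ
      · rw [List.length_map]
        exact Nat.add_le_add_right (Nat.mul_le_mul_right _ (by omega)) 1
    have h₄ := key _ h₁ fun χ hχ => h₃ χ (.inl hχ)
    have h₅ := key _ (by omega) fun χ hχ => h₃ χ (.inr hχ)
    rw [expandData, Data.size_cons]
    omega

/-! #### Transitions -/

/-- Intermediate results of the evaluation of subformulas as trees. -/
def BackState.data (s : BackState) : Data :=
  .cons (.ofBools s.1) (.cons (.ofBools s.2.1) (.ofBools s.2.2))

theorem feasible_nodeStep {x : ∀ a, Val (Fin (nX a))} {y : ∀ a, Val (Fin (nY a))}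
    {φ : ∀ a, LTLf (Fin (nX a) ⊕ Fin (nY a))} {s : α → BackState}
    (hx : Feasible inp fun a => .ofVal (x a)) (hy : Feasible inp fun a => .ofVal (y a))
    (hφ : Feasible inp fun a => (φ a).data) (hs : Feasible inp fun a => BackState.data (s a)) :
    Feasible inp fun a =>
      BackState.data (nodeStep (Sum.elim (x a) (y a)) (φ a) (s a)) := by
  have h₁ : Feasible inp fun a => .ofBools (s a).1 := hs.fst
  have h₂ : Feasible inp fun a => .ofBools (s a).2.1 := hs.snd.fst
  have h₃ : Feasible inp fun a => .ofBools (s a).2.2 := hs.snd.snd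
  -- The index of an atom is in unary and thus the length of a list. For other formulas this number
  -- is computed as well, but the case distinction discards it.
  have hb : Feasible inp fun a => .ofNat (φ a).data.tl.toList.length :=
    FeasibleIn.length (by simpa only [Data.ofList_toList] using hφ.tl)
  have leaf {k : α → ℕ} {v : ∀ a, Val (Fin (k a))} (hv : Feasible inp fun a => .ofVal (v a)) :=
    FeasibleIn.getD hv hb
  have out {b c : α → Data} {l : α → List Bool} (hb : Feasible inp b) (hc : Feasible inp c)
      (hl : Feasible inp fun a => .ofBools (l a)) :
      Feasible inp fun a => .cons (.cons (b a) (.ofBools (l a)))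
        (.cons (.cons (c a) (.ofBools (s a).2.1)) (.ofBools (s a).2.2.tail)) :=
    (hb.cons hl).cons ((hc.cons h₂).cons h₃.tail)
  have hu := h₁.tail.headD.or (h₁.headD.and h₃.headD)
  have hn := h₁.headD.not
  have ha := h₁.headD.and h₁.tail.headD
  convert hφ.hd.tagCases (out (leaf hx) (leaf hx) h₁) (out (leaf hy) (leaf hy) h₁)
    (out hn hn h₁.tail) (out ha ha h₁.tail.tail) (out h₃.headD h₁.headD h₁.tail)
    (out hu hu h₁.tail.tail) using 2 with a
  rcases φ a with (i | j) | _ | _ | _ | _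
  · have h : (List.ofFn fun i => Data.ofBool (x a i)).getD
        (Data.ofNat i.1).toList.length .nil = .ofBool (x a i) := by
      rw [Data.length_toList_ofNat]
      simp
    change _ = Data.cons (.cons (List.getD _ (Data.ofNat i.1).toList.length _) _)
      (.cons (.cons (List.getD _ (Data.ofNat i.1).toList.length _) _) _)
    rw [h]
    rfl
  · have h : (List.ofFn fun i => Data.ofBool (y a i)).getD
        (Data.ofNat j.1).toList.length .nil = .ofBool (y a j) := by
      rw [Data.length_toList_ofNat]
      simp
    change _ = Data.cons (.cons (List.getD _ (Data.ofNat j.1).toList.length _) _)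
      (.cons (.cons (List.getD _ (Data.ofNat j.1).toList.length _) _) _)
    rw [h]
    rfl
  all_goals rfl

theorem foldr_nodeStep_length {P : Type} (a : Val P) (r : List Bool) (t : List (LTLf P)) :
    (t.foldr (nodeStep a) ([], [], r)).1.length ≤ t.length ∧
      (t.foldr (nodeStep a) ([], [], r)).2.1.length ≤ t.length ∧
      (t.foldr (nodeStep a) ([], [], r)).2.2.length ≤ r.length := by
  induction t with
  | nil => simp
  | cons φ t ih =>
    obtain ⟨h₁, h₂, h₃⟩ := ih
    rw [List.foldr_cons]
    cases φ <;> simp only [nodeStep, List.length_cons, List.length_tail] <;>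
      exact ⟨by omega, by omega, by omega⟩

theorem feasible_width {φ : ∀ a, LTLf (Fin (nX a) ⊕ Fin (nY a))}
    (hφ : Feasible inp fun a => (φ a).data) : Feasible inp fun a => .ofNat (φ a).width := by
  simpa only [LTLf.width, List.length_map] using (feasible_subs hφ).length.succ

theorem feasible_back {x : ∀ a, Val (Fin (nX a))} {y : ∀ a, Val (Fin (nY a))}
    {φ : ∀ a, LTLf (Fin (nX a) ⊕ Fin (nY a))} {v : ∀ a, Val (Fin (φ a).width)}
    (hx : Feasible inp fun a => .ofVal (x a)) (hy : Feasible inp fun a => .ofVal (y a))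
    (hφ : Feasible inp fun a => (φ a).data) (hv : Feasible inp fun a => .ofVal (v a)) :
    Feasible inp fun a => .ofVal (back (φ a) (Sum.elim (x a) (y a)) (v a)) := by
  have hm := feasible_width hφ
  have hr : Feasible inp fun a => .ofBools (List.ofFn (v a)).reverse := by
    simp only [Data.ofBools, List.map_reverse, List.map_ofFn]
    exact FeasibleIn.reverse hv
  have hB := ((polyLE_of_feasible_ofNat hm).mul (.const 4)).add (.const 1)
  have h := FeasibleIn.foldr (β := fun a => LTLf (Fin (nX a) ⊕ Fin (nY a)))
    (encβ := fun _ => LTLf.data) (σ := fun _ => BackState) (encσ := fun _ => BackState.data)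
    (s := fun a => ([], [], (List.ofFn (v a)).reverse))
    (F := fun a => nodeStep (Sum.elim (x a) (y a))) (feasible_subs hφ)
    (feasible_nil.cons (feasible_nil.cons hr))
    (feasible_env fun w => feasible_nodeStep (hx.via w.fst) (hy.via w.fst) w.snd.fst w.snd.snd)
    ((((PolyLE.const 3).mul hB).add (.const 2))) ?_
  · have h₁ : Feasible inp fun a => .ofBools ((φ a).subs.foldr (nodeStep (Sum.elim (x a) (y a)))
      ([], [], (List.ofFn (v a)).reverse)).1 := h.fst
    exact FeasibleIn.ofVal_getD hm (h₁.headD.cons h.snd.fst)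
  · intro a t ht
    obtain ⟨h₁, h₂, h₃⟩ :=
      foldr_nodeStep_length (Sum.elim (x a) (y a)) (List.ofFn (v a)).reverse t
    have h₄ := ht.length_le
    rw [List.length_reverse, List.length_ofFn] at h₃
    have h₅ := Data.size_ofBools_le
      (t.foldr (nodeStep (Sum.elim (x a) (y a))) ([], [], (List.ofFn (v a)).reverse)).1
    have h₆ := Data.size_ofBools_le
      (t.foldr (nodeStep (Sum.elim (x a) (y a))) ([], [], (List.ofFn (v a)).reverse)).2.1
    have h₇ := Data.size_ofBools_le
      (t.foldr (nodeStep (Sum.elim (x a) (y a))) ([], [], (List.ofFn (v a)).reverse)).2.2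
    have h₈ : (φ a).width = (φ a).subs.length + 1 := rfl
    simp only [BackState.data, Data.size_cons]
    omega

/-- Polynomial time relative to an environment that already accounts for the number of states and of
letters. The hypotheses on `2 ^ nX` and `2 ^ nY` are needed because, unlike for automata, the input
contains no table over the letters. -/
theorem feasible_formulaDFA {φ : ∀ a, LTLf (Fin (nX a) ⊕ Fin (nY a))}
    (hX : Feasible inp fun a => .ofNat (nX a)) (hY : Feasible inp fun a => .ofNat (nY a))
    (hφ : Feasible inp fun a => (φ a).data)
    (pX : PolyLE (fun a => 2 ^ nX a) fun a => (inp a).size)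
    (pY : PolyLE (fun a => 2 ^ nY a) fun a => (inp a).size)
    (hp : Feasible inp fun a => .ofNat (2 ^ 2 ^ (φ a).width)) :
    Feasible inp fun a => (formulaDFA (φ a)).data := by
  have hn := polyLE_of_feasible_ofNat hp
  have hm := feasible_width hφ
  have hm' : PolyLE (fun a => 2 ^ (φ a).width) fun a => (inp a).size :=
    hn.mono fun _ => Nat.lt_two_pow_self.le
  have hk := hm.two_pow hm'
  refine hX.cons (hY.cons (hp.cons (FeasibleIn.cons ?_ (FeasibleIn.cons ?_
    (FeasibleIn.cons ?_ feasible_nil)))))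
  · refine FeasibleIn.valIdx ?_ hn
    refine feasible_ofFn_two_pow hm hm' (feasible_env fun v => ?_)
    simp only [Equiv.symm_apply_apply]
    exact v.snd.valApply (feasible_const (.ofNat 0))
  · refine feasible_ofFn_two_pow hk hn (feasible_env fun v => ?_)
    refine feasible_stepTable (hX.via v.fst) (hY.via v.fst)
      (pX.comp Sigma.fst |>.trans v.fst.size) (pY.comp Sigma.fst |>.trans v.fst.size)
      (feasible_env fun v => ?_)
    simp only [formulaDFA, Equiv.symm_apply_apply]
    have hφ₁ := hφ.via v.fst.fst.fst
    refine FeasibleIn.valIdx ?_ (hn.comp _ |>.trans v.fst.fst.fst.size)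
    refine feasible_ofFn_two_pow (hm.via v.fst.fst.fst) (hm'.comp _ |>.trans v.fst.fst.fst.size)
      (feasible_env fun w => ?_)
    simp only [Equiv.symm_apply_apply]
    refine (v.fst.fst.snd.via w.fst).valApply ?_
    exact (feasible_back (v.fst.snd.via w.fst) (v.snd.via w.fst) (hφ₁.via w.fst) w.snd).valIdx
      (hm'.comp _ |>.trans (v.fst.fst.fst.via w.fst).size)
  · refine feasible_ofFn_two_pow hk hn (feasible_env fun v => ?_)
    simp only [formulaDFA, Equiv.symm_apply_apply]
    refine v.snd.valApply (FeasibleIn.valIdx ?_ (hm'.comp _ |>.trans v.fst.size))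
    exact feasible_ofVal (hm.via v.fst) (feasible_const (.ofBool false))

/-- The double exponential is produced in two rounds, first `2 ^ width` and the numbers of letters,
then `2 ^ 2 ^ width`. Each round has height 1; the construction itself is polynomial in the result.
-/
theorem feasibleIn_two_formulaDFA {φ : ∀ a, LTLf (Fin (nX a) ⊕ Fin (nY a))}
    (hX : Feasible inp fun a => .ofNat (nX a)) (hY : Feasible inp fun a => .ofNat (nY a))
    (hφ : Feasible inp fun a => (φ a).data) :
    FeasibleIn 2 inp fun a => (formulaDFA (φ a)).data := by
  have h₁ : FeasibleIn 1 inp fun a => .cons (inp a) (.cons (.ofNat (2 ^ (φ a).width))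
      (.cons (.ofNat (2 ^ nX a)) (.ofNat (2 ^ nY a)))) :=
    (feasible_id inp).mono.cons ((feasibleIn_one_two_pow (feasible_width hφ)).cons
      ((feasibleIn_one_two_pow hX).cons (feasibleIn_one_two_pow hY)))
  have h₂ : FeasibleIn 1 (fun a => .cons (inp a) (.cons (.ofNat (2 ^ (φ a).width))
      (.cons (.ofNat (2 ^ nX a)) (.ofNat (2 ^ nY a))))) fun a =>
        (formulaDFA (φ a)).data := by
    refine FeasibleIn.compose (j := 0) (k := 1) (mid := fun a => .cons (.cons (inp a)
      (.cons (.ofNat (2 ^ (φ a).width)) (.cons (.ofNat (2 ^ nX a)) (.ofNat (2 ^ nY a)))))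
      (.ofNat (2 ^ 2 ^ (φ a).width))) (feasible_env fun v => ?_)
      ((feasible_id _).mono.cons (feasibleIn_one_two_pow (feasible_id _).snd.fst))
    exact feasible_formulaDFA (hX.via v.fst.fst) (hY.via v.fst.fst) (hφ.via v.fst.fst)
      (polyLE_of_feasible_ofNat v.fst.snd.snd.fst) (polyLE_of_feasible_ofNat v.fst.snd.snd.snd)
      v.snd
  exact h₂.compose h₁

end Formulas

end UnreliableSynthesis
namespace UnreliableSynthesis

/-! ### The main theorem -/

theorem feasibleIn_one_belief {α : Type} {inp : α → Data} {nX nY : α → ℕ}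
    {A : ∀ a, ExplicitDFA (nX a) (nY a)} {u : ∀ a, Val (Fin (nX a))}
    (hA : Feasible inp fun a => (A a).data) (hu : Feasible inp fun a => .ofVal (u a)) :
    FeasibleIn 1 inp fun a => ((A a).belief (u a)).data := by
  refine FeasibleIn.compose (j := 0) (k := 1)
    (mid := fun a => .cons (inp a) (.ofNat (2 ^ (A a).n))) (feasible_env fun v => ?_)
    ((feasible_id _).mono.cons (feasibleIn_one_two_pow hA.dfaN))
  exact feasible_belief (hA.via v.fst) (hu.via v.fst) v.snd

/-- The belief states are computed from an automaton of doubly exponential size, which gives height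
1 + 2. The main automaton is carried along, and product and solver add only a polynomial. -/
theorem feasibleIn_three_technique : FeasibleIn 3 Problem.data fun I => answerData
    (((formulaDFA I.main).prod ((formulaDFA I.backup).belief I.unr)).solve) := by
  have h := feasible_id Problem.data
  have hX : Feasible Problem.data fun I => .ofNat I.nX := h.fst
  have hY : Feasible Problem.data fun I => .ofNat I.nY := h.snd.fst
  have hu : Feasible Problem.data fun I => .ofVal I.unr := h.snd.snd.fst
  have hm : Feasible Problem.data fun I => I.main.data := h.snd.snd.snd.fst
  have hb : Feasible Problem.data fun I => I.backup.data := h.snd.snd.snd.snd.fst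
  have h₂ := hu.mono.cons
    ((feasibleIn_two_formulaDFA hX hY hm).cons (feasibleIn_two_formulaDFA hX hY hb))
  have v := feasible_id fun I : Problem =>
    .cons (.ofVal I.unr) (.cons (formulaDFA I.main).data (formulaDFA I.backup).data)
  have h₁ := v.snd.fst.mono.cons (feasibleIn_one_belief v.snd.snd v.fst)
  refine FeasibleIn.compose (j := 0) (k := 3) (feasible_env fun v => ?_) (h₁.compose h₂)
  exact feasible_solve (feasible_prod v.fst v.snd)

end UnreliableSynthesis

theorem mainTheorem10 :
    ∃ (toDFA : ∀ nX nY : ℕ, LTLf (Fin nX ⊕ Fin nY) → ExplicitDFA nX nY)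
      (belief : ∀ nX nY : ℕ, Val (Fin nX) → ExplicitDFA nX nY → ExplicitDFA nX nY)
      (product : ∀ nX nY : ℕ, ExplicitDFA nX nY → ExplicitDFA nX nY → ExplicitDFA nX nY)
      (solve : ∀ nX nY : ℕ, ExplicitDFA nX nY → Option (Transducer nX nY)),
      -- the four steps: automaton of a formula, belief states, synchronous product, game solving
      (∀ (nX nY : ℕ) (φ : LTLf (Fin nX ⊕ Fin nY)),
        RecognizesFormula (toDFA nX nY φ).toDFA φ) ∧
      (∀ (nX nY : ℕ) (u : Val (Fin nX)) (A : ExplicitDFA nX nY),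
        (belief nX nY u A).Presents (beliefDFA (markedSet u) A.toDFA)) ∧
      (∀ (nX nY : ℕ) (A B : ExplicitDFA nX nY),
        (product nX nY A B).Presents (A.toDFA.inter B.toDFA)) ∧
      (∀ (nX nY : ℕ) (G : ExplicitDFA nX nY),
        CorrectAnswer (WinsGame G.toDFA) (solve nX nY G)) ∧
      -- their running times
      ComputableInExpTime 2 FormulaInput.data
        (fun i => (toDFA i.nX i.nY i.formula).data) ∧
      ComputableInExpTime 1 BeliefInput.data
        (fun i => (belief i.nX i.nY i.unr i.dfa).data) ∧
      ComputableInExpTime 0 ProductInput.data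
        (fun i => (product i.nX i.nY i.left i.right).data) ∧
      ComputableInExpTime 0 GameInput.data
        (fun i => answerData (solve i.nX i.nY i.game)) ∧
      -- the technique solves synthesis under unreliable input in triply exponential time
      (∀ I : Problem,
        CorrectAnswer I.IsSolution (beliefTechnique toDFA belief product solve I)) ∧
      ComputableInExpTime 3 Problem.data
        (fun I => answerData (beliefTechnique toDFA belief product solve I)) := by
  refine ⟨fun _ _ φ => formulaDFA φ, fun _ _ u A => A.belief u, fun _ _ A B => A.prod B,
    fun _ _ G => G.solve, fun _ _ => formulaDFA_recognizes,
    fun _ _ => ExplicitDFA.belief_presents, fun _ _ => ExplicitDFA.prod_presents,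
    fun _ _ G => G.solve_correct, ?_, ?_, ?_, ?_, fun I => ?_,
    feasibleIn_three_technique.computableInExpTime⟩
  · have h := feasible_id FormulaInput.data
    exact (feasibleIn_two_formulaDFA h.fst h.snd.fst h.snd.snd.fst).computableInExpTime
  · have h := feasible_id BeliefInput.data
    exact (feasibleIn_one_belief (A := fun i : BeliefInput => i.dfa) h.snd.fst
      h.fst).computableInExpTime
  · have h := feasible_id ProductInput.data
    exact (feasible_prod (A := fun i : ProductInput => i.left) (B := fun i => i.right) h.fst
      h.snd.fst).computableInExpTime
  · exact (feasible_solve (A := fun i : GameInput => i.game)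
      (feasible_id GameInput.data)).computableInExpTime
  · have h := solvesUnreliable_iff_winsGame (formulaDFA_recognizes I.main)
      (formulaDFA_recognizes I.backup) ((formulaDFA I.backup).belief_presents I.unr)
      ((formulaDFA I.main).prod_presents _)
    -- The two properties agree for every strategy, so a correct answer for the game, positive or
    -- negative, is one for the instance.
    have hI : I.IsSolution = WinsGame ((formulaDFA I.main).prod
        ((formulaDFA I.backup).belief I.unr)).toDFA := funext fun σ => propext (h σ)
    rw [hI]
    exact ExplicitDFA.solve_correct _
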